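/- All hypergraphs are finite and without repeated hyperedges. A cycle of length $l\ge 2$ in a hypergraph is a cyclic sequence $v_0,e_0,v_1,e_1,\dots,v_{l-1},e_{l-1},v_0$ with distinct vertices $v_i$ and distinct hyperedges $e_i$ such that $v_i,v_{i+1}\in e_i$ (indices modulo $l$); sequences that differ by a rotation or a reversal describe the same cycle. A hypergraph is unicyclic if it is connected and has exactly one cycle; it is linear if any two different hyperedges share at most one vertex; its girth is the minimum length of a cycle. A cored vertex is a vertex of degree one. The $d$-th order trace of a tensor $\mathcal T=(t_{i_1\cdots i_k})$ of order $k$ and dimension $n$ is $$\mathrm{Tr}_d(\mathcal T)=(k-1)^{n-1}\sum_{d_1+\cdots+d_n=d}\ \prod_{i=1}^n\frac{1}{(d_i(k-1))!}\Big(\sum_{\beta\in[n]^{k-1}}t_{i\beta}\,\frac{\partial}{\partial a_{i\beta_1}}\cdots\frac{\partial}{\partial a_{i\beta_{k-1}}}\Big)^{d_i}\mathrm{tr}\big(A^{d(k-1)}\big),$$ where $A=(a_{ij})$ is an $n\times n$ matrix of independent variables. (It equals the sum of the $d$-th powers of the eigenvalues of $\mathcal T$.) For a $k$-uniform hypergraph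 $\mathcal H$ let $\mathcal A_\alpha(\mathcal H)=\alpha\mathcal D(\mathcal H)+(1-\alpha)\mathcal A(\mathcal H)$, where $\mathcal D(\mathcal H)$ is the diagonal tensor of vertex degrees and the adjacency tensor $\mathcal A(\mathcal H)$ has entry $\frac1{(k-1)!}$ at $i_1\cdots i_k$ if $\{i_1,\dots,i_k\}$ is a hyperedge, and $0$ otherwise. For two $k$-uniform hypergraphs $\mathcal H_1,\mathcal H_2$ with $n$ vertices each, $\mathcal H_1\prec_\alpha\mathcal H_2$ means that for some $1\le d\le n(k-1)^{n-1}-1$ one has $\mathrm{Tr}_t(\mathcal A_\alpha(\mathcal H_1))=\mathrm{Tr}_t(\mathcal A_\alpha(\mathcal H_2))$ for $0\le t<d$ and $\mathrm{Tr}_d(\mathcal A_\alpha(\mathcal H_1))<\mathrm{Tr}_d(\mathcal A_\alpha(\mathcal H_2))$; $\mathcal H_1=_\alpha\mathcal H_2$ means that these traces agree for all $0\le t\le n(k-1)^{n-1}-1$; and $\mathcal H_1\preceq_\alpha\mathcal H_2$ means $\mathcal H_1\prec_\alpha\mathcal H_2$ or $\mathcal H_1=_\alpha\mathcal H_2$.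 The hypercycle $C_g^{(k)}$ ($g\ge3$) has the $g$ hyperedges $\{u_i,w_{i,1},\dots,w_{i,k-2},u_{i+1}\}$, $i\in\mathbb Z/g$, all the vertices $u_i$, $w_{i,j}$ being distinct. The hyperpath $P_r^{(k)}$ has the $r$ hyperedges $\{u_{i-1},w_{i,1},\dots,w_{i,k-2},u_i\}$, $1\le i\le r$, with distinct vertices $u_0,\dots,u_r$, $w_{i,j}$; $P_0^{(k)}$ is the single vertex $u_0$. For $k\ge3$ the hypercycle has cored vertices, and $C_g^{(k)}\cdot P_{r}^{(k)}$ denotes the hypergraph obtained from disjoint copies of $C_g^{(k)}$ and $P_r^{(k)}$ by identifying a cored vertex of $C_g^{(k)}$ with the end vertex $u_0$ of $P_r^{(k)}$; in particular $C_g^{(k)}\cdot P_0^{(k)}\cong C_g^{(k)}$. **Theorem.** Let $k\ge3$, $3\le g\le m$ and $0<\alpha<1$. Among all $k$-uniform linear unicyclic hypergraphs with $m$ hyperedges and girth $g$, the first one in $S_\alpha$-order is $C_g^{(k)}\cdot P_{m-g}^{(k)}$. That is, $C_g^{(k)}\cdot P_{m-g}^{(k)}$ (for any choice of the cored vertex)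 belongs to this class, and every $\mathcal H$ in this class satisfies $C_g^{(k)}\cdot P_{m-g}^{(k)}\preceq_\alpha\mathcal H$, with $C_g^{(k)}\cdot P_{m-g}^{(k)}=_\alpha\mathcal H$ if and only if $\mathcal H\cong C_g^{(k)}\cdot P_{m-g}^{(k)}$. -/

import Mathlib

universe u

/-! ### Tensors and their traces -/

/-- A real tensor of order `k` whose indices range over `V`: the first index is separated from the
remaining `k - 1` ones, so `A i β` is the entry `a_{i β₁ ⋯ β_{k-1}}`. -/
abbrev Tensor (k : ℕ) (V : Type*) : Type _ := V → (Fin (k - 1) → V) → ℝ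

namespace Tensor

variable {k : ℕ} {V : Type*}

/-- The partial derivative with respect to the variable `p`, as a linear operator. -/
noncomputable def partialOp (p : V × V) : Module.End ℝ (MvPolynomial (V × V) ℝ) :=
  (MvPolynomial.pderiv p).toLinearMap

theorem commute_partialOp (p q : V × V) : Commute (partialOp p) (partialOp q) := by
  have h : ⁅(MvPolynomial.pderiv p : Derivation ℝ (MvPolynomial (V × V) ℝ)
        (MvPolynomial (V × V) ℝ)), (MvPolynomial.pderiv q : Derivation ℝ (MvPolynomial (V × V) ℝ)
        (MvPolynomial (V × V) ℝ))⁆ = 0 := by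
    classical
    apply MvPolynomial.derivation_ext
    intro r
    simp only [Derivation.commutator_apply, MvPolynomial.pderiv_X, Derivation.coe_zero,
      Pi.zero_apply, Pi.single_apply]
    split_ifs <;> simp
  refine LinearMap.ext fun f => ?_
  have h2 := congrArg (fun D : Derivation ℝ (MvPolynomial (V × V) ℝ) (MvPolynomial (V × V) ℝ) => D f) h
  simp only [Derivation.commutator_apply, Derivation.coe_zero, Pi.zero_apply] at h2
  exact sub_eq_zero.mp h2

theorem pairwise_partialOp (i : V) (β : Fin (k - 1) → V) :
    ((Finset.univ : Finset (Fin (k - 1))) : Set (Fin (k - 1))).Pairwise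
      (Function.onFun Commute fun j => partialOp (i, β j)) :=
  fun _ _ _ _ _ => commute_partialOp _ _

/-- The operator `∂/∂a_{i β₁} ⋯ ∂/∂a_{i β_{k-1}}`. -/
noncomputable def entryOp (i : V) (β : Fin (k - 1) → V) :
    Module.End ℝ (MvPolynomial (V × V) ℝ) :=
  Finset.univ.noncommProd (fun j => partialOp (i, β j)) (pairwise_partialOp i β)

theorem commute_entryOp (i i' : V) (β β' : Fin (k - 1) → V) :
    Commute (entryOp i β) (entryOp i' β') :=
  Finset.noncommProd_commute _ _ _ _ fun _ _ =>
    (Finset.noncommProd_commute _ _ _ _ fun _ _ => commute_partialOp _ _).symm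

variable [Fintype V]

/-- The operator `∑_β a_{i β} ∂/∂a_{i β}`, the coefficients being the entries of the tensor. -/
noncomputable def rowOp (A : Tensor k V) (i : V) : Module.End ℝ (MvPolynomial (V × V) ℝ) :=
  open Classical in ∑ β : Fin (k - 1) → V, A i β • entryOp i β

theorem commute_rowOp (A : Tensor k V) (i i' : V) : Commute (rowOp A i) (rowOp A i') :=
  Commute.sum_left _ _ _ fun _ _ => Commute.sum_right _ _ _ fun _ _ =>
    ((commute_entryOp _ _ _ _).smul_left _).smul_right _

theorem pairwise_rowOp (A : Tensor k V) (δ : V → ℕ) :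
    ((Finset.univ : Finset V) : Set V).Pairwise
      (Function.onFun Commute fun i => rowOp A i ^ δ i) :=
  fun _ _ _ _ _ => (commute_rowOp A _ _).pow_pow _ _

/-- The auxiliary matrix `(a_{ij})` of independent variables. -/
noncomputable def auxMatrix (V : Type*) : Matrix V V (MvPolynomial (V × V) ℝ) :=
  Matrix.of fun i j => MvPolynomial.X (i, j)

/-- The `d`-th order trace of a tensor of order `k` and dimension `n`:
`(k-1)^(n-1) ∑_{d₁+⋯+dₙ=d} ∏ᵢ (1/(dᵢ(k-1))!) (∑_β a_{iβ} ∂/∂a_{iβ})^{dᵢ} tr(a^{d(k-1)})`.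
The operators commute, and they turn `tr(a^{d(k-1)})`, which is homogeneous of degree `d(k-1)`,
into a constant polynomial, which is read as a real number. -/
noncomputable def trace [DecidableEq V] (d : ℕ) (A : Tensor k V) : ℝ :=
  ((k : ℝ) - 1) ^ (Fintype.card V - 1) *
    ∑ δ ∈ Finset.univ.piAntidiag d,
      (∏ i : V, 1 / ((δ i * (k - 1)).factorial : ℝ)) *
        MvPolynomial.constantCoeff
          (Finset.univ.noncommProd (fun i => rowOp A i ^ δ i) (pairwise_rowOp A δ)
            (Matrix.trace (auxMatrix V ^ (d * (k - 1)))))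

end Tensor

/-! ### Hypergraphs -/

namespace Hypergraph

variable {V W : Type*}

/-- The degree of a vertex: the number of edges that contain it. -/
noncomputable def degree (H : Hypergraph V) (v : V) : ℕ :=
  {e | e ∈ H.edgeSet ∧ v ∈ e}.ncard

/-- A cored vertex is a vertex of degree one. -/
def IsCored (H : Hypergraph V) (v : V) : Prop := H.degree v = 1

/-- Every edge has exactly `k` vertices. -/
def IsUniform (H : Hypergraph V) (k : ℕ) : Prop := ∀ e ∈ H.edgeSet, e.ncard = k

/-- Two different edges have at most one vertex in common. -/
def IsLinear (H : Hypergraph V) : Prop :=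
  ∀ e ∈ H.edgeSet, ∀ f ∈ H.edgeSet, e ≠ f → (e ∩ f).Subsingleton

/-- There is a vertex, and any two vertices are joined by a path. -/
def IsConnected (H : Hypergraph V) : Prop :=
  H.vertexSet.Nonempty ∧
    ∀ u ∈ H.vertexSet, ∀ v ∈ H.vertexSet, Relation.ReflTransGen H.Adj u v

/-- The sequence `v₀, e₀, v₁, e₁, …, v_{l-1}, e_{l-1}, v₀` is a cycle of length `l ≥ 2`: the `vᵢ`
are different vertices, the `eᵢ` are different edges, and `vᵢ` and `vᵢ₊₁` lie in `eᵢ` (indices are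
read cyclically). -/
structure IsCycle (H : Hypergraph V) {l : ℕ} (v : Fin l → V) (e : Fin l → Set V) : Prop where
  two_le : 2 ≤ l
  vertex_injective : Function.Injective v
  edge_injective : Function.Injective e
  edge_mem : ∀ i, e i ∈ H.edgeSet
  left_mem : ∀ i, v i ∈ e i
  right_mem : ∀ i, v (finRotate l i) ∈ e i

/-- The vertex-edge incidences that a cycle runs through. Two sequences describe the same cycle
(that is, they differ by a rotation or a reversal) if and only if these sets agree. -/
def cycleIncidences {l : ℕ} (v : Fin l → V) (e : Fin l → Set V) : Set (V × Set V) :=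
  {p | ∃ i, p = (v i, e i) ∨ p = (v (finRotate l i), e i)}

/-- A unicyclic hypergraph: connected, with exactly one cycle. -/
def IsUnicyclic (H : Hypergraph V) : Prop :=
  H.IsConnected ∧
    ∃! C : Set (V × Set V), ∃ (l : ℕ) (v : Fin l → V) (e : Fin l → Set V),
      H.IsCycle v e ∧ cycleIncidences v e = C

/-- The girth: the minimum length of a cycle (used only for hypergraphs that have one). -/
noncomputable def girth (H : Hypergraph V) : ℕ :=
  sInf {l | ∃ (v : Fin l → V) (e : Fin l → Set V), H.IsCycle v e}

/-- `H` is a `k`-uniform linear unicyclic hypergraph with `m` edges and girth `g`, whose vertices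
are all the elements of `V`. -/
structure IsLinearUnicyclic (H : Hypergraph V) (k m g : ℕ) : Prop where
  vertexSet_eq : H.vertexSet = Set.univ
  uniform : H.IsUniform k
  linear : H.IsLinear
  unicyclic : H.IsUnicyclic
  card_edges : H.edgeSet.ncard = m
  girth_eq : H.girth = g

/-- Isomorphism of hypergraphs whose vertices are all the elements of their vertex types. -/
def Iso (H : Hypergraph V) (H' : Hypergraph W) : Prop :=
  ∃ f : V ≃ W, H.image f = H'

/-! ### The `𝒜_α`-tensor and the `S_α`-order -/

/-- The adjacency tensor of a `k`-uniform hypergraph. -/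
noncomputable def adjTensor (H : Hypergraph V) (k : ℕ) : Tensor k V := fun i β =>
  open Classical in
  if insert i (Set.range β) ∈ H.edgeSet then 1 / ((k - 1).factorial : ℝ) else 0

/-- The diagonal tensor of vertex degrees. -/
noncomputable def degTensor (H : Hypergraph V) (k : ℕ) : Tensor k V := fun i β =>
  open Classical in
  if ∀ j, β j = i then (H.degree i : ℝ) else 0

/-- The tensor `𝒜_α = α 𝒟 + (1 - α) 𝒜`. -/
noncomputable def alphaTensor (H : Hypergraph V) (k : ℕ) (α : ℝ) : Tensor k V :=
  α • H.degTensor k + (1 - α) • H.adjTensor k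

section Order

variable [Fintype V] [DecidableEq V] [Fintype W] [DecidableEq W]

/-- The `d`-th order `𝒜_α`-spectral moment. -/
noncomputable def moment (H : Hypergraph V) (k : ℕ) (α : ℝ) (d : ℕ) : ℝ :=
  (H.alphaTensor k α).trace d

/-- `H` comes strictly before `H'` in `S_α`-order: they have the same number `n` of vertices, and
for some `1 ≤ d ≤ n(k-1)^(n-1) - 1` the moments of order less than `d` agree while that of order
`d` is smaller for `H`. -/
def SLT (k : ℕ) (α : ℝ) (H : Hypergraph V) (H' : Hypergraph W) : Prop :=
  Fintype.card V = Fintype.card W ∧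
    ∃ d, 1 ≤ d ∧ d < Fintype.card V * (k - 1) ^ (Fintype.card V - 1) ∧
      (∀ t < d, H.moment k α t = H'.moment k α t) ∧ H.moment k α d < H'.moment k α d

/-- `H =_α H'`: the same number `n` of vertices, and the same moments of the orders
`0, 1, …, n(k-1)^(n-1) - 1`. -/
def SEq (k : ℕ) (α : ℝ) (H : Hypergraph V) (H' : Hypergraph W) : Prop :=
  Fintype.card V = Fintype.card W ∧
    ∀ t < Fintype.card V * (k - 1) ^ (Fintype.card V - 1), H.moment k α t = H'.moment k α t

/-- `H ⪯_α H'`. -/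
def SLE (k : ℕ) (α : ℝ) (H : Hypergraph V) (H' : Hypergraph W) : Prop :=
  SLT k α H H' ∨ SEq k α H H'

end Order

/-! ### Hypercycles, hyperpaths and coalescence -/

/-- The vertices of the hypercycle: the vertices `uᵢ` (`i ∈ ℤ/g`) in which consecutive edges meet,
and `k - 2` further vertices `w_{i,j}` for each edge. -/
abbrev CycleVertex (k g : ℕ) : Type := Fin g ⊕ Fin g × Fin (k - 2)

/-- The `k`-uniform hypercycle with the `g` edges `{uᵢ, w_{i,1}, …, w_{i,k-2}, uᵢ₊₁}`, indices
read cyclically. -/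
def hypercycle (k g : ℕ) : Hypergraph (CycleVertex k g) where
  vertexSet := Set.univ
  edgeSet := Set.range fun i : Fin g =>
    {Sum.inl i, Sum.inl (finRotate g i)} ∪ Set.range fun j => Sum.inr (i, j)
  subset_vertexSet_of_mem_edgeSet' _ _ := Set.subset_univ _

/-- The vertices of the hyperpath: `u₀, …, u_r`, and `k - 2` further vertices `w_{i,j}` for each
edge. -/
abbrev PathVertex (k r : ℕ) : Type := Fin (r + 1) ⊕ Fin r × Fin (k - 2)

/-- The `k`-uniform hyperpath with the `r` edges `{uᵢ, w_{i,1}, …, w_{i,k-2}, uᵢ₊₁}`; for `r = 0`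
it is a single vertex. -/
def hyperpath (k r : ℕ) : Hypergraph (PathVertex k r) where
  vertexSet := Set.univ
  edgeSet := Set.range fun i : Fin r =>
    {Sum.inl i.castSucc, Sum.inl i.succ} ∪ Set.range fun j => Sum.inr (i, j)
  subset_vertexSet_of_mem_edgeSet' _ _ := Set.subset_univ _

/-- The vertices of a coalescence: those of both hypergraphs, without the vertex `w` of the second
one, which is identified with a vertex of the first. -/
abbrev CoalVertex (V : Type*) {W : Type*} (w : W) : Type _ := V ⊕ {x : W // x ≠ w}

/-- The map of the vertices of the second hypergraph into the coalescence; it sends `w` to `v`. -/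
def coalMap [DecidableEq W] (v : V) (w : W) (x : W) : CoalVertex V w :=
  if h : x = w then Sum.inl v else Sum.inr ⟨x, h⟩

/-- The coalescence of `H` at its vertex `v` with `H'` at its vertex `w`: the union of the two
hypergraphs after `w` has been identified with `v`. -/
def coalescence [DecidableEq W] (H : Hypergraph V) (v : V) (H' : Hypergraph W) (w : W) :
    Hypergraph (CoalVertex V w) where
  vertexSet := (H.image Sum.inl).vertexSet ∪ (H'.image (coalMap v w)).vertexSet
  edgeSet := (H.image Sum.inl).edgeSet ∪ (H'.image (coalMap v w)).edgeSet
  subset_vertexSet_of_mem_edgeSet' _ he := he.elim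
    (fun h => (Hypergraph.subset_vertexSet_of_mem_edgeSet h).trans Set.subset_union_left)
    (fun h => (Hypergraph.subset_vertexSet_of_mem_edgeSet h).trans Set.subset_union_right)

/-- The coalescence of the hypercycle with `g` edges at its vertex `c` with the hyperpath with `r`
edges at its end vertex `u₀`. -/
def cyclePath (k g r : ℕ) (c : CycleVertex k g) :
    Hypergraph (CoalVertex (CycleVertex k g) (Sum.inl 0 : PathVertex k r)) :=
  (hypercycle k g).coalescence c (hyperpath k r) (Sum.inl 0)

end Hypergraph

/-!
Pairing polynomials apolarly turns the derivatives in the trace into multiplications by the rows of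
the tensor, so a trace counts weighted closed walks. For the tensor `α 𝒟 + (1 - α) 𝒜` of a linear
`k`-uniform hypergraph, a choice of diagonal entries and rooted edges contributes only if the
resulting arcs are balanced, and for orders up to `k + 2` this forces the rooted edges to be absent
or to be one edge rooted once at each of its vertices. Hence the moment of order `2` is a positive
multiple of `∑ v, d(v) ^ 2`, and given all the degree power sums and the number of edges, the first
moment that can differ is that of order `k + 2`, which grows with `∑ e, (∑ v ∈ e, d(v)) ^ 2`.

A linear unicyclic hypergraph with `m` edges has `(k - 1) m` vertices, so `∑ v, d(v)` is fixed and
`∑ v, d(v) ^ 2` is least exactly when all degrees are at most `2`; all the degree power sums are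
then fixed. In that case `∑ v ∈ e, d(v)` is `k` plus the number of edges meeting `e`. Call excess of
`e` this number minus `2`. The excesses add up to `0`, and if `g < m`, then some edge of the cycle
has positive excess. So the squares of the excesses add up to at least `2`, and to exactly `2` only
if one cycle edge has excess `1`, one edge has excess `-1` and all others have excess `0`: then the
edges off the cycle form a path, and the hypergraph is determined by which of its edges meet.
-/

/-! ### The apolar pairing -/

section ApolarPairing

open MvPolynomial

variable {σ τ R : Type*} [CommSemiring R]

/-- The apolar pairing of polynomials, `⟨p, q⟩ = p(∂) q` evaluated at `0`: the monomials are
orthogonal, and a monomial paired with itself gives the product of the factorials of its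
exponents. -/
noncomputable def apolarPairing : MvPolynomial σ R →ₗ[R] MvPolynomial σ R →ₗ[R] R :=
  (basisMonomials σ R).constr R fun M => (M.prod fun _ n => (n.factorial : R)) • lcoeff R M

theorem apolarPairing_monomial (M : σ →₀ ℕ) (a : R) (q : MvPolynomial σ R) :
    apolarPairing (monomial M a) q = a * ((M.prod fun _ n => (n.factorial : R)) * coeff M q) := by
  have h := (basisMonomials σ R).constr_basis R
    (fun M => (M.prod fun _ n => (n.factorial : R)) • lcoeff (σ := σ) R M) M
  rw [coe_basisMonomials] at h
  rw [apolarPairing, ← mul_one a, ← smul_eq_mul, ← smul_monomial, map_smul, h]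
  simp

theorem apolarPairing_one (q : MvPolynomial σ R) : apolarPairing 1 q = constantCoeff q := by
  simpa [constantCoeff_eq] using apolarPairing_monomial 0 1 q

theorem prod_factorial_add_single (M : σ →₀ ℕ) (p : σ) :
    ((M + Finsupp.single p 1).prod fun _ n => (n.factorial : R)) =
      (M p + 1) * M.prod fun _ n => (n.factorial : R) := by
  classical
  rw [← Finsupp.mul_prod_erase' (M + Finsupp.single p 1) p _ (by simp),
    ← Finsupp.mul_prod_erase' M p _ (by simp), Finsupp.erase_add, Finsupp.erase_single, add_zero]
  simp [Nat.factorial_succ, mul_assoc]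

theorem apolarPairing_X_mul (p : σ) (r q : MvPolynomial σ R) :
    apolarPairing (X p * r) q = apolarPairing r (pderiv p q) := by
  induction r using MvPolynomial.induction_on' with
  | monomial M a =>
    rw [mul_comm, X, monomial_mul, mul_one, apolarPairing_monomial, apolarPairing_monomial,
      prod_factorial_add_single, coeff_pderiv]
    ring
  | add r s hr hs => simp only [mul_add, map_add, LinearMap.add_apply, hr, hs]

theorem apolarPairing_rename (f : σ ≃ τ) (p q : MvPolynomial σ R) :
    apolarPairing (rename f p) (rename f q) = apolarPairing p q := by
  induction p using MvPolynomial.induction_on' with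
  | monomial M a =>
    rw [rename_monomial, apolarPairing_monomial, apolarPairing_monomial,
      coeff_rename_mapDomain f f.injective, Finsupp.prod_mapDomain_index_inj f.injective]
  | add r s hr hs => simp only [map_add, LinearMap.add_apply, hr, hs]

/-- The operator `T` is adjoint, for the apolar pairing, to the multiplication by `p`. -/
def IsAdjointMul (T : Module.End R (MvPolynomial σ R)) (p : MvPolynomial σ R) : Prop :=
  ∀ r q, apolarPairing (p * r) q = apolarPairing r (T q)

namespace IsAdjointMul

variable {T T' : Module.End R (MvPolynomial σ R)} {p p' : MvPolynomial σ R}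

theorem one : IsAdjointMul (1 : Module.End R (MvPolynomial σ R)) 1 := fun r q => by simp

theorem mul (h : IsAdjointMul T p) (h' : IsAdjointMul T' p') : IsAdjointMul (T * T') (p * p') :=
  fun r q => by rw [mul_comm p, mul_assoc, h', h]; rfl

theorem smul (h : IsAdjointMul T p) (c : R) : IsAdjointMul (c • T) (c • p) := fun r q => by
  rw [smul_mul_assoc, map_smul, LinearMap.smul_apply, h, LinearMap.smul_apply, map_smul]

theorem pow (h : IsAdjointMul T p) (n : ℕ) : IsAdjointMul (T ^ n) (p ^ n) := by
  induction n with
  | zero => simpa using one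
  | succ n ih => rw [pow_succ, pow_succ]; exact ih.mul h

theorem sum {ι : Type*} (s : Finset ι) {T : ι → Module.End R (MvPolynomial σ R)}
    {p : ι → MvPolynomial σ R} (h : ∀ i ∈ s, IsAdjointMul (T i) (p i)) :
    IsAdjointMul (∑ i ∈ s, T i) (∑ i ∈ s, p i) := fun r q => by
  rw [Finset.sum_mul, map_sum, LinearMap.sum_apply, LinearMap.sum_apply, map_sum]
  exact Finset.sum_congr rfl fun i hi => h i hi r q

theorem noncommProd {ι : Type*} (s : Finset ι) {T : ι → Module.End R (MvPolynomial σ R)}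
    {p : ι → MvPolynomial σ R} (hc : (s : Set ι).Pairwise (Function.onFun Commute T))
    (h : ∀ i ∈ s, IsAdjointMul (T i) (p i)) :
    IsAdjointMul (s.noncommProd T hc) (∏ i ∈ s, p i) := by
  classical
  induction s using Finset.induction_on with
  | empty => simpa using one
  | insert a s ha ih =>
    rw [Finset.noncommProd_insert_of_notMem _ _ _ _ ha, Finset.prod_insert ha]
    exact (h a (Finset.mem_insert_self a s)).mul
      (ih _ fun i hi => h i (Finset.mem_insert_of_mem hi))

end IsAdjointMul

end ApolarPairing

/-! ### The trace formula in terms of the apolar pairing -/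

namespace Tensor

open MvPolynomial

variable {k : ℕ} {V W : Type*}

theorem isAdjointMul_partialOp (p : V × V) : IsAdjointMul (partialOp p) (X p) :=
  apolarPairing_X_mul p

variable [Fintype V] [Fintype W]

/-- The polynomial `∑_β a_{iβ} x_{iβ₁} ⋯ x_{iβ_{k-1}}` that encodes the `i`-th row of a tensor; its
variables are the arcs, that is, the ordered pairs of indices. -/
noncomputable def rowPoly (A : Tensor k V) (i : V) : MvPolynomial (V × V) ℝ :=
  ∑ β : Fin (k - 1) → V, A i β • ∏ j, X (i, β j)

theorem isAdjointMul_rowOp (A : Tensor k V) (i : V) : IsAdjointMul (rowOp A i) (rowPoly A i) :=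
  .sum _ fun _ _ => .smul (.noncommProd _ _ fun _ _ => isAdjointMul_partialOp _) _

theorem rename_rowPoly (f : V ≃ W) {A : Tensor k V} {B : Tensor k W}
    (h : ∀ i β, B (f i) (f ∘ β) = A i β) (i : V) :
    rename (f.prodCongr f) (rowPoly A i) = rowPoly B (f i) := by
  classical
  unfold rowPoly
  rw [map_sum]
  refine Fintype.sum_equiv ((Equiv.refl (Fin (k - 1))).arrowCongr f) _ _ fun β => ?_
  rw [map_smul, map_prod, ← h]
  simp only [rename_X]
  rfl

/-- The pairing with `tr(a^N)`. On a monomial it counts, up to a positive factor, the closed walks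
of length `N` whose arcs are the variables of the monomial. -/
noncomputable def walkFunctional (V : Type*) [Fintype V] [DecidableEq V] (N : ℕ) :
    MvPolynomial (V × V) ℝ →ₗ[ℝ] ℝ :=
  apolarPairing.flip (Matrix.trace (auxMatrix V ^ N))

variable [DecidableEq V] [DecidableEq W]

theorem trace_eq_sum_walkFunctional (d : ℕ) (A : Tensor k V) :
    trace d A = ((k : ℝ) - 1) ^ (Fintype.card V - 1) *
      ∑ δ ∈ (Finset.univ : Finset V).piAntidiag d,
        (∏ i : V, 1 / ((δ i * (k - 1)).factorial : ℝ)) *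
          walkFunctional V (d * (k - 1)) (∏ i, rowPoly A i ^ δ i) := by
  unfold trace
  congr 1
  refine Finset.sum_congr rfl fun δ _ => ?_
  congr 1
  have h := IsAdjointMul.noncommProd Finset.univ (pairwise_rowOp A δ)
    (p := fun i => rowPoly A i ^ δ i) fun i _ => (isAdjointMul_rowOp A i).pow _
  rw [walkFunctional, LinearMap.flip_apply, ← mul_one (∏ i, _), h, apolarPairing_one]

theorem auxMatrix_map_rename (f : V ≃ W) :
    (rename (f.prodCongr f) : _ →ₐ[ℝ] _).mapMatrix (auxMatrix V) =
      Matrix.reindexAlgEquiv ℝ _ f.symm (auxMatrix W) := by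
  ext i j : 2
  simp [auxMatrix]

theorem rename_trace_auxMatrix_pow (f : V ≃ W) (N : ℕ) :
    rename (f.prodCongr f) (Matrix.trace (auxMatrix V ^ N)) = Matrix.trace (auxMatrix W ^ N) := by
  rw [AddMonoidHom.map_trace, ← AlgHom.mapMatrix_apply, map_pow, auxMatrix_map_rename, ← map_pow]
  exact Equiv.sum_comp f fun i => (auxMatrix W ^ N) i i

theorem walkFunctional_rename (f : V ≃ W) (N : ℕ) (p : MvPolynomial (V × V) ℝ) :
    walkFunctional W N (rename (f.prodCongr f) p) = walkFunctional V N p := by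
  rw [walkFunctional, walkFunctional, LinearMap.flip_apply, LinearMap.flip_apply,
    ← rename_trace_auxMatrix_pow f, apolarPairing_rename]

theorem trace_congr (f : V ≃ W) {A : Tensor k V} {B : Tensor k W}
    (h : ∀ i β, B (f i) (f ∘ β) = A i β) (d : ℕ) : trace d A = trace d B := by
  rw [trace_eq_sum_walkFunctional, trace_eq_sum_walkFunctional, Fintype.card_congr f]
  congr 1
  refine Finset.sum_equiv (f.arrowCongr (Equiv.refl ℕ)) (fun δ => ?_) fun δ _ => ?_
  · simp only [Finset.mem_piAntidiag, Finset.mem_univ, implies_true, and_true]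
    exact iff_of_eq (congrArg (· = d) (Equiv.sum_comp f.symm δ).symm)
  · congr 1
    · exact Fintype.prod_equiv f _ _ fun i => by simp
    · rw [← walkFunctional_rename f, map_prod]
      congr 1
      refine Fintype.prod_equiv f _ _ fun i => ?_
      rw [map_pow, rename_rowPoly f h]
      simp

end Tensor

/-! ### Closed walks -/

/-- There is a walk from `a` to `b` in the complete digraph with loops that runs through each arc
as often as the multiplicity function `M` says. -/
inductive ArcWalk {V : Type*} (a : V) : V → (V × V →₀ ℕ) → Prop
  | nil : ArcWalk a a 0
  | snoc {b : V} {M : V × V →₀ ℕ} (h : ArcWalk a b M) (c : V) :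
      ArcWalk a c (M + Finsupp.single (b, c) 1)

namespace ArcWalk

variable {V : Type*} {a b c : V} {M M' : V × V →₀ ℕ}

theorem trans (h : ArcWalk a b M) (h' : ArcWalk b c M') : ArcWalk a c (M + M') := by
  induction h' with
  | nil => simpa using h
  | snoc h' c ih => rw [← add_assoc]; exact ih.snoc c

theorem single (a b : V) : ArcWalk a b (Finsupp.single (a, b) 1) := by
  simpa using (nil (a := a)).snoc b

theorem nsmul (h : ArcWalk a a M) (n : ℕ) : ArcWalk a a (n • M) := by
  induction n with
  | zero => simpa using nil
  | succ n ih => rw [succ_nsmul]; exact ih.trans h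

theorem sum {ι : Type*} (s : Finset ι) {M : ι → V × V →₀ ℕ} (h : ∀ i ∈ s, ArcWalk a a (M i)) :
    ArcWalk a a (∑ i ∈ s, M i) := by
  classical
  induction s using Finset.induction_on with
  | empty => simpa using nil
  | insert i s hi ih =>
    rw [Finset.sum_insert hi]
    exact (h i (Finset.mem_insert_self i s)).trans
      (ih fun j hj => h j (Finset.mem_insert_of_mem hj))

theorem mem_iff_of_closed (h : ArcWalk a b M) (S : Set V)
    (hS : ∀ u v, M (u, v) ≠ 0 → (u ∈ S ↔ v ∈ S)) :
    (a ∈ S ↔ b ∈ S) ∧ ∀ u v, M (u, v) ≠ 0 → (a ∈ S ↔ u ∈ S) := by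
  classical
  induction h with
  | nil => simp
  | @snoc b M h c ih =>
    have hM := ih fun u v huv => hS u v (by simp [huv])
    refine ⟨hM.1.trans (hS b c (by simp)), fun u v huv => ?_⟩
    by_cases hM0 : M (u, v) = 0
    · obtain rfl : u = b := by
        by_contra hub
        simp [hM0, Ne.symm hub] at huv
      exact hM.1
    · exact hM.2 u v hM0

theorem sum_out_add_eq_sum_in_add [Fintype V] [DecidableEq V] (h : ArcWalk a b M) (u : V) :
    (∑ v, M (u, v)) + (if u = b then 1 else 0) = (∑ v, M (v, u)) + if u = a then 1 else 0 := by
  induction h with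
  | nil => simp
  | @snoc b M h c ih =>
    simp only [Finsupp.add_apply, Finset.sum_add_distrib, Finsupp.single_apply, Prod.mk.injEq]
    have hout : (∑ v, if b = u ∧ c = v then 1 else 0) = if u = b then 1 else 0 := by
      by_cases h : b = u <;> simp [h, Ne.symm]
    have hin : (∑ v, if b = v ∧ c = u then 1 else 0) = if u = c then 1 else 0 := by
      by_cases h : c = u <;> simp [h, Ne.symm]
    rw [hout, hin]
    omega

theorem sum_out_eq_sum_in [Fintype V] (h : ArcWalk a a M) (u : V) :
    ∑ v, M (u, v) = ∑ v, M (v, u) := by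
  classical
  exact add_right_cancel (h.sum_out_add_eq_sum_in_add u)

end ArcWalk

namespace Tensor

open MvPolynomial

variable {V : Type*} [Fintype V] [DecidableEq V] {N : ℕ} {a b c : V} {M : V × V →₀ ℕ}

theorem coeff_auxMatrix_pow_succ (N : ℕ) (a c : V) (M : V × V →₀ ℕ) :
    coeff M ((auxMatrix V ^ (N + 1)) a c) =
      ∑ b, if (b, c) ∈ M.support then
        coeff (M - Finsupp.single (b, c) 1) ((auxMatrix V ^ N) a b) else 0 := by
  rw [pow_succ, Matrix.mul_apply, coeff_sum]
  exact Finset.sum_congr rfl fun b _ => coeff_mul_X' M (b, c) _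

theorem coeff_auxMatrix_pow_nonneg (N : ℕ) (a b : V) (M : V × V →₀ ℕ) :
    0 ≤ coeff M ((auxMatrix V ^ N) a b) := by
  induction N generalizing b M with
  | zero =>
    rw [pow_zero, Matrix.one_apply]
    split_ifs
    · rw [coeff_one]; split_ifs <;> simp
    · simp
  | succ N ih =>
    rw [coeff_auxMatrix_pow_succ]
    exact Finset.sum_nonneg fun c _ => by split_ifs <;> simp [ih]

theorem arcWalk_of_coeff_auxMatrix_pow_ne_zero (h : coeff M ((auxMatrix V ^ N) a b) ≠ 0) :
    ArcWalk a b M := by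
  induction N generalizing b M with
  | zero =>
    rw [pow_zero, Matrix.one_apply] at h
    split_ifs at h with hab
    · rw [coeff_one] at h
      split_ifs at h with hM
      · subst hab hM; exact .nil
      · exact absurd rfl h
    · exact absurd (coeff_zero M) h
  | succ N ih =>
    rw [coeff_auxMatrix_pow_succ] at h
    obtain ⟨c, _, hc⟩ := Finset.exists_ne_zero_of_sum_ne_zero h
    split_ifs at hc with hcb
    · have hle : Finsupp.single (c, b) 1 ≤ M :=
        Finsupp.single_le_iff.2 (Nat.one_le_iff_ne_zero.2 (Finsupp.mem_support_iff.1 hcb))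
      simpa only [tsub_add_cancel_of_le hle] using (ih hc).snoc b
    · exact absurd rfl hc

theorem coeff_auxMatrix_pow_pos (h : ArcWalk a b M) :
    0 < coeff M ((auxMatrix V ^ M.degree) a b) := by
  induction h with
  | nil => simp
  | @snoc b M _ c ih =>
    have hdeg : (M + Finsupp.single (b, c) 1).degree = M.degree + 1 := by simp
    rw [hdeg, coeff_auxMatrix_pow_succ]
    refine Finset.sum_pos' (fun c _ => ?_) ⟨b, Finset.mem_univ b, ?_⟩
    · split_ifs
      · exact coeff_auxMatrix_pow_nonneg _ _ _ _
      · exact le_rfl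
    · rw [if_pos (by simp), add_tsub_cancel_right]
      exact ih

theorem walkFunctional_monomial (N : ℕ) (M : V × V →₀ ℕ) :
    walkFunctional V N (monomial M 1) =
      (M.prod fun _ n => (n.factorial : ℝ)) * ∑ a, coeff M ((auxMatrix V ^ N) a a) := by
  rw [walkFunctional, LinearMap.flip_apply, apolarPairing_monomial, one_mul, Matrix.trace,
    coeff_sum]
  rfl

theorem exists_arcWalk_of_walkFunctional_ne_zero (h : walkFunctional V N (monomial M 1) ≠ 0) :
    ∃ a, ArcWalk a a M := by
  rw [walkFunctional_monomial] at h
  obtain ⟨a, _, ha⟩ := Finset.exists_ne_zero_of_sum_ne_zero (right_ne_zero_of_mul h)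
  exact ⟨a, arcWalk_of_coeff_auxMatrix_pow_ne_zero ha⟩

theorem walkFunctional_monomial_pos (h : ArcWalk a a M) (hN : M.degree = N) :
    0 < walkFunctional V N (monomial M 1) := by
  rw [walkFunctional_monomial, ← hN]
  exact mul_pos (Finset.prod_pos fun _ _ => by positivity)
    (Finset.sum_pos' (fun _ _ => coeff_auxMatrix_pow_nonneg _ _ _ _)
      ⟨a, Finset.mem_univ a, coeff_auxMatrix_pow_pos h⟩)

end Tensor

/-! ### Balanced families of rooted edges -/

section RootedEdges

open Finset

variable {V I : Type*} [DecidableEq V] [Fintype I] {k : ℕ} {ρ : I → V} {f : I → Finset V}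

/-- The family of the edges `f p`, each with a root `ρ p`, is balanced: every vertex is `k` times as
often covered as it is a root. For rooted edges of size `k` this is the condition that the arcs from
the roots to the other vertices leave every vertex as often as they enter it. -/
def IsBalanced (k : ℕ) (ρ : I → V) (f : I → Finset V) : Prop :=
  ∀ u, k * #{p | ρ p = u} = #{p | u ∈ f p}

theorem IsBalanced.subset_image_root (hb : IsBalanced k ρ f) (p : I) : f p ⊆ univ.image ρ := by
  intro u hu
  have hcovered : 0 < #{p | u ∈ f p} := card_pos.2 ⟨p, by simpa using hu⟩
  rw [← hb] at hcovered
  obtain ⟨q, hq⟩ := card_pos.1 (Nat.pos_of_mul_pos_left hcovered)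
  exact mem_image.2 ⟨q, mem_univ q, (mem_filter.1 hq).2⟩

theorem IsBalanced.le_card_filter_mem (hb : IsBalanced k ρ f) {p : I} {u : V} (hu : u ∈ f p) :
    k ≤ #{q | u ∈ f q} := by
  have hcovered : 0 < #{q | u ∈ f q} := card_pos.2 ⟨p, by simpa using hu⟩
  rw [← hb] at hcovered ⊢
  exact Nat.le_mul_of_pos_right _ (Nat.pos_of_mul_pos_left hcovered)

theorem card_add_card_add_card_le_card_union_add {e f g : Finset V}
    (hef : #(e ∩ f) ≤ 1) (heg : #(e ∩ g) ≤ 1) (hfg : #(f ∩ g) ≤ 1) :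
    #e + #f + #g ≤ #(e ∪ f ∪ g) + 3 := by
  have h₁ := card_union_add_card_inter e f
  have h₂ := card_union_add_card_inter (e ∪ f) g
  have h₃ : #((e ∪ f) ∩ g) ≤ #(e ∩ g) + #(f ∩ g) := by
    rw [union_inter_distrib_right]; exact card_union_le _ _
  omega

theorem exists_mem_notMem_of_card_inter_le_one {e f : Finset V} (he : 2 ≤ #e)
    (hef : #(e ∩ f) ≤ 1) : ∃ u ∈ e, u ∉ f := by
  have hsdiff : 0 < #(e \ f) := by
    have := card_sdiff_add_card_inter e f
    omega
  obtain ⟨u, hu⟩ := card_pos.1 hsdiff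
  exact ⟨u, mem_sdiff.1 hu⟩

theorem IsBalanced.le_card_fiber (hb : IsBalanced k ρ f) {p q : I} (hp : 2 ≤ #(f p))
    (hpq : #(f p ∩ f q) ≤ 1) (htwo : ∀ r, f r = f p ∨ f r = f q) :
    k ≤ #{r | f r = f p} := by
  obtain ⟨u, hup, huq⟩ := exists_mem_notMem_of_card_inter_le_one hp hpq
  refine (hb.le_card_filter_mem hup).trans_eq (congrArg card (filter_congr fun r _ => ?_))
  exact ⟨fun hur => (htwo r).resolve_right fun h => huq (h ▸ hur), fun h => h ▸ hup⟩

/-- Three different edges cover at least `3 k - 3` vertices, each of which is a root. If there are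
just two different edges, then each has a vertex that is not in the other one, so that each occurs
at least `k` times. -/
theorem IsBalanced.eq_of_card_le (hb : IsBalanced k ρ f) (hk : 3 ≤ k)
    (hI : Fintype.card I ≤ k + 2) (hu : ∀ p, #(f p) = k)
    (hl : ∀ p q, f p ≠ f q → #(f p ∩ f q) ≤ 1) (p q : I) : f p = f q := by
  classical
  by_contra hpq
  by_cases hthird : ∃ r, f p ≠ f r ∧ f q ≠ f r
  · obtain ⟨r, hpr, hqr⟩ := hthird
    have hcover : #(f p ∪ f q ∪ f r) ≤ #(univ.image ρ) := card_le_card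
      (union_subset (union_subset (hb.subset_image_root p) (hb.subset_image_root q))
        (hb.subset_image_root r))
    have hroots : #(univ.image ρ) ≤ Fintype.card I := card_image_le
    have h := card_add_card_add_card_le_card_union_add (hl p q hpq) (hl p r hpr) (hl q r hqr)
    rw [hu, hu, hu] at h
    omega
  · push Not at hthird
    have htwo : ∀ r, f r = f p ∨ f r = f q := fun r =>
      or_iff_not_imp_left.2 fun h => (hthird r (Ne.symm h)).symm
    have hp := hb.le_card_fiber (by rw [hu]; omega) (hl p q hpq) htwo
    have hq := hb.le_card_fiber (by rw [hu]; omega) (hl q p (Ne.symm hpq)) fun r => (htwo r).symm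
    have hdisj : Disjoint ({r | f r = f p} : Finset I) ({r | f r = f q} : Finset I) :=
      disjoint_filter.2 fun r _ h h' => hpq (h.symm.trans h')
    have hle := card_le_univ (({r | f r = f p} : Finset I) ∪ ({r | f r = f q} : Finset I))
    rw [card_union_of_disjoint hdisj] at hle
    omega

/-- The indicator vector of a set of vertices, as a vector of multiplicities. -/
def ind (e : Finset V) (u : V) : ℕ := if u ∈ e then 1 else 0

theorem ind_of_mem {e : Finset V} {u : V} (h : u ∈ e) : ind e u = 1 := if_pos h

theorem ind_of_notMem {e : Finset V} {u : V} (h : u ∉ e) : ind e u = 0 := if_neg h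

theorem sum_ind [Fintype V] (e : Finset V) : ∑ u, ind e u = #e := by simp [ind]

theorem mem_of_ind_ne_zero {e : Finset V} {u : V} (h : ind e u ≠ 0) : u ∈ e := by
  by_contra hu
  exact h (ind_of_notMem hu)

theorem ind_injective : Function.Injective (ind (V := V)) := by
  intro e f h
  ext u
  have hu := congrFun h u
  simp only [ind] at hu
  split_ifs at hu with he hf hf <;> simp_all

theorem IsBalanced.card_root_eq_ind [Nonempty I] (hb : IsBalanced k ρ f) (hk : 3 ≤ k)
    (hI : Fintype.card I ≤ k + 2) {e : Finset V} (hf : ∀ p, f p = e) (u : V) :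
    #{p | ρ p = u} = ind e u := by
  have hu := hb u
  simp only [hf] at hu
  by_cases hue : u ∈ e
  · simp only [hue, filter_true, card_univ] at hu
    have hpos : 0 < Fintype.card I := Fintype.card_pos
    have hlt : k * #{p | ρ p = u} < k * 2 := by omega
    have hroot := Nat.lt_of_mul_lt_mul_left hlt
    have hne : #{p | ρ p = u} ≠ 0 := fun h => by rw [h] at hu; omega
    rw [ind_of_mem hue]
    omega
  · simp only [hue, filter_false, card_empty, mul_eq_zero] at hu
    rw [ind_of_notMem hue]
    omega

end RootedEdges

/-! ### Arcs of loops and of rooted edges -/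

namespace Tensor

open Finset MvPolynomial

variable {V : Type*}

/-- The loops, the loop at `i` being taken `δ i * (k - 1)` times. -/
noncomputable def loopArcs [Fintype V] (k : ℕ) (δ : V → ℕ) : V × V →₀ ℕ :=
  ∑ i, Finsupp.single (i, i) (δ i * (k - 1))

theorem prod_loops_eq_monomial [Fintype V] (k : ℕ) (δ : V → ℕ) :
    ∏ i, (X (i, i) ^ (k - 1) : MvPolynomial (V × V) ℝ) ^ δ i = monomial (loopArcs k δ) 1 := by
  rw [loopArcs, monomial_sum_one]
  refine prod_congr rfl fun i _ => ?_
  rw [← pow_mul, X_pow_eq_monomial, mul_comm]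

variable [DecidableEq V]

theorem loopArcs_apply [Fintype V] (k : ℕ) (δ : V → ℕ) (u v : V) :
    loopArcs k δ (u, v) = if u = v then δ u * (k - 1) else 0 := by
  rw [loopArcs, Finsupp.finsetSum_apply]
  simp only [Finsupp.single_apply, Prod.mk.injEq]
  by_cases h : u = v
  · subst h; simp
  · rw [if_neg h]
    exact sum_eq_zero fun i _ => if_neg fun hi => h (hi.1.symm.trans hi.2)

/-- The arcs from a vertex to the other vertices of an edge. -/
noncomputable def edgeArcs (i : V) (e : Finset V) : V × V →₀ ℕ :=
  ∑ j ∈ e.erase i, Finsupp.single (i, j) 1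

theorem edgeArcs_apply (i : V) (e : Finset V) (u v : V) :
    edgeArcs i e (u, v) = if u = i ∧ v ∈ e ∧ v ≠ i then 1 else 0 := by
  rw [edgeArcs, Finsupp.finsetSum_apply]
  by_cases hu : i = u
  · subst hu
    simp [Finsupp.single_apply, and_comm]
  · simp [Ne.symm hu]

/-- All the arcs between different vertices of an edge. -/
noncomputable def edgeStar (e : Finset V) : V × V →₀ ℕ := ∑ i ∈ e, edgeArcs i e

variable [Fintype V] {k : ℕ}

theorem sum_edgeArcs_out {i : V} {e : Finset V} (hi : i ∈ e) (u : V) :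
    ∑ v, edgeArcs i e (u, v) = if i = u then #e - 1 else 0 := by
  simp only [edgeArcs_apply]
  split_ifs with h
  · subst h
    rw [← card_filter, ← card_erase_of_mem hi]
    congr 1
    ext v; simp [and_comm]
  · simp [Ne.symm h]

theorem sum_edgeArcs_in_add {i : V} {e : Finset V} (hi : i ∈ e) (u : V) :
    ∑ v, edgeArcs i e (v, u) + (if i = u then 1 else 0) = if u ∈ e then 1 else 0 := by
  simp only [edgeArcs_apply]
  by_cases h : i = u
  · subst h; simp [hi]
  · by_cases h' : u ∈ e <;> simp [h, h', Ne.symm h]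

theorem isBalanced_of_arcWalk {I : Type*} [Fintype I] {ρ : I → V} {f : I → Finset V}
    (hu : ∀ p, #(f p) = k) (hρ : ∀ p, ρ p ∈ f p) {z : V → ℕ} {a : V}
    (hw : ArcWalk a a (loopArcs k z + ∑ p, edgeArcs (ρ p) (f p))) : IsBalanced k ρ f := by
  intro u
  have hbal : ∑ p, ∑ v, edgeArcs (ρ p) (f p) (u, v) = ∑ p, ∑ v, edgeArcs (ρ p) (f p) (v, u) := by
    have h := hw.sum_out_eq_sum_in u
    simp only [Finsupp.add_apply, Finsupp.finsetSum_apply, sum_add_distrib, loopArcs_apply,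
      sum_ite_eq, sum_ite_eq', mem_univ, if_true, add_right_inj] at h
    exact (sum_comm.symm.trans h).trans sum_comm
  have hin := congrArg (· + ∑ p, if ρ p = u then 1 else 0) hbal
  simp only [← sum_add_distrib, sum_edgeArcs_out (hρ _), sum_edgeArcs_in_add (hρ _), hu] at hin
  rw [card_filter, card_filter, ← hin, mul_sum]
  refine sum_congr rfl fun p _ => ?_
  have hk : 0 < k := hu p ▸ card_pos.2 ⟨ρ p, hρ p⟩
  split_ifs <;> omega

theorem card_filter_sigma_fst_eq (y : V → ℕ) (u : V) : #{p : Σ i, Fin (y i) | p.1 = u} = y u := by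
  rw [card_filter, Fintype.sum_sigma, sum_eq_single u (fun v _ h => by simp [h]) (by simp)]
  simp

theorem rooted_edges_eq_of_arcWalk (hk : 3 ≤ k) {z y : V → ℕ} (hy : ∑ i, y i ≤ k + 2)
    (hy0 : y ≠ 0) {f : (Σ i, Fin (y i)) → Finset V} (hu : ∀ p, #(f p) = k)
    (hl : ∀ p q, f p ≠ f q → #(f p ∩ f q) ≤ 1) (hρ : ∀ p, p.1 ∈ f p) {a : V}
    (hw : ArcWalk a a (loopArcs k z + ∑ p, edgeArcs p.1 (f p))) :
    ∃ p₀, (∀ p, f p = f p₀) ∧ y = ind (f p₀) := by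
  obtain ⟨i₀, hi₀⟩ := Function.ne_iff.1 hy0
  have p₀ : Σ i, Fin (y i) := ⟨i₀, 0, Nat.pos_of_ne_zero hi₀⟩
  have : Nonempty (Σ i, Fin (y i)) := ⟨p₀⟩
  have hb := isBalanced_of_arcWalk hu hρ hw
  have hI : Fintype.card (Σ i, Fin (y i)) ≤ k + 2 := by simpa using hy
  have hconst : ∀ p, f p = f p₀ := fun p => hb.eq_of_card_le hk hI hu hl p p₀
  exact ⟨p₀, hconst, funext fun u => by
    rw [← card_filter_sigma_fst_eq y u, hb.card_root_eq_ind hk hI hconst]⟩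

end Tensor

/-! ### The walk functional of the products of the rows -/

namespace Tensor

open MvPolynomial Finset

variable {V : Type*} [Fintype V]

/-- The coefficient of `∏ i, x i ^ y i * l i ^ (δ i - y i)` in the expansion of the product
`∏ i, (b • x i + D i • l i) ^ δ i`. -/
def binomialWeight (D : V → ℝ) (b : ℝ) (δ y : V → ℕ) : ℝ :=
  b ^ (∑ i, y i) * (∏ i, D i ^ (δ i - y i)) * ∏ i, ((δ i).choose (y i) : ℝ)

theorem binomialWeight_zero (D : V → ℝ) (b : ℝ) (δ : V → ℕ) :
    binomialWeight D b δ 0 = ∏ i, D i ^ δ i := by simp [binomialWeight]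

theorem binomialWeight_eq_zero {D : V → ℝ} {b : ℝ} {δ y : V → ℕ} {i : V} (hi : δ i < y i) :
    binomialWeight D b δ y = 0 := by
  refine mul_eq_zero_of_right _ (prod_eq_zero (mem_univ i) ?_)
  rw [Nat.choose_eq_zero_of_lt hi, Nat.cast_zero]

variable [DecidableEq V] {k N : ℕ} {E : Finset (Finset V)}

theorem binomialWeight_ind (D : V → ℝ) (b : ℝ) (δ : V → ℕ) (e : Finset V) :
    binomialWeight D b δ (ind e) =
      b ^ #e * ((∏ i ∈ e, (δ i : ℝ)) * ∏ i, D i ^ (δ i - ind e i)) := by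
  have hchoose : ∏ i, ((δ i).choose (ind e i) : ℝ) = ∏ i ∈ e, (δ i : ℝ) := by
    rw [← prod_subset (subset_univ e)]
    · exact prod_congr rfl fun i hi => by simp [ind_of_mem hi]
    · exact fun i _ hi => by simp [ind_of_notMem hi]
  rw [binomialWeight, hchoose, sum_ind]
  ring

theorem sum_edgeArcs_eq_edgeStar (e : Finset V) :
    ∑ p : Σ i, Fin (ind e i), edgeArcs p.1 e = edgeStar e := by
  rw [Fintype.sum_sigma, edgeStar, ← sum_subset (subset_univ e)]
  · exact sum_congr rfl fun i hi => by simp [ind_of_mem hi]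
  · exact fun i _ hi => by simp [ind_of_notMem hi]

theorem monomial_mul_prod_pow_eq_sum (M : V × V →₀ ℕ) (E : Finset (Finset V)) (y : V → ℕ) :
    monomial M (1 : ℝ) * ∏ i, (∑ e ∈ E with i ∈ e, monomial (edgeArcs i e) 1) ^ y i =
      ∑ f ∈ Fintype.piFinset fun p : Σ i, Fin (y i) => {e ∈ E | p.1 ∈ e},
        monomial (M + ∑ p, edgeArcs p.1 (f p)) 1 := by
  have hprod : ∏ i, (∑ e ∈ E with i ∈ e, monomial (edgeArcs i e) (1 : ℝ)) ^ y i =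
      ∏ p : Σ i, Fin (y i), ∑ e ∈ E with p.1 ∈ e, monomial (edgeArcs p.1 e) (1 : ℝ) := by
    rw [Fintype.prod_sigma]
    exact prod_congr rfl fun i _ => by simp
  rw [hprod, prod_univ_sum, mul_sum]
  simp only [← monomial_sum_one, monomial_mul, one_mul]

theorem rooted_edges_eq_of_walkFunctional_ne_zero (hk : 3 ≤ k) (hu : ∀ e ∈ E, #e = k)
    (hl : ∀ e ∈ E, ∀ f ∈ E, e ≠ f → #(e ∩ f) ≤ 1) {z y : V → ℕ} (hy : ∑ i, y i ≤ k + 2)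
    (hy0 : y ≠ 0) {f : (Σ i, Fin (y i)) → Finset V}
    (hf : f ∈ Fintype.piFinset fun p : Σ i, Fin (y i) => {e ∈ E | p.1 ∈ e})
    (hw : walkFunctional V N (monomial (loopArcs k z + ∑ p, edgeArcs p.1 (f p)) 1) ≠ 0) :
    ∃ e ∈ E, (∀ p, f p = e) ∧ y = ind e := by
  have hfE : ∀ p, f p ∈ E ∧ p.1 ∈ f p := fun p => mem_filter.1 (Fintype.mem_piFinset.1 hf p)
  obtain ⟨a, ha⟩ := exists_arcWalk_of_walkFunctional_ne_zero hw
  obtain ⟨p₀, hp₀⟩ := rooted_edges_eq_of_arcWalk hk hy hy0 (fun p => hu _ (hfE p).1)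
    (fun p q => hl _ (hfE p).1 _ (hfE q).1) (fun p => (hfE p).2) ha
  exact ⟨f p₀, (hfE p₀).1, hp₀⟩

theorem walkFunctional_loops_mul_rows_ind (hk : 3 ≤ k) (hu : ∀ e ∈ E, #e = k)
    (hl : ∀ e ∈ E, ∀ f ∈ E, e ≠ f → #(e ∩ f) ≤ 1) (z : V → ℕ) {e : Finset V} (he : e ∈ E) :
    walkFunctional V N (monomial (loopArcs k z) 1 *
      ∏ i, (∑ e ∈ E with i ∈ e, monomial (edgeArcs i e) 1) ^ ind e i) =
      walkFunctional V N (monomial (loopArcs k z + edgeStar e) 1) := by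
  have hsum : ∑ i, ind e i = k := (sum_ind e).trans (hu e he)
  rw [monomial_mul_prod_pow_eq_sum, map_sum, sum_eq_single fun _ => e, sum_edgeArcs_eq_edgeStar]
  · intro f hf hne
    by_contra hw
    obtain ⟨e', -, hfe', hind⟩ := rooted_edges_eq_of_walkFunctional_ne_zero hk hu hl (by omega)
      (fun h => by simp [h] at hsum; omega) hf hw
    exact hne (funext fun p => (hfe' p).trans (ind_injective hind).symm)
  · intro hmem
    have hroot : ∀ p : Σ i, Fin (ind e i), p.1 ∈ e := fun p => mem_of_ind_ne_zero p.2.pos.ne'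
    exact absurd (Fintype.mem_piFinset.2 fun p => mem_filter.2 ⟨he, hroot p⟩) hmem

theorem walkFunctional_loops_mul_rows (hk : 3 ≤ k) (hu : ∀ e ∈ E, #e = k)
    (hl : ∀ e ∈ E, ∀ f ∈ E, e ≠ f → #(e ∩ f) ≤ 1) (z : V → ℕ) {y : V → ℕ}
    (hy : ∑ i, y i ≤ k + 2) :
    walkFunctional V N (monomial (loopArcs k z) 1 *
      ∏ i, (∑ e ∈ E with i ∈ e, monomial (edgeArcs i e) 1) ^ y i) =
    (if y = 0 then walkFunctional V N (monomial (loopArcs k z) 1) else 0) +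
      ∑ e ∈ E, if y = ind e then walkFunctional V N (monomial (loopArcs k z + edgeStar e) 1)
        else 0 := by
  have hne : ∀ e ∈ E, ind e ≠ 0 := fun e he h => by
    have hsum := sum_ind e
    rw [h, hu e he] at hsum
    simp at hsum
    omega
  by_cases hye : ∃ e ∈ E, y = ind e
  · obtain ⟨e, he, rfl⟩ := hye
    rw [if_neg (hne e he), zero_add, walkFunctional_loops_mul_rows_ind hk hu hl z he,
      sum_eq_single_of_mem e he fun f _ hfe => if_neg fun h => hfe (ind_injective h).symm,
      if_pos rfl]
  · rw [sum_eq_zero fun e he => if_neg fun h => hye ⟨e, he, h⟩, add_zero]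
    split_ifs with hy0
    · simp [hy0]
    · rw [monomial_mul_prod_pow_eq_sum, map_sum]
      refine sum_eq_zero fun f hf => by_contra fun hw => hye ?_
      obtain ⟨e, he, -, hind⟩ :=
        rooted_edges_eq_of_walkFunctional_ne_zero hk hu hl hy hy0 hf hw
      exact ⟨e, he, hind⟩

/-- The row polynomial, in the sense of `rowPoly`, of the tensor with the diagonal entries `D i`
whose off-diagonal part is `b` times the adjacency tensor of the family `E` of edges. -/
noncomputable def familyRow (k : ℕ) (D : V → ℝ) (b : ℝ) (E : Finset (Finset V)) (i : V) :
    MvPolynomial (V × V) ℝ :=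
  b • (∑ e ∈ E with i ∈ e, monomial (edgeArcs i e) 1) + D i • X (i, i) ^ (k - 1)

theorem prod_familyRow_pow (D : V → ℝ) (b : ℝ) (δ : V → ℕ) :
    ∏ i, familyRow k D b E i ^ δ i =
      ∑ y ∈ Fintype.piFinset (fun i => range (δ i + 1)), binomialWeight D b δ y •
        (monomial (loopArcs k (δ - y)) 1 *
          ∏ i, (∑ e ∈ E with i ∈ e, monomial (edgeArcs i e) 1) ^ y i) := by
  simp only [familyRow, add_pow]
  rw [prod_univ_sum]
  refine sum_congr rfl fun y _ => ?_
  rw [← prod_loops_eq_monomial, ← prod_mul_distrib, binomialWeight]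
  simp only [smul_eq_C_mul, map_mul, map_prod, map_pow, map_natCast]
  rw [← prod_pow_eq_pow_sum, ← prod_mul_distrib, ← prod_mul_distrib, ← prod_mul_distrib]
  refine prod_congr rfl fun i _ => ?_
  simp only [mul_pow, Pi.sub_apply]
  ring

theorem walkFunctional_prod_familyRow (hk : 3 ≤ k) (hu : ∀ e ∈ E, #e = k)
    (hl : ∀ e ∈ E, ∀ f ∈ E, e ≠ f → #(e ∩ f) ≤ 1) (D : V → ℝ) (b : ℝ) {δ : V → ℕ}
    (hδ : ∑ i, δ i ≤ k + 2) :
    walkFunctional V N (∏ i, familyRow k D b E i ^ δ i) =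
      (∏ i, D i ^ δ i) * walkFunctional V N (monomial (loopArcs k δ) 1) +
      ∑ e ∈ E, b ^ k * ((∏ i ∈ e, (δ i : ℝ)) * (∏ i, D i ^ (δ i - ind e i)) *
        walkFunctional V N (monomial (loopArcs k (δ - ind e) + edgeStar e) 1)) := by
  have hterm : ∀ y ∈ Fintype.piFinset (fun i => range (δ i + 1)),
      walkFunctional V N (binomialWeight D b δ y • (monomial (loopArcs k (δ - y)) 1 *
          ∏ i, (∑ e ∈ E with i ∈ e, monomial (edgeArcs i e) 1) ^ y i)) =
      (if y = 0 then (∏ i, D i ^ δ i) * walkFunctional V N (monomial (loopArcs k δ) 1) else 0) +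
      ∑ e ∈ E, if y = ind e then binomialWeight D b δ (ind e) * walkFunctional V N
        (monomial (loopArcs k (δ - ind e) + edgeStar e) 1) else 0 := by
    intro y hy
    have hyδ : ∀ i, y i ≤ δ i := fun i =>
      Nat.lt_succ_iff.1 (mem_range.1 (Fintype.mem_piFinset.1 hy i))
    rw [map_smul, walkFunctional_loops_mul_rows hk hu hl _
      ((sum_le_sum fun i _ => hyδ i).trans hδ), smul_eq_mul, mul_add, mul_sum, mul_ite, mul_zero]
    congr 1
    · exact ite_congr rfl (fun h => by rw [h, tsub_zero, binomialWeight_zero]) fun _ => rfl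
    · refine sum_congr rfl fun e _ => ?_
      rw [mul_ite, mul_zero]
      exact ite_congr rfl (fun h => by rw [h]) fun _ => rfl
  rw [prod_familyRow_pow, map_sum, sum_congr rfl hterm, sum_add_distrib, sum_ite_eq',
    if_pos (by simp), sum_comm]
  refine congrArg _ (sum_congr rfl fun e he => ?_)
  have hbinomial : b ^ k * ((∏ i ∈ e, (δ i : ℝ)) * (∏ i, D i ^ (δ i - ind e i))) =
      binomialWeight D b δ (ind e) := by rw [binomialWeight_ind, hu e he]
  rw [sum_ite_eq', ← mul_assoc, hbinomial]
  split_ifs with hmem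
  · rfl
  · have hlt : ∃ i, δ i < ind e i := by
      by_contra! hle
      exact hmem (Fintype.mem_piFinset.2 fun i => mem_range.2 (Nat.lt_succ_iff.2 (hle i)))
    rw [binomialWeight_eq_zero hlt.choose_spec, zero_mul]

end Tensor

/-! ### The weights of the loops and of the edges -/

namespace Tensor

open MvPolynomial Finset

section EdgeStar

variable {V : Type*} [DecidableEq V]

theorem edgeStar_apply (e : Finset V) (u v : V) :
    edgeStar e (u, v) = if u ∈ e ∧ v ∈ e ∧ v ≠ u then 1 else 0 := by
  rw [edgeStar, Finsupp.finsetSum_apply]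
  simp only [edgeArcs_apply]
  by_cases hu : u ∈ e
  · rw [sum_eq_single u (fun i _ hi => by simp [hi.symm]) (fun h => absurd hu h)]
    simp [hu]
  · rw [sum_eq_zero fun i hi => if_neg fun h : u = i ∧ _ => hu (h.1 ▸ hi)]
    simp [hu]

theorem edgeStar_singleton (r : V) : edgeStar ({r} : Finset V) = 0 := by
  ext ⟨u, v⟩
  rw [edgeStar_apply, Finsupp.zero_apply, if_neg]
  rintro ⟨hu, hv, hne⟩
  exact hne ((mem_singleton.1 hv).trans (mem_singleton.1 hu).symm)

theorem edgeStar_insert {r : V} {s : Finset V} (hr : r ∉ s) :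
    edgeStar (insert r s) = edgeStar s +
      ∑ c ∈ s, (Finsupp.single (r, c) 1 + Finsupp.single (c, r) 1) := by
  ext ⟨u, v⟩
  have hout : (∑ c ∈ s, if r = u ∧ c = v then 1 else 0) = if u = r ∧ v ∈ s then 1 else 0 := by
    by_cases h : r = u
    · simp [h]
    · simp [h, Ne.symm h]
  have hin : (∑ c ∈ s, if c = u ∧ r = v then 1 else 0) = if u ∈ s ∧ v = r then 1 else 0 := by
    by_cases h : r = v
    · simp [h]
    · simp [h, Ne.symm h]
  rw [Finsupp.add_apply, Finsupp.finsetSum_apply, edgeStar_apply, edgeStar_apply]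
  simp only [Finsupp.add_apply, sum_add_distrib, Finsupp.single_apply, Prod.mk.injEq, hout, hin]
  by_cases hu : u = r
  · subst hu
    by_cases hv : v = u
    · subst hv; simp [hr]
    · simp [hr, hv]
  · by_cases hv : v = r
    · subst hv; simp [hr, hu, Ne.symm hu]
    · simp [hu, hv]

/-- By induction on the edge: go from `r` to the next vertex `b`, walk through the rest of the edge
from `b` to `b`, return to `r`, and go back and forth between `r` and the remaining vertices. -/
theorem arcWalk_edgeStar_insert (n : V → ℕ) (s : Finset V) :
    ∀ r ∉ s, ArcWalk r r (edgeStar (insert r s) +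
      ∑ i ∈ insert r s, n i • Finsupp.single (i, i) 1) := by
  induction s using Finset.induction_on with
  | empty =>
    intro r _
    simpa [edgeStar_singleton] using (ArcWalk.single r r).nsmul (n r)
  | insert b s hb ih =>
    intro r hr
    have hthroughRest := ((ArcWalk.single r b).trans (ih b hb)).trans (ArcWalk.single b r)
    have hbackForth := ArcWalk.sum s fun c _ => (ArcWalk.single r c).trans (ArcWalk.single c r)
    have hloops := (ArcWalk.single r r).nsmul (n r)
    rw [edgeStar_insert hr, sum_insert hr, sum_insert (f := fun c => _ + _) hb]
    convert (hthroughRest.trans hbackForth).trans hloops using 1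
    abel

theorem degree_edgeStar (e : Finset V) : (edgeStar e).degree = #e * (#e - 1) := by
  rw [edgeStar, map_sum, ← smul_eq_mul, ← sum_const]
  refine sum_congr rfl fun i hi => ?_
  rw [edgeArcs, map_sum]
  simp [card_erase_of_mem hi]

theorem mapDomain_edgeStar (σ : Equiv.Perm V) (e : Finset V) :
    (edgeStar e).mapDomain (σ.prodCongr σ) = edgeStar (e.map σ.toEmbedding) := by
  rw [edgeStar, edgeStar, Finsupp.mapDomain_finsetSum, sum_map]
  refine sum_congr rfl fun i _ => ?_
  rw [edgeArcs, edgeArcs, Finsupp.mapDomain_finsetSum]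
  change _ = ∑ j ∈ (e.map σ.toEmbedding).erase (σ.toEmbedding i), _
  rw [← map_erase, sum_map]
  simp [Finsupp.mapDomain_single]

end EdgeStar

section Loops

variable {V : Type*} [Fintype V] {k : ℕ}

theorem degree_loopArcs (z : V → ℕ) : (loopArcs k z).degree = (∑ i, z i) * (k - 1) := by
  rw [loopArcs, map_sum, sum_mul]
  exact sum_congr rfl fun i _ => Finsupp.degree_single _ _

theorem mapDomain_loopArcs (σ : Equiv.Perm V) (z : V → ℕ) :
    (loopArcs k z).mapDomain (σ.prodCongr σ) = loopArcs k (z ∘ σ.symm) := by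
  rw [loopArcs, loopArcs, Finsupp.mapDomain_finsetSum]
  refine Fintype.sum_equiv σ _ _ fun i => ?_
  rw [Finsupp.mapDomain_single, Function.comp_apply, Equiv.symm_apply_apply]
  rfl

theorem loopArcs_apply_self_ne_zero (hk : 2 ≤ k) {z : V → ℕ} {u : V} (hu : z u ≠ 0) :
    loopArcs k z (u, u) ≠ 0 := by
  classical
  rw [loopArcs_apply, if_pos rfl]
  exact mul_ne_zero hu (by omega)

theorem eq_of_arcWalk_loopArcs (hk : 2 ≤ k) {z : V → ℕ} {a : V} (h : ArcWalk a a (loopArcs k z))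
    {u : V} (hu : z u ≠ 0) : u = a := by
  classical
  have hclosed := (h.mem_iff_of_closed {a} fun u v huv => by
    rw [loopArcs_apply] at huv
    split_ifs at huv with huv'
    · rw [huv']
    · exact absurd rfl huv).2
  exact (hclosed u u (loopArcs_apply_self_ne_zero hk hu)).1 rfl

end Loops

variable {V : Type*} [DecidableEq V] [Fintype V] {k : ℕ}

theorem arcWalk_loopArcs_add_edgeStar {e : Finset V} {r : V} (hr : r ∈ e) {z : V → ℕ}
    (hz : ∀ i, z i ≠ 0 → i ∈ e) : ArcWalk r r (loopArcs k z + edgeStar e) := by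
  have h := arcWalk_edgeStar_insert (fun i => z i * (k - 1)) (e.erase r) r (by simp)
  rw [insert_erase hr] at h
  rw [add_comm]
  convert h using 2
  rw [loopArcs, ← sum_subset (subset_univ e)]
  · simp
  · intro i _ hi
    have hzi : z i = 0 := by_contra fun h => hi (hz i h)
    simp [hzi]

theorem mem_of_arcWalk_loopArcs_add_edgeStar (hk : 2 ≤ k) {e : Finset V} (he : 2 ≤ #e)
    {z : V → ℕ} {a : V} (h : ArcWalk a a (loopArcs k z + edgeStar e)) {u : V} (hu : z u ≠ 0) :
    u ∈ e := by
  have hclosed := (h.mem_iff_of_closed (e : Set V) fun u v huv => by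
    rw [Finsupp.add_apply, loopArcs_apply, edgeStar_apply] at huv
    split_ifs at huv with huv' hmem hmem
    · simp [huv']
    · simp [huv']
    · simp [hmem.1, hmem.2.1]
    · simp at huv).2
  obtain ⟨i, hi, j, hj, hij⟩ := one_lt_card.1 he
  have ha : a ∈ (e : Set V) := (hclosed i j (by
    rw [Finsupp.add_apply, edgeStar_apply, if_pos ⟨hi, hj, hij.symm⟩]; simp)).2 hi
  refine (hclosed u u ?_).1 ha
  rw [Finsupp.add_apply]
  exact (Nat.add_pos_left (Nat.pos_of_ne_zero (loopArcs_apply_self_ne_zero hk hu)) _).ne'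

/-- The coefficient of `∏ i, D i ^ δ i` in the trace of order `∑ i, δ i` of the diagonal tensor with
the diagonal entries `D i`, up to the factor `(k - 1) ^ (n - 1)`. -/
noncomputable def diagWeight (k : ℕ) (δ : V → ℕ) : ℝ :=
  (∏ i, 1 / ((δ i * (k - 1)).factorial : ℝ)) *
    walkFunctional V ((∑ i, δ i) * (k - 1)) (monomial (loopArcs k δ) 1)

/-- The contribution of a single edge, together with `z i` diagonal entries at each vertex `i`, to
the trace of order `#e + ∑ i, z i`, up to the factor `(k - 1) ^ (n - 1)`. -/
noncomputable def edgeWeight (k : ℕ) (e : Finset V) (z : V → ℕ) : ℝ :=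
  (∏ i, 1 / (((z i + ind e i) * (k - 1)).factorial : ℝ)) * (∏ i ∈ e, ((z i : ℝ) + 1)) *
    walkFunctional V ((∑ i, z i + #e) * (k - 1)) (monomial (loopArcs k z + edgeStar e) 1)

theorem diagWeight_single_pos (v : V) (d : ℕ) : 0 < diagWeight k (Pi.single v d) := by
  refine mul_pos (prod_pos fun i _ => by positivity) (walkFunctional_monomial_pos (a := v) ?_ ?_)
  · rw [loopArcs, sum_eq_single v (fun i _ hi => by simp [hi]) (by simp)]
    simpa using (ArcWalk.single v v).nsmul (d * (k - 1))
  · rw [degree_loopArcs]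

theorem eq_single_of_diagWeight_ne_zero (hk : 2 ≤ k) {δ : V → ℕ} (h : diagWeight k δ ≠ 0) :
    ∃ v, δ = Pi.single v (∑ i, δ i) := by
  obtain ⟨a, ha⟩ := exists_arcWalk_of_walkFunctional_ne_zero (right_ne_zero_of_mul h)
  have hδ : ∀ u, u ≠ a → δ u = 0 := fun u hu =>
    by_contra fun h => hu (eq_of_arcWalk_loopArcs hk ha h)
  refine ⟨a, funext fun u => ?_⟩
  rw [sum_eq_single a (fun i _ hi => hδ i hi) (by simp)]
  by_cases hu : u = a
  · subst hu; simp
  · simp [hu, hδ u hu]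

theorem edgeWeight_pos (hk : 1 ≤ k) {e : Finset V} (he : #e = k) {z : V → ℕ}
    (hz : ∀ i, z i ≠ 0 → i ∈ e) : 0 < edgeWeight k e z := by
  obtain ⟨r, hr⟩ := card_pos.1 (he.symm ▸ hk)
  refine mul_pos (mul_pos (prod_pos fun i _ => by positivity) (prod_pos fun i _ => by positivity))
    (walkFunctional_monomial_pos (arcWalk_loopArcs_add_edgeStar hr hz) ?_)
  rw [map_add, degree_loopArcs, degree_edgeStar, he, add_mul]

theorem mem_of_edgeWeight_ne_zero (hk : 2 ≤ k) {e : Finset V} (he : #e = k) {z : V → ℕ}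
    (h : edgeWeight k e z ≠ 0) {i : V} (hi : z i ≠ 0) : i ∈ e := by
  obtain ⟨a, ha⟩ := exists_arcWalk_of_walkFunctional_ne_zero (right_ne_zero_of_mul h)
  exact mem_of_arcWalk_loopArcs_add_edgeStar hk (he.symm ▸ hk) ha hi

theorem diagWeight_comp_symm (σ : Equiv.Perm V) (δ : V → ℕ) :
    diagWeight k (δ ∘ σ.symm) = diagWeight k δ := by
  unfold diagWeight
  rw [← walkFunctional_rename σ _ (monomial (loopArcs k δ) 1), rename_monomial, mapDomain_loopArcs,
    ← Equiv.sum_comp σ, ← Equiv.prod_comp σ]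
  simp

theorem edgeWeight_map_comp_symm (σ : Equiv.Perm V) (e : Finset V) (z : V → ℕ) :
    edgeWeight k (e.map σ.toEmbedding) (z ∘ σ.symm) = edgeWeight k e z := by
  unfold edgeWeight
  rw [← walkFunctional_rename σ _ (monomial (loopArcs k z + edgeStar e) 1), rename_monomial,
    Finsupp.mapDomain_add, mapDomain_loopArcs, mapDomain_edgeStar,
    ← Equiv.sum_comp σ, ← Equiv.prod_comp σ, prod_map]
  simp [ind]

end Tensor

section Permutations

open Finset

variable {V : Type*} [DecidableEq V]

theorem single_comp_perm_symm (σ : Equiv.Perm V) (v : V) (n : ℕ) :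
    (Pi.single v n : V → ℕ) ∘ σ.symm = Pi.single (σ v) n := by
  ext u
  simp [Pi.single_apply, Equiv.symm_apply_eq]

theorem map_swap_eq_of_mem {e : Finset V} {v w : V} (hv : v ∈ e) (hw : w ∈ e) :
    e.map (Equiv.swap v w).toEmbedding = e := by
  refine eq_of_subset_of_card_le (fun x hx => ?_) (by simp)
  obtain ⟨y, hy, rfl⟩ := mem_map.1 hx
  simp only [Equiv.toEmbedding_apply, Equiv.swap_apply_def]
  split_ifs <;> assumption

end Permutations

section PermutationsOfFinite

open Finset

variable {V : Type*} [Finite V]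

theorem exists_perm_map_eq {e e' : Finset V} (h : #e = #e') :
    ∃ σ : Equiv.Perm V, e.map σ.toEmbedding = e' := by
  classical
  have := Fintype.ofFinite V
  let f : {x // x ∈ e} ≃ {x // x ∈ e'} := Finset.equivOfCardEq h
  refine ⟨f.extendSubtype, eq_of_subset_of_card_le (fun x hx => ?_) (by simp [h])⟩
  obtain ⟨y, hy, rfl⟩ := mem_map.1 hx
  exact f.extendSubtype_mem y hy

theorem exists_perm_map_eq_of_mem {e e' : Finset V} (h : #e = #e') {v v' : V} (hv : v ∈ e)
    (hv' : v' ∈ e') : ∃ σ : Equiv.Perm V, e.map σ.toEmbedding = e' ∧ σ v = v' := by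
  classical
  obtain ⟨σ, rfl⟩ := exists_perm_map_eq h
  refine ⟨σ.trans (Equiv.swap (σ v) v'), ?_, by simp⟩
  rw [Equiv.trans_toEmbedding, ← map_map, map_swap_eq_of_mem (by simpa using hv) hv']

theorem exists_perm_map_eq_of_mem_pair {e e' : Finset V} (h : #e = #e') {v v' w w' : V}
    (hv : v ∈ e) (hv' : v' ∈ e') (hw : w ∈ e) (hw' : w' ∈ e') (hvw : v ≠ w) (hvw' : v' ≠ w') :
    ∃ σ : Equiv.Perm V, e.map σ.toEmbedding = e' ∧ σ v = v' ∧ σ w = w' := by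
  classical
  obtain ⟨σ, rfl, rfl⟩ := exists_perm_map_eq_of_mem h hv hv'
  refine ⟨σ.trans (Equiv.swap (σ w) w'), ?_, ?_, by simp⟩
  · rw [Equiv.trans_toEmbedding, ← map_map, map_swap_eq_of_mem (by simpa using hw) hw']
  · exact Equiv.swap_apply_of_ne_of_ne (by simpa using hvw) hvw'

end PermutationsOfFinite

section PiAntidiag

open Finset

variable {V : Type*} [DecidableEq V]

theorem sum_piAntidiag_cons {M : Type*} [AddCommMonoid M] {i : V} {s : Finset V} (hi : i ∉ s)
    (n : ℕ) (F : (V → ℕ) → M) :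
    ∑ z ∈ piAntidiag (cons i s hi) n, F z =
      ∑ p ∈ antidiagonal n, ∑ z ∈ piAntidiag s p.2, F (z + Pi.single i p.1) := by
  rw [piAntidiag_cons, sum_disjiUnion]
  refine sum_congr rfl fun p _ => ?_
  rw [sum_map]
  refine sum_congr rfl fun z _ => congrArg F ?_
  ext t
  simp [Pi.single_apply]

theorem sum_piAntidiag_one {M : Type*} [AddCommMonoid M] (s : Finset V) (F : (V → ℕ) → M) :
    ∑ z ∈ piAntidiag s 1, F z = ∑ v ∈ s, F (Pi.single v 1) := by
  induction s using Finset.cons_induction generalizing F with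
  | empty => simp
  | cons i s hi ih =>
    rw [sum_piAntidiag_cons, sum_cons, show antidiagonal 1 = {(0, 1), (1, 0)} from rfl]
    simp [ih, add_comm]

theorem two_nsmul_sum_piAntidiag_two {M : Type*} [AddCommMonoid M] (s : Finset V)
    (F : (V → ℕ) → M) :
    2 • ∑ z ∈ piAntidiag s 2, F z = 2 • ∑ v ∈ s, F (Pi.single v 2) +
      ∑ v ∈ s, ∑ w ∈ s.erase v, F (Pi.single v 1 + Pi.single w 1) := by
  induction s using Finset.cons_induction generalizing F with
  | empty => simp
  | cons i s hi ih =>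
    have herase : ∀ v ∈ s, ∑ w ∈ (cons i s hi).erase v, F (Pi.single v 1 + Pi.single w 1) =
        F (Pi.single i 1 + Pi.single v 1) +
          ∑ w ∈ s.erase v, F (Pi.single v 1 + Pi.single w 1) := by
      intro v hv
      rw [erase_cons_of_ne hi fun h => hi (h ▸ hv), sum_cons, add_comm (Pi.single v 1)]
    have hmixed := sum_piAntidiag_one s fun z => F (z + Pi.single i 1)
    simp only [add_comm _ (Pi.single i 1)] at hmixed
    rw [sum_piAntidiag_cons, sum_cons, sum_cons, sum_congr rfl herase, erase_cons, sum_add_distrib,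
      show antidiagonal 2 = {(0, 2), (1, 1), (2, 0)} from rfl]
    simp only [add_comm _ (Pi.single i _), mem_insert, mem_singleton, Prod.mk.injEq, zero_ne_one,
      OfNat.ofNat_ne_zero, OfNat.one_ne_ofNat, and_false, or_false, false_and, not_false_eq_true,
      sum_insert, Pi.single_zero, zero_add, hmixed, sum_singleton, piAntidiag_zero, add_zero,
      nsmul_add, ih]
    abel

end PiAntidiag

/-! ### Traces of linear families of edges -/

namespace Tensor

open MvPolynomial Finset

variable {V : Type*} [DecidableEq V] [Fintype V] {k d : ℕ} {E : Finset (Finset V)}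

theorem prod_pow_single (D : V → ℝ) (v : V) (n : ℕ) :
    ∏ i, D i ^ (Pi.single v n : V → ℕ) i = D v ^ n := by
  rw [prod_eq_single v (fun i _ hi => by simp [hi]) (by simp), Pi.single_eq_same]

/-- The trace of order `d`, without the factor `(k - 1) ^ (n - 1)`, of the tensor with the diagonal
entries `D i` whose off-diagonal part is `b` times the adjacency tensor of the family `E`. -/
noncomputable def familyTrace (k : ℕ) (D : V → ℝ) (b : ℝ) (E : Finset (Finset V)) (d : ℕ) : ℝ :=
  ∑ δ ∈ (univ : Finset V).piAntidiag d, (∏ i : V, 1 / ((δ i * (k - 1)).factorial : ℝ)) *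
    walkFunctional V (d * (k - 1)) (∏ i, familyRow k D b E i ^ δ i)

/-- The contribution of the edge `e` to the summand with the exponents `δ` of `familyTrace`, up to
the factor `b ^ k`. -/
noncomputable def edgeTerm (k : ℕ) (D : V → ℝ) (e : Finset V) (δ : V → ℕ) : ℝ :=
  (∏ i : V, 1 / ((δ i * (k - 1)).factorial : ℝ)) *
    ((∏ i ∈ e, (δ i : ℝ)) * (∏ i, D i ^ (δ i - ind e i)) *
      walkFunctional V ((∑ i, δ i) * (k - 1)) (monomial (loopArcs k (δ - ind e) + edgeStar e) 1))

theorem edgeTerm_add_ind (D : V → ℝ) (e : Finset V) (z : V → ℕ) :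
    edgeTerm k D e (z + ind e) = edgeWeight k e z * ∏ i, D i ^ z i := by
  have hprod : ∏ i ∈ e, ((z + ind e) i : ℝ) = ∏ i ∈ e, ((z i : ℝ) + 1) :=
    prod_congr rfl fun i hi => by simp [ind_of_mem hi]
  rw [edgeTerm, edgeWeight, hprod]
  simp only [Pi.add_apply, add_tsub_cancel_right, sum_add_distrib, sum_ind]
  ring

theorem ind_le_of_edgeTerm_ne_zero {D : V → ℝ} {e : Finset V} {δ : V → ℕ}
    (h : edgeTerm k D e δ ≠ 0) : ind e ≤ δ := by
  intro i
  by_cases hi : i ∈ e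
  · rw [ind_of_mem hi]
    exact Nat.one_le_iff_ne_zero.2 <| by
      simpa using prod_ne_zero_iff.1
        (left_ne_zero_of_mul (left_ne_zero_of_mul (right_ne_zero_of_mul h))) i hi
  · simp [ind_of_notMem hi]

theorem mem_of_edgeTerm_ne_zero (hk : 2 ≤ k) {D : V → ℝ} {e : Finset V} (he : #e = k) {δ : V → ℕ}
    (h : edgeTerm k D e δ ≠ 0) {i : V} (hi : δ i ≠ 0) : i ∈ e := by
  by_contra hie
  obtain ⟨z, rfl⟩ := exists_add_of_le (ind_le_of_edgeTerm_ne_zero h)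
  rw [add_comm, edgeTerm_add_ind] at h
  rw [Pi.add_apply, ind_of_notMem hie, zero_add] at hi
  exact hie (mem_of_edgeWeight_ne_zero hk he (left_ne_zero_of_mul h) hi)

theorem sum_edgeTerm_of_lt {D : V → ℝ} {e : Finset V} (hd : d < #e) :
    ∑ δ ∈ (univ : Finset V).piAntidiag d, edgeTerm k D e δ = 0 := by
  refine sum_eq_zero fun δ hδ => by_contra fun h => ?_
  have hle := sum_le_sum fun i (_ : i ∈ univ) => ind_le_of_edgeTerm_ne_zero h i
  rw [sum_ind, (mem_piAntidiag.1 hδ).1] at hle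
  omega

theorem sum_edgeTerm_card_add (hk : 2 ≤ k) (D : V → ℝ) {e : Finset V} (he : #e = k) (r : ℕ) :
    ∑ δ ∈ (univ : Finset V).piAntidiag (k + r), edgeTerm k D e δ =
      ∑ z ∈ e.piAntidiag r, edgeWeight k e z * ∏ i, D i ^ z i := by
  have hsum : ∀ z : V → ℕ, (∀ i, z i ≠ 0 → i ∈ e) → ∑ i ∈ e, z i = ∑ i, z i := fun z hz =>
    sum_subset (subset_univ e) fun i _ hi => by_contra fun h => hi (hz i h)
  symm
  refine sum_of_injOn (fun z => z + ind e) (fun z _ z' _ h => add_right_cancel h) ?_ ?_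
    fun z _ => (edgeTerm_add_ind D e z).symm
  · intro z hz
    obtain ⟨hzr, hze⟩ := mem_piAntidiag.1 hz
    refine mem_piAntidiag.2 ⟨?_, fun _ _ => mem_univ _⟩
    simp only [Pi.add_apply, sum_add_distrib, sum_ind]
    rw [← hsum z hze, hzr, he, add_comm]
  · intro δ hδ hne
    by_contra h
    obtain ⟨z, rfl⟩ := exists_add_of_le (ind_le_of_edgeTerm_ne_zero h)
    have hze : ∀ i, z i ≠ 0 → i ∈ e := fun i hi =>
      mem_of_edgeTerm_ne_zero hk he h (by rw [Pi.add_apply]; omega)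
    refine hne ⟨z, mem_piAntidiag.2 ⟨?_, hze⟩, add_comm z (ind e)⟩
    have hδsum := (mem_piAntidiag.1 hδ).1
    simp only [Pi.add_apply, sum_add_distrib, sum_ind] at hδsum
    rw [hsum z hze]
    omega

theorem familyTrace_eq_sum_diagWeight_add_sum_edgeTerm (hk : 3 ≤ k) (hu : ∀ e ∈ E, #e = k)
    (hl : ∀ e ∈ E, ∀ f ∈ E, e ≠ f → #(e ∩ f) ≤ 1) (D : V → ℝ) (b : ℝ) (hd : d ≤ k + 2) :
    familyTrace k D b E d =
      ∑ δ ∈ (univ : Finset V).piAntidiag d, diagWeight k δ * ∏ i, D i ^ δ i +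
      b ^ k * ∑ e ∈ E, ∑ δ ∈ (univ : Finset V).piAntidiag d, edgeTerm k D e δ := by
  rw [familyTrace, sum_comm, mul_sum, ← sum_add_distrib]
  refine sum_congr rfl fun δ hδ => ?_
  obtain ⟨rfl, -⟩ := mem_piAntidiag.1 hδ
  rw [walkFunctional_prod_familyRow hk hu hl D b hd, mul_add, mul_sum, mul_sum, diagWeight]
  congr 1
  · ring
  · exact sum_congr rfl fun e _ => by rw [edgeTerm]; ring

variable (V) in
theorem exists_sum_diagWeight_eq (hk : 2 ≤ k) (hd : d ≠ 0) : ∃ c : ℝ, 0 < c ∧ ∀ D : V → ℝ,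
    ∑ δ ∈ (univ : Finset V).piAntidiag d, diagWeight k δ * ∏ i, D i ^ δ i =
      c * ∑ v, D v ^ d := by
  rcases isEmpty_or_nonempty V with _ | ⟨⟨v₀⟩⟩
  · refine ⟨1, one_pos, fun D => ?_⟩
    rw [univ_eq_empty, piAntidiag_empty_of_ne_zero hd]
    simp
  refine ⟨diagWeight k (Pi.single v₀ d), diagWeight_single_pos v₀ d, fun D => ?_⟩
  rw [mul_sum]
  symm
  refine sum_of_injOn (fun v => Pi.single v d) (fun v _ w _ h => ?_) ?_ ?_ ?_
  · exact by_contra fun hvw => hd (by simpa [Pi.single_apply, hvw] using congrFun h v)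
  · intro v _
    simp [mem_piAntidiag]
  · intro δ hδ hne
    by_contra h
    obtain ⟨v, hv⟩ := eq_single_of_diagWeight_ne_zero hk (left_ne_zero_of_mul h)
    rw [(mem_piAntidiag.1 hδ).1] at hv
    exact hne ⟨v, by simp, hv.symm⟩
  · intro v _
    rw [← diagWeight_comp_symm (Equiv.swap v₀ v) (Pi.single v₀ d), single_comp_perm_symm,
      Equiv.swap_apply_left, prod_pow_single]

theorem edgeWeight_congr {e e' : Finset V} {z z' : V → ℕ} {σ : Equiv.Perm V}
    (he : e.map σ.toEmbedding = e') (hz : z ∘ σ.symm = z') :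
    edgeWeight k e z = edgeWeight k e' z' := by
  rw [← he, ← hz, edgeWeight_map_comp_symm]

variable (V k) in
theorem exists_edgeWeight_zero_eq :
    ∃ κ : ℝ, ∀ e : Finset V, #e = k → edgeWeight k e 0 = κ := by
  by_cases hne : ∃ e : Finset V, #e = k
  · obtain ⟨e₀, he₀⟩ := hne
    refine ⟨edgeWeight k e₀ 0, fun e he => ?_⟩
    obtain ⟨σ, hσ⟩ := exists_perm_map_eq (he.trans he₀.symm)
    exact edgeWeight_congr hσ rfl
  · exact ⟨0, fun e he => absurd ⟨e, he⟩ hne⟩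

variable (V k) in
theorem exists_edgeWeight_single_eq (n : ℕ) :
    ∃ κ : ℝ, ∀ e : Finset V, #e = k → ∀ v ∈ e, edgeWeight k e (Pi.single v n) = κ := by
  by_cases hne : ∃ e : Finset V, #e = k ∧ ∃ v, v ∈ e
  · obtain ⟨e₀, he₀, v₀, hv₀⟩ := hne
    refine ⟨edgeWeight k e₀ (Pi.single v₀ n), fun e he v hv => ?_⟩
    obtain ⟨σ, hσ, rfl⟩ := exists_perm_map_eq_of_mem (he.trans he₀.symm) hv hv₀
    exact edgeWeight_congr hσ (single_comp_perm_symm σ v n)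
  · exact ⟨0, fun e he v hv => absurd ⟨e, he, v, hv⟩ hne⟩

theorem edgeWeight_single_add_single_pos (hk : 1 ≤ k) {e : Finset V} (he : #e = k) {v w : V}
    (hv : v ∈ e) (hw : w ∈ e) : 0 < edgeWeight k e (Pi.single v 1 + Pi.single w 1) := by
  refine edgeWeight_pos hk he fun i hi => by_contra fun hie => hi ?_
  simp [show i ≠ v from fun h => hie (h ▸ hv), show i ≠ w from fun h => hie (h ▸ hw)]

variable (V) in
theorem exists_edgeWeight_single_add_single_eq (hk : 1 ≤ k) :
    ∃ κ : ℝ, 0 < κ ∧ ∀ e : Finset V, #e = k → ∀ v ∈ e, ∀ w ∈ e.erase v,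
      edgeWeight k e (Pi.single v 1 + Pi.single w 1) = κ := by
  by_cases hne : ∃ e : Finset V, #e = k ∧ ∃ v ∈ e, ∃ w, w ∈ e.erase v
  · obtain ⟨e₀, he₀, v₀, hv₀, w₀, hw₀⟩ := hne
    obtain ⟨hw₀v₀, hw₀⟩ := mem_erase.1 hw₀
    refine ⟨edgeWeight k e₀ (Pi.single v₀ 1 + Pi.single w₀ 1),
      edgeWeight_single_add_single_pos hk he₀ hv₀ hw₀, fun e he v hv w hw => ?_⟩
    obtain ⟨hwv, hw⟩ := mem_erase.1 hw
    obtain ⟨σ, hσ, rfl, rfl⟩ := exists_perm_map_eq_of_mem_pair (he.trans he₀.symm) hv hv₀ hw hw₀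
      hwv.symm hw₀v₀.symm
    exact edgeWeight_congr hσ (by rw [Pi.add_comp, single_comp_perm_symm, single_comp_perm_symm])
  · exact ⟨1, one_pos, fun e he v hv w hw => absurd ⟨e, he, v, hv, w, hw⟩ hne⟩

variable (V) in
theorem exists_familyTrace_eq_of_lt (hk : 3 ≤ k) (hd : d ≠ 0) (hdk : d < k) :
    ∃ c : ℝ, 0 < c ∧ ∀ E : Finset (Finset V), (∀ e ∈ E, #e = k) →
      (∀ e ∈ E, ∀ f ∈ E, e ≠ f → #(e ∩ f) ≤ 1) → ∀ (D : V → ℝ) (b : ℝ),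
      familyTrace k D b E d = c * ∑ v, D v ^ d := by
  obtain ⟨c, hc, hdiag⟩ := exists_sum_diagWeight_eq V (k := k) (by omega) hd
  refine ⟨c, hc, fun E hu hl D b => ?_⟩
  rw [familyTrace_eq_sum_diagWeight_add_sum_edgeTerm hk hu hl D b (by omega), hdiag,
    sum_eq_zero fun e he => sum_edgeTerm_of_lt (by rwa [hu e he]), mul_zero, add_zero]

theorem familyTrace_card_add (hk : 3 ≤ k) (hu : ∀ e ∈ E, #e = k)
    (hl : ∀ e ∈ E, ∀ f ∈ E, e ≠ f → #(e ∩ f) ≤ 1) (D : V → ℝ) (b : ℝ) {r : ℕ} (hr : r ≤ 2) :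
    familyTrace k D b E (k + r) =
      ∑ δ ∈ (univ : Finset V).piAntidiag (k + r), diagWeight k δ * ∏ i, D i ^ δ i +
      b ^ k * ∑ e ∈ E, ∑ z ∈ e.piAntidiag r, edgeWeight k e z * ∏ i, D i ^ z i := by
  rw [familyTrace_eq_sum_diagWeight_add_sum_edgeTerm hk hu hl D b (by omega),
    sum_congr rfl fun e he => sum_edgeTerm_card_add (by omega) D (hu e he) r]

variable (V) in
theorem exists_familyTrace_card_eq (hk : 3 ≤ k) :
    ∃ c κ : ℝ, ∀ E : Finset (Finset V), (∀ e ∈ E, #e = k) →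
      (∀ e ∈ E, ∀ f ∈ E, e ≠ f → #(e ∩ f) ≤ 1) → ∀ (D : V → ℝ) (b : ℝ),
      familyTrace k D b E k = c * ∑ v, D v ^ k + b ^ k * (κ * #E) := by
  obtain ⟨c, -, hdiag⟩ := exists_sum_diagWeight_eq V (k := k) (d := k) (by omega) (by omega)
  obtain ⟨κ, hκ⟩ := exists_edgeWeight_zero_eq V k
  refine ⟨c, κ, fun E hu hl D b => ?_⟩
  have h := familyTrace_card_add hk hu hl D b (Nat.zero_le 2)
  rw [add_zero, hdiag] at h
  rw [h, mul_comm κ, ← nsmul_eq_mul, ← sum_const]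
  congr 2
  refine sum_congr rfl fun e he => ?_
  rw [piAntidiag_zero, sum_singleton, hκ e (hu e he)]
  simp

variable (V) in
theorem exists_familyTrace_card_add_one_eq (hk : 3 ≤ k) :
    ∃ c κ : ℝ, ∀ E : Finset (Finset V), (∀ e ∈ E, #e = k) →
      (∀ e ∈ E, ∀ f ∈ E, e ≠ f → #(e ∩ f) ≤ 1) → ∀ (D : V → ℝ) (b : ℝ),
      familyTrace k D b E (k + 1) =
        c * ∑ v, D v ^ (k + 1) + b ^ k * (κ * ∑ e ∈ E, ∑ v ∈ e, D v) := by
  obtain ⟨c, -, hdiag⟩ := exists_sum_diagWeight_eq V (k := k) (d := k + 1) (by omega) (by omega)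
  obtain ⟨κ, hκ⟩ := exists_edgeWeight_single_eq V k 1
  refine ⟨c, κ, fun E hu hl D b => ?_⟩
  rw [familyTrace_card_add hk hu hl D b one_le_two, hdiag]
  congr 2
  rw [mul_sum]
  refine sum_congr rfl fun e he => ?_
  rw [sum_piAntidiag_one, mul_sum]
  exact sum_congr rfl fun v hv => by rw [hκ e (hu e he) v hv, prod_pow_single, pow_one]

variable (V) in
theorem exists_familyTrace_card_add_two_eq (hk : 3 ≤ k) :
    ∃ c κ κ' : ℝ, 0 < κ' ∧ ∀ E : Finset (Finset V), (∀ e ∈ E, #e = k) →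
      (∀ e ∈ E, ∀ f ∈ E, e ≠ f → #(e ∩ f) ≤ 1) → ∀ (D : V → ℝ) (b : ℝ),
      familyTrace k D b E (k + 2) = c * ∑ v, D v ^ (k + 2) +
        b ^ k * (κ * ∑ e ∈ E, ∑ v ∈ e, D v ^ 2 +
          κ' * ∑ e ∈ E, ∑ v ∈ e, ∑ w ∈ e.erase v, D v * D w) := by
  obtain ⟨c, -, hdiag⟩ := exists_sum_diagWeight_eq V (k := k) (d := k + 2) (by omega) (by omega)
  obtain ⟨κ, hκ⟩ := exists_edgeWeight_single_eq V k 2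
  obtain ⟨κ', hpos, hκ'⟩ := exists_edgeWeight_single_add_single_eq V (k := k) (by omega)
  refine ⟨c, κ, κ' / 2, by positivity, fun E hu hl D b => ?_⟩
  rw [familyTrace_card_add hk hu hl D b le_rfl, hdiag]
  congr 2
  rw [mul_sum, mul_sum, ← sum_add_distrib]
  refine sum_congr rfl fun e he => ?_
  have hdouble : ∑ v ∈ e, edgeWeight k e (Pi.single v 2) *
      ∏ i, D i ^ (Pi.single v 2 : V → ℕ) i = κ * ∑ v ∈ e, D v ^ 2 := by
    rw [mul_sum]
    exact sum_congr rfl fun v hv => by rw [hκ e (hu e he) v hv, prod_pow_single]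
  have hmixed : ∑ v ∈ e, ∑ w ∈ e.erase v, edgeWeight k e (Pi.single v 1 + Pi.single w 1) *
      ∏ i, D i ^ (Pi.single v 1 + Pi.single w 1 : V → ℕ) i =
      κ' * ∑ v ∈ e, ∑ w ∈ e.erase v, D v * D w := by
    simp only [mul_sum]
    refine sum_congr rfl fun v hv => sum_congr rfl fun w hw => ?_
    rw [hκ' e (hu e he) v hv w hw]
    simp only [Pi.add_apply, pow_add, prod_mul_distrib, prod_pow_single, pow_one]
  have htwice := two_nsmul_sum_piAntidiag_two e fun z => edgeWeight k e z * ∏ i, D i ^ z i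
  simp only [two_nsmul] at htwice
  rw [hdouble, hmixed] at htwice
  linarith

end Tensor

/-! ### Spectral moments of linear hypergraphs -/

namespace UnicyclicHypergraph

open Hypergraph Finset MvPolynomial Tensor

variable {V W : Type*} {k : ℕ} {α : ℝ}

theorem degree_image (f : V ≃ W) (H : Hypergraph V) (v : V) :
    (H.image f).degree (f v) = H.degree v := by
  rw [degree, degree, ← Set.ncard_image_of_injective _ (Set.image_injective.2 f.injective)]
  congr 1
  ext e
  constructor
  · rintro ⟨⟨e, he, rfl⟩, hv⟩
    exact ⟨e, ⟨he, by simpa using hv⟩, rfl⟩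
  · rintro ⟨e, ⟨he, hv⟩, rfl⟩
    exact ⟨⟨e, he, rfl⟩, by simpa using hv⟩

theorem moment_eq_of_iso [Fintype V] [DecidableEq V] [Fintype W] [DecidableEq W]
    {H : Hypergraph V} {H' : Hypergraph W} (h : H.Iso H') (k : ℕ) (α : ℝ) (d : ℕ) :
    H.moment k α d = H'.moment k α d := by
  classical
  obtain ⟨f, rfl⟩ := h
  refine trace_congr f (fun i β => ?_) d
  have hedge : (insert (f i) (Set.range (f ∘ β)) ∈ (H.image f).edgeSet) =
      (insert i (Set.range β) ∈ H.edgeSet) := by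
    rw [Set.range_comp, ← Set.image_insert_eq]
    exact propext (Set.image_injective.2 f.injective).mem_set_image
  simp only [alphaTensor, Pi.add_apply, Pi.smul_apply, degTensor, adjTensor, hedge,
    degree_image, Function.comp_apply, f.apply_eq_iff_eq]
  congr

section Tuples

variable [DecidableEq V] {e : Finset V} {i : V}

theorem injective_and_image_eq_erase_of_insert_image_eq (he : #e = k) (hi : i ∈ e)
    {β : Fin (k - 1) → V} (h : insert i (univ.image β) = e) :
    Function.Injective β ∧ univ.image β = e.erase i := by
  have hsub : e.erase i ⊆ univ.image β := fun x hx => by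
    rw [mem_erase, ← h, mem_insert] at hx
    exact hx.2.resolve_left hx.1
  have hcard : #(e.erase i) = Fintype.card (Fin (k - 1)) := by
    rw [card_erase_of_mem hi, he, Fintype.card_fin]
  have heq := eq_of_subset_of_card_le hsub (hcard ▸ card_image_le)
  refine ⟨?_, heq.symm⟩
  rw [← Set.injOn_univ, ← coe_univ, ← card_image_iff, ← heq, hcard, card_univ]

theorem insert_image_embedding_eq (he : #e = k) (hi : i ∈ e)
    (φ : Fin (k - 1) ↪ {x // x ∈ e.erase i}) :
    insert i (univ.image fun j => (φ j : V)) = e := by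
  have himg : univ.image (fun j => (φ j : V)) = e.erase i := by
    refine eq_of_subset_of_card_le (image_subset_iff.2 fun j _ => (φ j).2) ?_
    rw [card_image_of_injective _ fun _ _ h => φ.injective (Subtype.ext h), card_univ,
      Fintype.card_fin, card_erase_of_mem hi, he]
  rw [himg, insert_erase hi]

theorem card_filter_insert_image_eq [Fintype V] (he : #e = k) (hi : i ∈ e) :
    #{β : Fin (k - 1) → V | insert i (univ.image β) = e} = (k - 1).factorial := by
  have hcard : Fintype.card (Fin (k - 1) ↪ {x // x ∈ e.erase i}) = (k - 1).factorial := by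
    rw [Fintype.card_embedding_eq, Fintype.card_coe, card_erase_of_mem hi, he, Fintype.card_fin,
      Nat.descFactorial_self]
  rw [← hcard, ← card_univ, ← card_image_of_injective univ (f :=
    fun (φ : Fin (k - 1) ↪ {x // x ∈ e.erase i}) j => (φ j : V)) fun φ ψ h =>
      DFunLike.ext _ _ fun j => Subtype.ext (congrFun h j)]
  congr 1
  ext β
  simp only [mem_filter, mem_univ, true_and, mem_image]
  constructor
  · intro h
    obtain ⟨hinj, himg⟩ := injective_and_image_eq_erase_of_insert_image_eq he hi h
    exact ⟨⟨fun j => ⟨β j, himg ▸ mem_image_of_mem β (mem_univ j)⟩, fun a b hab =>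
      hinj (congrArg Subtype.val hab)⟩, rfl⟩
  · rintro ⟨φ, rfl⟩
    exact insert_image_embedding_eq he hi φ

theorem sum_smul_prod_X_eq_monomial_edgeArcs [Fintype V] (he : #e = k) (hi : i ∈ e) :
    ∑ β : Fin (k - 1) → V,
      (if insert i (univ.image β) = e then 1 / ((k - 1).factorial : ℝ) else 0) •
        ∏ j, X (R := ℝ) (i, β j) = monomial (edgeArcs i e) 1 := by
  have hprod : ∀ β : Fin (k - 1) → V, insert i (univ.image β) = e →
      ∏ j, X (R := ℝ) (i, β j) = monomial (edgeArcs i e) 1 := by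
    intro β hβ
    obtain ⟨hinj, himg⟩ := injective_and_image_eq_erase_of_insert_image_eq he hi hβ
    rw [edgeArcs, monomial_sum_one, ← himg, prod_image fun a _ b _ h => hinj h]
    rfl
  simp only [ite_smul, zero_smul]
  rw [← sum_filter, sum_congr rfl fun β hβ => by rw [hprod β (mem_filter.1 hβ).2], sum_const,
    card_filter_insert_image_eq he hi, ← Nat.cast_smul_eq_nsmul ℝ, smul_smul, mul_one_div,
    div_self (by positivity), one_smul]

end Tuples

section EdgeFamily

variable [Fintype V] {H : Hypergraph V}

/-- The edges of a hypergraph on a finite vertex type, as finsets. -/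
noncomputable def edgeFamily (H : Hypergraph V) : Finset (Finset V) :=
  open Classical in {e | (e : Set V) ∈ H.edgeSet}

theorem mem_edgeFamily {e : Finset V} : e ∈ edgeFamily H ↔ (e : Set V) ∈ H.edgeSet := by
  simp [edgeFamily]

theorem card_edgeFamily (H : Hypergraph V) : #(edgeFamily H) = H.edgeSet.ncard := by
  classical
  rw [← Set.ncard_coe_finset, ← Set.ncard_image_of_injective _ (Finset.coe_injective (α := V))]
  congr 1
  ext e
  constructor
  · rintro ⟨e, he, rfl⟩
    simpa [mem_edgeFamily] using he
  · intro he
    exact ⟨e.toFinset, by simp [mem_edgeFamily, he], by simp⟩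

theorem card_eq_of_isUniform (hu : H.IsUniform k) : ∀ e ∈ edgeFamily H, #e = k := fun e he => by
  rw [← hu e (mem_edgeFamily.1 he), Set.ncard_coe_finset]

theorem card_filter_mem_edgeFamily (H : Hypergraph V) (v : V)
    [DecidablePred (v ∈ · : Finset V → Prop)] :
    #{e ∈ edgeFamily H | v ∈ e} = H.degree v := by
  classical
  rw [degree, ← Set.ncard_coe_finset,
    ← Set.ncard_image_of_injective _ (Finset.coe_injective (α := V))]
  congr 1
  ext e
  constructor
  · rintro ⟨e, he, rfl⟩
    simpa [mem_edgeFamily] using he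
  · rintro ⟨he, hv⟩
    exact ⟨e.toFinset, by simp [mem_edgeFamily, he, hv], by simp⟩

theorem sum_edgeFamily_sum (H : Hypergraph V) {R : Type*} [CommSemiring R] (F : V → R) :
    ∑ e ∈ edgeFamily H, ∑ v ∈ e, F v = ∑ v, (H.degree v : R) * F v := by
  classical
  simp_rw [← card_filter_mem_edgeFamily H, card_filter, Nat.cast_sum, sum_mul]
  rw [sum_comm]
  refine sum_congr rfl fun e _ => ?_
  rw [← sum_subset (subset_univ e) fun v _ hv => by simp [hv]]
  exact sum_congr rfl fun v hv => by simp [hv]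

theorem sum_degree (hu : H.IsUniform k) : ∑ v, H.degree v = k * H.edgeSet.ncard := by
  have hsum := sum_edgeFamily_sum H (fun _ => 1)
  simp only [mul_one, Nat.cast_id] at hsum
  rw [← hsum, ← card_edgeFamily, mul_comm, ← smul_eq_mul, ← sum_const]
  exact sum_congr rfl fun e he => by simp [card_eq_of_isUniform hu e he]

theorem sum_edgeFamily_sum_mul_degree (H : Hypergraph V) (α : ℝ) :
    ∑ e ∈ edgeFamily H, ∑ v ∈ e, α * (H.degree v : ℝ) = α * ∑ v, (H.degree v : ℝ) ^ 2 := by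
  rw [sum_edgeFamily_sum, mul_sum]
  exact sum_congr rfl fun v _ => by ring

theorem sum_edgeFamily_sum_mul_degree_sq (H : Hypergraph V) (α : ℝ) :
    ∑ e ∈ edgeFamily H, ∑ v ∈ e, (α * (H.degree v : ℝ)) ^ 2 =
      α ^ 2 * ∑ v, (H.degree v : ℝ) ^ 3 := by
  rw [sum_edgeFamily_sum, mul_sum]
  exact sum_congr rfl fun v _ => by ring

variable [DecidableEq V]

theorem card_inter_le_one_of_isLinear (hl : H.IsLinear) :
    ∀ e ∈ edgeFamily H, ∀ f ∈ edgeFamily H, e ≠ f → #(e ∩ f) ≤ 1 := fun e he f hf hef => by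
  rw [card_le_one_iff_subsingleton, coe_inter]
  exact hl _ (mem_edgeFamily.1 he) _ (mem_edgeFamily.1 hf) fun h => hef (coe_injective h)

theorem alphaTensor_apply (H : Hypergraph V) (k : ℕ) (α : ℝ) (i : V)
    (β : Fin (k - 1) → V) : H.alphaTensor k α i β =
      (1 - α) * (∑ e ∈ edgeFamily H with i ∈ e,
        if insert i (univ.image β) = e then 1 / ((k - 1).factorial : ℝ) else 0) +
      if β = fun _ => i then α * H.degree i else 0 := by
  classical
  rw [sum_ite_eq]
  simp only [alphaTensor, Pi.add_apply, Pi.smul_apply, degTensor, adjTensor, smul_eq_mul,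
    mem_filter, mem_edgeFamily, coe_insert, coe_image, coe_univ, Set.image_univ, mem_insert_self,
    and_true, funext_iff, mul_ite, mul_zero]
  rw [add_comm]

theorem rowPoly_alphaTensor (hu : H.IsUniform k) (α : ℝ) (i : V) :
    rowPoly (H.alphaTensor k α) i =
      familyRow k (fun v => α * H.degree v) (1 - α) (edgeFamily H) i := by
  rw [rowPoly, familyRow, ← sum_congr rfl fun e he => sum_smul_prod_X_eq_monomial_edgeArcs
    (card_eq_of_isUniform hu e (mem_filter.1 he).1) (mem_filter.1 he).2]
  simp only [alphaTensor_apply, add_smul, sum_add_distrib, mul_smul, sum_smul, smul_sum]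
  rw [sum_comm]
  congr 1
  simp [ite_smul, mul_smul]

theorem moment_eq_familyTrace (hu : H.IsUniform k) (α : ℝ) (d : ℕ) :
    H.moment k α d = ((k : ℝ) - 1) ^ (Fintype.card V - 1) *
      familyTrace k (fun v => α * H.degree v) (1 - α) (edgeFamily H) d := by
  rw [moment, trace_eq_sum_walkFunctional, familyTrace]
  simp only [rowPoly_alphaTensor hu]

theorem sum_edgeFamily_sum_erase_mul_degree (H : Hypergraph V) (α : ℝ) :
    ∑ e ∈ edgeFamily H, ∑ v ∈ e, ∑ w ∈ e.erase v,
      α * (H.degree v : ℝ) * (α * (H.degree w : ℝ)) =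
      α ^ 2 * (∑ e ∈ edgeFamily H, (∑ v ∈ e, H.degree v) ^ 2 : ℕ) -
        α ^ 2 * ∑ v, (H.degree v : ℝ) ^ 3 := by
  rw [← sum_edgeFamily_sum_mul_degree_sq, Nat.cast_sum, mul_sum, ← sum_sub_distrib]
  refine sum_congr rfl fun e _ => ?_
  push_cast
  rw [sq (∑ v ∈ e, _), sum_mul_sum, mul_sum, ← sum_sub_distrib]
  refine sum_congr rfl fun v hv => ?_
  rw [← add_sum_erase e _ hv, mul_add, mul_sum]
  simp only [mul_mul_mul_comm α _ α, ← sq α]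
  ring

theorem moment_zero (hu : H.IsUniform k) (α : ℝ) :
    H.moment k α 0 =
      ((k : ℝ) - 1) ^ (Fintype.card V - 1) * walkFunctional V 0 1 := by
  rw [moment_eq_familyTrace hu, familyTrace]
  simp

end EdgeFamily

section Comparison

variable [Fintype V] [DecidableEq V] {H H' : Hypergraph V}

theorem moment_congr_of_lt_card (hk : 3 ≤ k) (hu : H.IsUniform k) (hu' : H'.IsUniform k)
    (hl : H.IsLinear) (hl' : H'.IsLinear) {t : ℕ} (ht : t < k)
    (hd : ∑ v, H.degree v ^ t = ∑ v, H'.degree v ^ t) : H.moment k α t = H'.moment k α t := by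
  rcases eq_or_ne t 0 with rfl | ht0
  · rw [moment_zero hu, moment_zero hu']
  obtain ⟨c, -, hc⟩ := exists_familyTrace_eq_of_lt V hk ht0 ht
  rw [moment_eq_familyTrace hu, moment_eq_familyTrace hu',
    hc _ (card_eq_of_isUniform hu) (card_inter_le_one_of_isLinear hl),
    hc _ (card_eq_of_isUniform hu') (card_inter_le_one_of_isLinear hl')]
  have hdR : ∑ v, (H.degree v : ℝ) ^ t = ∑ v, (H'.degree v : ℝ) ^ t := by exact_mod_cast hd
  simp only [mul_pow, ← mul_sum, hdR]

theorem moment_congr_of_lt_card_add_two (hk : 3 ≤ k) (hu : H.IsUniform k) (hu' : H'.IsUniform k)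
    (hl : H.IsLinear) (hl' : H'.IsLinear) (hm : H.edgeSet.ncard = H'.edgeSet.ncard)
    (hd : ∀ t, ∑ v, H.degree v ^ t = ∑ v, H'.degree v ^ t) {t : ℕ} (ht : t < k + 2) :
    H.moment k α t = H'.moment k α t := by
  have hdR : ∀ t, ∑ v, (H.degree v : ℝ) ^ t = ∑ v, (H'.degree v : ℝ) ^ t := fun t => by
    exact_mod_cast hd t
  rcases lt_trichotomy t k with htk | rfl | htk
  · exact moment_congr_of_lt_card hk hu hu' hl hl' htk (hd t)
  · obtain ⟨c, κ, hc⟩ := exists_familyTrace_card_eq V hk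
    rw [moment_eq_familyTrace hu, moment_eq_familyTrace hu',
      hc _ (card_eq_of_isUniform hu) (card_inter_le_one_of_isLinear hl),
      hc _ (card_eq_of_isUniform hu') (card_inter_le_one_of_isLinear hl'),
      card_edgeFamily, card_edgeFamily, hm]
    simp only [mul_pow, ← mul_sum, hdR]
  · obtain rfl : t = k + 1 := by omega
    obtain ⟨c, κ, hc⟩ := exists_familyTrace_card_add_one_eq V hk
    rw [moment_eq_familyTrace hu, moment_eq_familyTrace hu',
      hc _ (card_eq_of_isUniform hu) (card_inter_le_one_of_isLinear hl),
      hc _ (card_eq_of_isUniform hu') (card_inter_le_one_of_isLinear hl'),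
      sum_edgeFamily_sum_mul_degree, sum_edgeFamily_sum_mul_degree]
    simp only [mul_pow, ← mul_sum, hdR]

theorem natCast_sub_one_pow_pos (hk : 3 ≤ k) (n : ℕ) : (0 : ℝ) < ((k : ℝ) - 1) ^ n := by
  have : (3 : ℝ) ≤ k := by exact_mod_cast hk
  exact pow_pos (by linarith) _

theorem SLT_of_sum_degree_sq_lt (hk : 3 ≤ k) (hu : H.IsUniform k) (hu' : H'.IsUniform k)
    (hl : H.IsLinear) (hl' : H'.IsLinear) (hm : H.edgeSet.ncard = H'.edgeSet.ncard)
    (hV : 2 < Fintype.card V) (hα : α ≠ 0)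
    (h : ∑ v, H.degree v ^ 2 < ∑ v, H'.degree v ^ 2) : SLT k α H H' := by
  refine ⟨rfl, 2, by omega, ?_, fun t ht => ?_, ?_⟩
  · exact hV.trans_le (Nat.le_mul_of_pos_right _ (pow_pos (by omega) _))
  · refine moment_congr_of_lt_card hk hu hu' hl hl' (by omega) ?_
    interval_cases t
    · simp
    · simp [sum_degree hu, sum_degree hu', hm]
  · obtain ⟨c, hc, hf⟩ := exists_familyTrace_eq_of_lt V hk two_ne_zero (by omega)
    rw [moment_eq_familyTrace hu, moment_eq_familyTrace hu',
      hf _ (card_eq_of_isUniform hu) (card_inter_le_one_of_isLinear hl),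
      hf _ (card_eq_of_isUniform hu') (card_inter_le_one_of_isLinear hl')]
    simp only [mul_pow, ← mul_sum]
    have hlt : (∑ v, (H.degree v : ℝ) ^ 2) < ∑ v, (H'.degree v : ℝ) ^ 2 := by exact_mod_cast h
    have hpos := natCast_sub_one_pow_pos hk (Fintype.card V - 1)
    gcongr

theorem SLT_of_sum_edge_sq_lt (hk : 3 ≤ k) (hu : H.IsUniform k) (hu' : H'.IsUniform k)
    (hl : H.IsLinear) (hl' : H'.IsLinear) (hm : H.edgeSet.ncard = H'.edgeSet.ncard)
    (hV : k + 2 < Fintype.card V) (hα : α ≠ 0) (hα₁ : 0 < (1 - α) ^ k)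
    (hd : ∀ t, ∑ v, H.degree v ^ t = ∑ v, H'.degree v ^ t)
    (h : ∑ e ∈ edgeFamily H, (∑ v ∈ e, H.degree v) ^ 2 <
      ∑ e ∈ edgeFamily H', (∑ v ∈ e, H'.degree v) ^ 2) : SLT k α H H' := by
  refine ⟨rfl, k + 2, by omega, ?_, fun t ht => ?_, ?_⟩
  · exact hV.trans_le (Nat.le_mul_of_pos_right _ (pow_pos (by omega) _))
  · exact moment_congr_of_lt_card_add_two hk hu hu' hl hl' hm hd ht
  · obtain ⟨c, κ, κ', hκ', hf⟩ := exists_familyTrace_card_add_two_eq V hk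
    have hdR : ∀ t, ∑ v, (H.degree v : ℝ) ^ t = ∑ v, (H'.degree v : ℝ) ^ t := fun t => by
      exact_mod_cast hd t
    rw [moment_eq_familyTrace hu, moment_eq_familyTrace hu',
      hf _ (card_eq_of_isUniform hu) (card_inter_le_one_of_isLinear hl),
      hf _ (card_eq_of_isUniform hu') (card_inter_le_one_of_isLinear hl'),
      sum_edgeFamily_sum_erase_mul_degree, sum_edgeFamily_sum_erase_mul_degree,
      sum_edgeFamily_sum_mul_degree_sq, sum_edgeFamily_sum_mul_degree_sq]
    simp only [mul_pow, ← mul_sum, hdR]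
    have hpos := natCast_sub_one_pow_pos hk (Fintype.card V - 1)
    gcongr

end Comparison

end UnicyclicHypergraph

/-! ### The incidence graph of a unicyclic hypergraph -/

namespace UnicyclicHypergraph

open Hypergraph

section SimpleGraph

variable {W : Type*} {G : SimpleGraph W}

theorem card_edgeSet_deleteEdges_singleton_add_one [Finite W] {s : Sym2 W} (hs : s ∈ G.edgeSet) :
    Nat.card (G.deleteEdges {s}).edgeSet + 1 = Nat.card G.edgeSet := by
  rw [Nat.card_coe_set_eq, Nat.card_coe_set_eq, SimpleGraph.edgeSet_deleteEdges,
    Set.ncard_sdiff_singleton_add_one hs (Set.toFinite _)]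

open Fin.NatCast Fin.CommRing in
theorem reachable_of_forall_ne {l : ℕ} {x : Fin (l + 1) → W} (i : Fin (l + 1))
    (h : ∀ j ≠ i, G.Reachable (x j) (x (j + 1))) : G.Reachable (x (i + 1)) (x i) := by
  have hreach : ∀ n : ℕ, n ≤ l → G.Reachable (x (i + 1)) (x (i + 1 + (n : Fin (l + 1)))) := by
    intro n hn
    induction n with
    | zero => simp
    | succ n ih =>
      have hne : i + 1 + (n : Fin (l + 1)) ≠ i := by
        intro heq
        rw [add_assoc, add_eq_left, add_comm (1 : Fin (l + 1)), ← Nat.cast_succ] at heq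
        have hval := congrArg Fin.val heq
        rw [Fin.val_natCast, Nat.mod_eq_of_lt (by omega)] at hval
        simp at hval
      have hstep := (ih (by omega)).trans (h _ hne)
      rwa [add_assoc (i + 1), ← Nat.cast_succ] at hstep
  have hlast : i + 1 + (l : Fin (l + 1)) = i := by
    rw [add_assoc, add_eq_left, add_comm (1 : Fin (l + 1)), ← Nat.cast_succ]
    exact Fin.natCast_self (l + 1)
  simpa only [hlast] using hreach l le_rfl

end SimpleGraph

variable {V : Type*} {H : Hypergraph V}

/-- The bipartite graph of the incidences between the vertices and the edges. -/
def incGraph (H : Hypergraph V) : SimpleGraph (V ⊕ H.edgeSet) where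
  Adj
    | .inl v, .inr e => v ∈ e.1
    | .inr e, .inl v => v ∈ e.1
    | _, _ => False
  symm := ⟨by rintro (v | e) (w | f) h <;> exact h⟩
  loopless := ⟨by rintro (v | e) h <;> exact h⟩

/-- The edge of the incidence graph that belongs to an incidence. -/
def incEdge (H : Hypergraph V) (w : V) (f : H.edgeSet) : Sym2 (V ⊕ H.edgeSet) :=
  s(.inl w, .inr f)

theorem incEdge_inj {w w' : V} {f f' : H.edgeSet} :
    incEdge H w f = incEdge H w' f' ↔ w = w' ∧ f = f' := by
  simp [incEdge]

theorem bijective_sigma_edgeSet_incGraph (H : Hypergraph V) :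
    Function.Bijective fun p : (Σ e : H.edgeSet, e.1) =>
      (⟨incEdge H p.2 p.1, p.2.2⟩ : (incGraph H).edgeSet) := by
  constructor
  · rintro ⟨e, v⟩ ⟨e', v'⟩ h
    obtain ⟨hv, rfl⟩ := incEdge_inj.1 (congrArg Subtype.val h)
    obtain rfl := Subtype.ext hv
    rfl
  · rintro ⟨s, hs⟩
    induction s using Sym2.ind with
    | _ x y =>
      rcases x with v | e <;> rcases y with w | f
      · exact hs.elim
      · exact ⟨⟨f, v, hs⟩, rfl⟩
      · exact ⟨⟨e, w, hs⟩, Subtype.ext Sym2.eq_swap⟩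
      · exact hs.elim

theorem card_edgeSet_incGraph_of_isUniform [Finite V] {k : ℕ} (hu : H.IsUniform k) :
    Nat.card (incGraph H).edgeSet = k * H.edgeSet.ncard := by
  have := Fintype.ofFinite H.edgeSet
  rw [← Nat.card_congr (Equiv.ofBijective _ (bijective_sigma_edgeSet_incGraph H)), Nat.card_sigma,
    Finset.sum_congr rfl fun e _ => (Nat.card_coe_set_eq e.1).trans (hu e.1 e.2),
    Finset.sum_const, Finset.card_univ, smul_eq_mul, mul_comm, ← Nat.card_eq_fintype_card,
    Nat.card_coe_set_eq]

theorem exists_mem_edgeSet_of_isConnected [Nontrivial V] (h : H.IsConnected)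
    (hV : H.vertexSet = Set.univ) (v : V) : ∃ e ∈ H.edgeSet, v ∈ e := by
  obtain ⟨w, hw⟩ := exists_ne v
  rcases (h.2 v (by simp [hV]) w (by simp [hV])).cases_head with heq | ⟨c, ⟨e, he, hv, _⟩, _⟩
  · exact absurd heq.symm hw
  · exact ⟨e, he, hv⟩

theorem connected_incGraph (h : H.IsConnected) (hV : H.vertexSet = Set.univ)
    (hne : ∀ e ∈ H.edgeSet, e.Nonempty) : (incGraph H).Connected := by
  obtain ⟨v₀, hv₀⟩ := h.1
  have hadj : ∀ {v : V} {e : H.edgeSet}, v ∈ e.1 → (incGraph H).Adj (.inl v) (.inr e) := id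
  have hv : ∀ v, (incGraph H).Reachable (.inl v₀) (.inl v) := by
    intro v
    induction h.2 v₀ hv₀ v (by simp [hV]) with
    | refl => exact .rfl
    | tail _ hstep ih =>
      obtain ⟨e, he, hu, hw⟩ := hstep
      have hu' := hadj (e := ⟨e, he⟩) hu
      have hw' := hadj (e := ⟨e, he⟩) hw
      exact ih.trans (hu'.reachable.trans hw'.symm.reachable)
  refine (SimpleGraph.connected_iff_exists_forall_reachable _).2 ⟨.inl v₀, ?_⟩
  rintro (v | e)
  · exact hv v
  · obtain ⟨v, hve⟩ := hne e.1 e.2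
    exact (hv v).trans (hadj hve).reachable

/-- The edges of the incidence graph that a cycle runs through lie in the subgraph `G`. -/
def CycleIn {l : ℕ} (v : Fin l → V) (e : Fin l → Set V) (G : SimpleGraph (V ⊕ H.edgeSet)) : Prop :=
  ∀ w, ∀ f : H.edgeSet, (w, f.1) ∈ cycleIncidences v e → incEdge H w f ∈ G.edgeSet

section Cycle

variable {l : ℕ} {v : Fin l → V} {e : Fin l → Set V} {G : SimpleGraph (V ⊕ H.edgeSet)}

theorem apply_finRotate_ne_of_isCycle (h : H.IsCycle v e) (i : Fin l) :
    v (finRotate l i) ≠ v i := by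
  intro heq
  have hfix := h.vertex_injective heq
  obtain ⟨l, rfl⟩ : ∃ l', l = l' + 2 := ⟨l - 2, by have := h.two_le; omega⟩
  rw [finRotate_apply, add_eq_left] at hfix
  exact one_ne_zero hfix

theorem mem_edgeSet_and_mem_of_mem_cycleIncidences (h : H.IsCycle v e) {w : V} {f : Set V}
    (hw : (w, f) ∈ cycleIncidences v e) : f ∈ H.edgeSet ∧ w ∈ f := by
  obtain ⟨i, hi | hi⟩ := hw <;> obtain ⟨rfl, rfl⟩ := Prod.mk.inj hi
  exacts [⟨h.edge_mem i, h.left_mem i⟩, ⟨h.edge_mem i, h.right_mem i⟩]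

theorem exists_mem_cycleIncidences (h : H.IsCycle v e) :
    ∃ w, ∃ f : H.edgeSet, (w, f.1) ∈ cycleIncidences v e := by
  have := h.two_le
  let i : Fin l := ⟨0, by omega⟩
  exact ⟨v i, ⟨e i, h.edge_mem i⟩, i, .inl rfl⟩

theorem cycleIn_incGraph (h : H.IsCycle v e) : CycleIn v e (incGraph H) := fun _ _ hw =>
  (mem_edgeSet_and_mem_of_mem_cycleIncidences h hw).2

theorem cycleIn_deleteEdges (hG : CycleIn v e G) {w : V} {f : H.edgeSet}
    (hw : (w, f.1) ∉ cycleIncidences v e) : CycleIn v e (G.deleteEdges {incEdge H w f}) := by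
  intro u f' hu
  rw [SimpleGraph.edgeSet_deleteEdges]
  refine ⟨hG u f' hu, fun heq => hw ?_⟩
  obtain ⟨rfl, rfl⟩ := incEdge_inj.1 heq
  exact hu

theorem not_cycleIn_deleteEdges {w : V} {f : H.edgeSet} (hw : (w, f.1) ∈ cycleIncidences v e) :
    ¬ CycleIn v e (G.deleteEdges {incEdge H w f}) := fun h => by
  have hmem := h w f hw
  rw [SimpleGraph.edgeSet_deleteEdges] at hmem
  exact hmem.2 rfl

theorem not_isBridge_of_isCycle (h : H.IsCycle v e) (hG : CycleIn v e G) {w : V} {f : H.edgeSet}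
    (hw : (w, f.1) ∈ cycleIncidences v e) : ¬ G.IsBridge (incEdge H w f) := by
  obtain ⟨l, rfl⟩ : ∃ l', l = l' + 1 := ⟨l - 1, by have := h.two_le; omega⟩
  obtain ⟨i, hi⟩ := hw
  simp only [finRotate_apply] at hi
  obtain rfl : f = ⟨e i, h.edge_mem i⟩ := by
    rcases hi with hi | hi <;> exact Subtype.ext (Prod.mk.inj hi).2
  rw [incEdge, SimpleGraph.isBridge_iff, not_not]
  set G' := G.deleteEdges {incEdge H w ⟨e i, h.edge_mem i⟩}
  have hleft : ∀ j, ¬(v j = w ∧ e j = e i) → G'.Adj (.inl (v j)) (.inr ⟨e j, h.edge_mem j⟩) :=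
    fun j hj => SimpleGraph.deleteEdges_adj.2 ⟨hG _ ⟨e j, h.edge_mem j⟩ ⟨j, .inl rfl⟩,
      fun heq => hj ((incEdge_inj.1 heq).imp_right (congrArg Subtype.val))⟩
  have hright : ∀ j, ¬(v (j + 1) = w ∧ e j = e i) →
      G'.Adj (.inl (v (j + 1))) (.inr ⟨e j, h.edge_mem j⟩) :=
    fun j hj => SimpleGraph.deleteEdges_adj.2
      ⟨hG _ ⟨e j, h.edge_mem j⟩ ⟨j, .inr (by rw [finRotate_apply])⟩,
        fun heq => hj ((incEdge_inj.1 heq).imp_right (congrArg Subtype.val))⟩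
  have haround : G'.Reachable (.inl (v (i + 1))) (.inl (v i)) := by
    refine reachable_of_forall_ne (x := fun j => Sum.inl (v j)) i fun j hj => ?_
    have hne : e j ≠ e i := fun heq => hj (h.edge_injective heq)
    exact (hleft j fun hh => hne hh.2).reachable.trans (hright j fun hh => hne hh.2).symm.reachable
  have hrot := apply_finRotate_ne_of_isCycle h i
  rw [finRotate_apply] at hrot
  rcases hi with hi | hi <;> obtain ⟨rfl, -⟩ := Prod.mk.inj hi
  · exact haround.symm.trans (hright i fun hh => hrot hh.1).reachable
  · exact haround.trans (hleft i fun hh => hrot hh.1.symm).reachable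

theorem connected_deleteEdges_of_isCycle (hc : G.Connected) (h : H.IsCycle v e)
    (hG : CycleIn v e G) {w : V} {f : H.edgeSet} (hw : (w, f.1) ∈ cycleIncidences v e) :
    (G.deleteEdges {incEdge H w f}).Connected :=
  hc.connected_delete_edge_of_not_isBridge (not_isBridge_of_isCycle h hG hw)

theorem cycleIncidences_subset [Finite V] (hc : (incGraph H).Connected)
    (hcard : Nat.card (incGraph H).edgeSet = Nat.card (V ⊕ H.edgeSet))
    {l' : ℕ} {v' : Fin l' → V} {e' : Fin l' → Set V}
    (h : H.IsCycle v e) (h' : H.IsCycle v' e') :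
    cycleIncidences v' e' ⊆ cycleIncidences v e := by
  rintro ⟨w, f⟩ hw
  by_contra hnot
  lift f to H.edgeSet using (mem_edgeSet_and_mem_of_mem_cycleIncidences h' hw).1
  have hconn := connected_deleteEdges_of_isCycle hc h' (cycleIn_incGraph h') hw
  have hdel := card_edgeSet_deleteEdges_singleton_add_one (cycleIn_incGraph h' w f hw)
  have hG := cycleIn_deleteEdges (cycleIn_incGraph h) hnot
  obtain ⟨u, f', hu⟩ := exists_mem_cycleIncidences h
  have hle :=
    (connected_deleteEdges_of_isCycle hconn h hG hu).card_vert_le_card_edgeSet_add_one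
  have hdel' := card_edgeSet_deleteEdges_singleton_add_one (hG u f' hu)
  omega

end Cycle

section Walk

variable {G : SimpleGraph (V ⊕ H.edgeSet)} {u : V}

theorem isLeft_getVert_iff_even (hG : G ≤ incGraph H) {y : V ⊕ H.edgeSet}
    (p : G.Walk (.inl u) y) {n : ℕ} (hn : n ≤ p.length) : (p.getVert n).isLeft ↔ Even n := by
  induction n with
  | zero => simp
  | succ n ih =>
    have hadj := hG (p.adj_getVert_succ (i := n) (by omega))
    rw [Nat.even_add_one, ← ih (by omega)]
    generalize p.getVert n = x at *
    generalize p.getVert (n + 1) = y at *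
    rcases x with x | x <;> rcases y with y | y <;> first | exact hadj.elim | simp

theorem exists_getVert_eq (hG : G ≤ incGraph H) (p : G.Walk (.inl u) (.inl u)) :
    ∃ (l : ℕ) (v : Fin l → V) (e : Fin l → H.edgeSet), p.length = 2 * l ∧
      (∀ i : Fin l, p.getVert (2 * i) = .inl (v i)) ∧
      (∀ i : Fin l, p.getVert (2 * i + 1) = .inr (e i)) ∧
      ∀ i : Fin l, p.getVert (2 * i + 2) = .inl (v (finRotate l i)) := by
  have heven : Even p.length := by
    rw [← isLeft_getVert_iff_even hG p le_rfl]
    simp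
  obtain ⟨l, hl⟩ := even_iff_two_dvd.1 heven
  have hleft : ∀ i : Fin l, ∃ w, p.getVert (2 * i) = .inl w := fun i =>
    Sum.isLeft_iff.1 ((isLeft_getVert_iff_even hG p (n := 2 * i) (by omega)).2 (by simp))
  have hright : ∀ i : Fin l, ∃ f, p.getVert (2 * i + 1) = .inr f := fun i => by
    have hodd := (isLeft_getVert_iff_even hG p (n := 2 * i + 1) (by omega)).not.2 (by simp)
    rwa [Bool.not_eq_true, Sum.isLeft_eq_false, Sum.isRight_iff] at hodd
  choose v hv using hleft
  choose e he using hright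
  refine ⟨l, v, e, hl, hv, he, fun i => ?_⟩
  obtain ⟨l, rfl⟩ : ∃ l', l = l' + 1 := ⟨l - 1, by have := i.isLt; omega⟩
  rw [← hv]
  rcases eq_or_ne i (Fin.last l) with rfl | hi
  · rw [finRotate_last, Fin.val_last, Fin.val_zero, mul_zero, SimpleGraph.Walk.getVert_zero,
      show 2 * l + 2 = p.length by omega, SimpleGraph.Walk.getVert_length]
  · rw [coe_finRotate_of_ne_last hi, mul_add]

theorem exists_isCycle_cycleIn (hG : G ≤ incGraph H) {p : G.Walk (.inl u) (.inl u)}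
    (hp : p.IsCycle) :
    ∃ (l : ℕ) (v : Fin l → V) (e : Fin l → Set V), H.IsCycle v e ∧ CycleIn v e G := by
  obtain ⟨l, v, e, hl, hv, he, hrot⟩ := exists_getVert_eq hG p
  have hlen := hp.three_le_length
  have hleft : ∀ i, G.Adj (.inl (v i)) (.inr (e i)) := fun i => by
    rw [← hv, ← he]
    exact p.adj_getVert_succ (by omega)
  have hright : ∀ i, G.Adj (.inl (v (finRotate l i))) (.inr (e i)) := fun i => by
    rw [← hrot, ← he]
    exact (p.adj_getVert_succ (by omega)).symm
  have hinj := hp.getVert_injOn'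
  refine ⟨l, v, fun i => (e i).1, ⟨by omega, fun i j hij => ?_, fun i j hij => ?_,
    fun i => (e i).2, fun i => hG (hleft i), fun i => hG (hright i)⟩, ?_⟩
  · have := hinj (x₁ := 2 * i) (x₂ := 2 * j) (by simp; omega) (by simp; omega)
      (by rw [hv, hv, hij])
    omega
  · have := hinj (x₁ := 2 * i + 1) (x₂ := 2 * j + 1) (by simp; omega) (by simp; omega)
      (by rw [he, he, Subtype.ext hij])
    omega
  · rintro w f ⟨i, hi | hi⟩ <;> obtain ⟨rfl, hf⟩ := Prod.mk.inj hi <;> obtain rfl := Subtype.ext hf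
    exacts [hleft i, hright i]

theorem isAcyclic_of_forall_not_cycleIn (hG : G ≤ incGraph H)
    (h : ∀ (l : ℕ) (v : Fin l → V) (e : Fin l → Set V), H.IsCycle v e → ¬ CycleIn v e G) :
    G.IsAcyclic := by
  classical
  have hleft : ∀ u (p : G.Walk (.inl u) (.inl u)), ¬ p.IsCycle := fun u p hp =>
    let ⟨l, v, e, hcyc, hin⟩ := exists_isCycle_cycleIn hG hp
    h l v e hcyc hin
  rintro (u | f) p hp
  · exact hleft u p hp
  · have hadj := p.adj_snd hp.not_nil
    have hs : p.snd ∈ p.support := p.getVert_mem_support 1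
    generalize p.snd = x at *
    rcases x with u | f'
    · exact hleft u (p.rotate _ hs) (hp.rotate hs)
    · exact (hG hadj).elim

end Walk

theorem card_edgeSet_incGraph_of_isUnicyclic [Finite V] (h : H.IsUnicyclic)
    (hV : H.vertexSet = Set.univ) (hne : ∀ e ∈ H.edgeSet, e.Nonempty) :
    Nat.card (incGraph H).edgeSet = Nat.card (V ⊕ H.edgeSet) := by
  obtain ⟨hconn, C, ⟨l, v, e, hcyc, rfl⟩, huniq⟩ := h
  obtain ⟨w, f, hw⟩ := exists_mem_cycleIncidences hcyc
  have htree : ((incGraph H).deleteEdges {incEdge H w f}).IsTree := by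
    refine ⟨connected_deleteEdges_of_isCycle (connected_incGraph hconn hV hne) hcyc
      (cycleIn_incGraph hcyc) hw, isAcyclic_of_forall_not_cycleIn
        (SimpleGraph.deleteEdges_le _) fun l' v' e' hcyc' => not_cycleIn_deleteEdges ?_⟩
    rwa [huniq _ ⟨l', v', e', hcyc', rfl⟩]
  have hcard := (SimpleGraph.isTree_iff_connected_and_card.1 htree).2
  have hdel := card_edgeSet_deleteEdges_singleton_add_one (cycleIn_incGraph hcyc w f hw)
  omega

end UnicyclicHypergraph

/-! ### Edge enumerations -/

namespace UnicyclicHypergraph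

open Hypergraph Finset

section ImageRange

variable {β : Type*} [DecidableEq β] {a : ℕ → β} {n : ℕ} {s : Finset β}

theorem card_image_range (hinj : ∀ i < n, ∀ j < n, a i = a j → i = j) :
    #((range n).image a) = n := by
  rw [card_image_of_injOn, card_range]
  exact fun i hi j hj hij => hinj i (by simpa using hi) j (by simpa using hj) hij

theorem image_range_subset (hmem : ∀ i < n, a i ∈ s) : (range n).image a ⊆ s :=
  image_subset_iff.2 fun i hi => hmem i (mem_range.1 hi)

theorem image_range_eq (hinj : ∀ i < n, ∀ j < n, a i = a j → i = j) (hmem : ∀ i < n, a i ∈ s)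
    (hs : #s ≤ n) : (range n).image a = s :=
  eq_of_subset_of_card_le (image_range_subset hmem) (hs.trans_eq (card_image_range hinj).symm)

theorem image_range_ssubset (hinj : ∀ i < n, ∀ j < n, a i = a j → i = j)
    (hmem : ∀ i < n, a i ∈ s) (hs : n < #s) : (range n).image a ⊂ s :=
  (image_range_subset hmem).ssubset_of_ne fun h => by
    rw [← h, card_image_range hinj] at hs
    exact lt_irrefl n hs

theorem image_range_succ_update (x : β) :
    (range (n + 1)).image (Function.update a n x) = insert x ((range n).image a) := by
  rw [range_add_one, image_insert, Function.update_self]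
  refine congrArg _ (image_congr fun i hi => Function.update_of_ne ?_ _ _)
  exact (mem_range.1 hi).ne

end ImageRange

/-- The indices of the sets containing `v` among the first `m` terms of a sequence of sets. -/
def edgeIndices {V : Type*} [DecidableEq V] (a : ℕ → Finset V) (m : ℕ) (v : V) : Finset ℕ :=
  {i ∈ range m | v ∈ a i}

theorem mem_edgeIndices {V : Type*} [DecidableEq V] {a : ℕ → Finset V} {m i : ℕ} {v : V} :
    i ∈ edgeIndices a m v ↔ i < m ∧ v ∈ a i := by
  simp [edgeIndices]

variable {V W : Type*} [Fintype V] [Fintype W] {H : Hypergraph V} {H' : Hypergraph W}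
  {k m : ℕ} {a : ℕ → Finset V} {a' : ℕ → Finset W}

/-- The first `m` terms of `a` enumerate the edges of `H` without repetition. -/
structure IsEdgeEnum (H : Hypergraph V) (m : ℕ) (a : ℕ → Finset V) : Prop where
  inj : ∀ i < m, ∀ j < m, a i = a j → i = j
  mem_iff : ∀ e, e ∈ edgeFamily H ↔ ∃ i < m, a i = e

theorem IsEdgeEnum.mem (ha : IsEdgeEnum H m a) {i : ℕ} (hi : i < m) : a i ∈ edgeFamily H :=
  (ha.mem_iff _).2 ⟨i, hi, rfl⟩

theorem IsEdgeEnum.mem_edgeSet_iff (ha : IsEdgeEnum H m a) (e : Set V) :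
    e ∈ H.edgeSet ↔ ∃ i < m, (a i : Set V) = e := by
  classical
  have hmem := ha.mem_iff e.toFinset
  rw [mem_edgeFamily, Set.coe_toFinset] at hmem
  simp only [hmem, ← coe_inj, Set.coe_toFinset]

variable [DecidableEq V] [DecidableEq W]

theorem IsEdgeEnum.card_edgeIndices (ha : IsEdgeEnum H m a) (v : V) :
    #(edgeIndices a m v) = H.degree v := by
  have himg : {e ∈ edgeFamily H | v ∈ e} = (edgeIndices a m v).image a := by
    ext e
    simp only [mem_filter, ha.mem_iff, mem_image, mem_edgeIndices]
    constructor
    · rintro ⟨⟨i, hi, rfl⟩, hv⟩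
      exact ⟨i, ⟨hi, hv⟩, rfl⟩
    · rintro ⟨i, ⟨hi, hv⟩, rfl⟩
      exact ⟨⟨i, hi, rfl⟩, hv⟩
  rw [← card_filter_mem_edgeFamily, himg, card_image_of_injOn]
  intro i hi j hj hij
  rw [mem_coe, mem_edgeIndices] at hi hj
  exact ha.inj i hi.1 j hj.1 hij

theorem card_filter_edgeIndices_eq_zero {S : Finset ℕ} (hS : ∀ v, edgeIndices a m v ≠ S) :
    #{v | edgeIndices a m v = S} = 0 := by
  simp [hS]

theorem IsEdgeEnum.filter_edgeIndices_eq_pair (ha : IsEdgeEnum H m a)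
    (hd : ∀ v, H.degree v ≤ 2) {i j : ℕ} (hi : i < m) (hj : j < m) (hij : i ≠ j) :
    ({v | edgeIndices a m v = {i, j}} : Finset V) = a i ∩ a j := by
  ext v
  rw [mem_filter_univ, mem_inter]
  constructor
  · intro h
    exact ⟨(mem_edgeIndices.1 (h ▸ by simp : i ∈ edgeIndices a m v)).2,
      (mem_edgeIndices.1 (h ▸ by simp : j ∈ edgeIndices a m v)).2⟩
  · rintro ⟨hvi, hvj⟩
    refine (eq_of_subset_of_card_le ?_ ?_).symm
    · exact insert_subset (mem_edgeIndices.2 ⟨hi, hvi⟩)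
        (singleton_subset_iff.2 (mem_edgeIndices.2 ⟨hj, hvj⟩))
    · rw [ha.card_edgeIndices, card_pair hij]
      exact hd v

theorem IsEdgeEnum.card_filter_edgeIndices_eq_pair (ha : IsEdgeEnum H m a) (hl : H.IsLinear)
    (hd : ∀ v, H.degree v ≤ 2) {i j : ℕ} (hi : i < m) (hj : j < m) (hij : i ≠ j) :
    #{v | edgeIndices a m v = {i, j}} = if (a i ∩ a j).Nonempty then 1 else 0 := by
  rw [ha.filter_edgeIndices_eq_pair hd hi hj hij]
  have hle := card_inter_le_one_of_isLinear hl (a i) (ha.mem hi) (a j) (ha.mem hj)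
    fun h => hij (ha.inj i hi j hj h)
  split_ifs with h
  · exact le_antisymm hle (card_pos.2 h)
  · rw [card_eq_zero, ← not_nonempty_iff_eq_empty]
    exact h

theorem IsEdgeEnum.sum_card_filter_edgeIndices (ha : IsEdgeEnum H m a) (hu : H.IsUniform k)
    {i : ℕ} (hi : i < m) :
    ∑ S ∈ (range m).powerset with i ∈ S, #{v | edgeIndices a m v = S} = k := by
  rw [← card_eq_of_isUniform hu (a i) (ha.mem hi),
    card_eq_sum_card_fiberwise (f := edgeIndices a m)
      (t := {S ∈ (range m).powerset | i ∈ S}) (s := a i)]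
  · refine sum_congr rfl fun S hS => congrArg card ?_
    ext v
    simp only [mem_filter, mem_univ, true_and, iff_and_self]
    rintro rfl
    exact (mem_edgeIndices.1 (mem_filter.1 hS).2).2
  · intro v hv
    simp only [coe_filter, mem_powerset, Set.mem_ofPred_eq, mem_edgeIndices]
    exact ⟨filter_subset _ _, hi, hv⟩

theorem IsEdgeEnum.card_filter_edgeIndices_eq_of_card_ne_one
    (ha : IsEdgeEnum H m a) (ha' : IsEdgeEnum H' m a') (hl : H.IsLinear) (hl' : H'.IsLinear)
    (hd : ∀ v, 1 ≤ H.degree v ∧ H.degree v ≤ 2) (hd' : ∀ v, 1 ≤ H'.degree v ∧ H'.degree v ≤ 2)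
    (hmeet : ∀ i < m, ∀ j < m, i ≠ j → ((a i ∩ a j).Nonempty ↔ (a' i ∩ a' j).Nonempty))
    {S : Finset ℕ} (hS : S ⊆ range m) (hS₁ : #S ≠ 1) :
    #{v | edgeIndices a m v = S} = #{v | edgeIndices a' m v = S} := by
  by_cases hS₂ : #S = 2
  · obtain ⟨i, j, hij, rfl⟩ := card_eq_two.1 hS₂
    have hi : i < m := mem_range.1 (hS (by simp))
    have hj : j < m := mem_range.1 (hS (by simp))
    rw [ha.card_filter_edgeIndices_eq_pair hl (fun v => (hd v).2) hi hj hij,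
      ha'.card_filter_edgeIndices_eq_pair hl' (fun v => (hd' v).2) hi hj hij]
    simp only [hmeet i hi j hj hij]
  · rw [card_filter_edgeIndices_eq_zero, card_filter_edgeIndices_eq_zero]
    · rintro v rfl
      have := hd' v
      rw [ha'.card_edgeIndices] at hS₁ hS₂
      omega
    · rintro v rfl
      have := hd v
      rw [ha.card_edgeIndices] at hS₁ hS₂
      omega

theorem IsEdgeEnum.card_filter_edgeIndices_eq
    (ha : IsEdgeEnum H m a) (ha' : IsEdgeEnum H' m a') (hu : H.IsUniform k)
    (hu' : H'.IsUniform k) (hl : H.IsLinear) (hl' : H'.IsLinear)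
    (hd : ∀ v, 1 ≤ H.degree v ∧ H.degree v ≤ 2) (hd' : ∀ v, 1 ≤ H'.degree v ∧ H'.degree v ≤ 2)
    (hmeet : ∀ i < m, ∀ j < m, i ≠ j → ((a i ∩ a j).Nonempty ↔ (a' i ∩ a' j).Nonempty))
    (S : Finset ℕ) : #{v | edgeIndices a m v = S} = #{v | edgeIndices a' m v = S} := by
  have hne := fun {S} => ha.card_filter_edgeIndices_eq_of_card_ne_one ha' hl hl' hd hd' hmeet
    (S := S)
  by_cases hS : S ⊆ range m
  swap
  · rw [card_filter_edgeIndices_eq_zero, card_filter_edgeIndices_eq_zero] <;>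
      exact fun v h => hS (h ▸ filter_subset _ _)
  by_cases hS₁ : #S = 1
  swap
  · exact hne hS hS₁
  -- The fibre of a singleton `{i}` consists of what the other fibres leave of the edge `i`.
  obtain ⟨i, rfl⟩ := card_eq_one.1 hS₁
  have hi : i < m := mem_range.1 (hS (by simp))
  have hmem : {i} ∈ ({S ∈ (range m).powerset | i ∈ S} : Finset (Finset ℕ)) := by simp [hi]
  have hrest : ∀ S ∈ ({S ∈ (range m).powerset | i ∈ S} : Finset (Finset ℕ)).erase {i},
      #{v | edgeIndices a m v = S} = #{v | edgeIndices a' m v = S} := by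
    intro S hS
    rw [mem_erase, mem_filter, mem_powerset] at hS
    refine hne hS.2.1 fun hS₁ => ?_
    obtain ⟨j, rfl⟩ := card_eq_one.1 hS₁
    exact hS.1 (congrArg _ (mem_singleton.1 hS.2.2).symm)
  have hsum := ha.sum_card_filter_edgeIndices hu hi
  have hsum' := ha'.sum_card_filter_edgeIndices hu' hi
  rw [← add_sum_erase _ _ hmem] at hsum hsum'
  rw [sum_congr rfl hrest] at hsum
  omega

theorem IsEdgeEnum.iso_of_edgeIndices (ha : IsEdgeEnum H m a) (ha' : IsEdgeEnum H' m a')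
    (hV : H.vertexSet = Set.univ) (hV' : H'.vertexSet = Set.univ) (f : V ≃ W)
    (hf : ∀ v, edgeIndices a' m (f v) = edgeIndices a m v) : H.Iso H' := by
  have himage : ∀ i < m, f '' (a i : Set V) = (a' i : Set W) := by
    intro i hi
    ext w
    obtain ⟨v, rfl⟩ := f.surjective w
    have hmem : f v ∈ a' i ↔ v ∈ a i := by
      simpa [mem_edgeIndices, hi] using Finset.ext_iff.1 (hf v) i
    simp [hmem]
  refine ⟨f, Hypergraph.ext ?_ ?_⟩
  · simp [hV, hV']
  · ext e
    rw [mem_edgeSet_image, ha'.mem_edgeSet_iff]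
    simp only [ha.mem_edgeSet_iff]
    constructor
    · rintro ⟨_, ⟨i, hi, rfl⟩, rfl⟩
      exact ⟨i, hi, (himage i hi).symm⟩
    · rintro ⟨i, hi, rfl⟩
      exact ⟨_, ⟨i, hi, rfl⟩, himage i hi⟩

/-- The vertices lying in exactly a given set of edges are interchangeable, so it is enough that
they are equally many in both hypergraphs. -/
theorem IsEdgeEnum.iso (ha : IsEdgeEnum H m a) (ha' : IsEdgeEnum H' m a')
    (hV : H.vertexSet = Set.univ) (hV' : H'.vertexSet = Set.univ) (hu : H.IsUniform k)
    (hu' : H'.IsUniform k) (hl : H.IsLinear) (hl' : H'.IsLinear)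
    (hd : ∀ v, 1 ≤ H.degree v ∧ H.degree v ≤ 2) (hd' : ∀ v, 1 ≤ H'.degree v ∧ H'.degree v ≤ 2)
    (hmeet : ∀ i < m, ∀ j < m, i ≠ j → ((a i ∩ a j).Nonempty ↔ (a' i ∩ a' j).Nonempty)) :
    H.Iso H' := by
  have hfiber : ∀ S,
      Nonempty ({v // edgeIndices a m v = S} ≃ {v // edgeIndices a' m v = S}) := by
    intro S
    rw [← Fintype.card_eq, Fintype.card_subtype, Fintype.card_subtype]
    exact ha.card_filter_edgeIndices_eq ha' hu hu' hl hl' hd hd' hmeet S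
  exact ha.iso_of_edgeIndices ha' hV hV' (Equiv.ofFiberEquiv fun S => (hfiber S).some)
    (Equiv.ofFiberEquiv_map _)

end UnicyclicHypergraph

/-! ### Cycles with a pendant path -/

namespace UnicyclicHypergraph

open Hypergraph Finset

theorem eq_pair_of_card_le_two {β : Type*} [DecidableEq β] {s : Finset β} (hs : #s ≤ 2) {x y : β}
    (hx : x ∈ s) (hy : y ∈ s) (hxy : x ≠ y) : s = {x, y} :=
  (eq_of_subset_of_card_le (insert_subset hx (singleton_subset_iff.2 hy))
    (hs.trans_eq (card_pair hxy).symm)).symm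

theorem eq_triple_of_card_le_three {β : Type*} [DecidableEq β] {s : Finset β} (hs : #s ≤ 3)
    {x y z : β} (hx : x ∈ s) (hy : y ∈ s) (hz : z ∈ s) (hxy : x ≠ y) (hxz : x ≠ z)
    (hyz : y ≠ z) : s = {x, y, z} :=
  (eq_of_subset_of_card_le (by simp [insert_subset_iff, hx, hy, hz])
    (hs.trans_eq (card_eq_three.2 ⟨x, y, z, hxy, hxz, hyz, rfl⟩).symm)).symm

variable {V : Type*} [Fintype V] [DecidableEq V] {H : Hypergraph V} {k g s m : ℕ}
  {a : ℕ → Finset V} {e f : Finset V}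

/-- The edges of `H` different from `e` that meet `e`. -/
noncomputable def edgeNeighbors (H : Hypergraph V) (e : Finset V) : Finset (Finset V) :=
  {f ∈ edgeFamily H | f ≠ e ∧ (e ∩ f).Nonempty}

theorem mem_edgeNeighbors :
    f ∈ edgeNeighbors H e ↔ f ∈ edgeFamily H ∧ f ≠ e ∧ (e ∩ f).Nonempty := by
  simp [edgeNeighbors]

theorem sum_degree_edge (hu : H.IsUniform k) (hl : H.IsLinear) (he : e ∈ edgeFamily H) :
    ∑ v ∈ e, H.degree v = k + #(edgeNeighbors H e) := by
  have hcount : ∑ v ∈ e, H.degree v = ∑ f ∈ edgeFamily H, #(e ∩ f) := by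
    simp_rw [← card_filter_mem_edgeFamily, card_filter]
    rw [sum_comm]
    exact sum_congr rfl fun f _ => by rw [← card_filter, filter_mem_eq_inter]
  rw [hcount, ← add_sum_erase _ _ he, inter_self, card_eq_of_isUniform hu e he, edgeNeighbors,
    card_filter, ← sum_erase (a := e) (edgeFamily H) (by simp)]
  refine congrArg _ (sum_congr rfl fun f hf => ?_)
  have hne := ne_of_mem_erase hf
  split_ifs with hmeet
  · exact le_antisymm (card_inter_le_one_of_isLinear hl e he f (mem_of_mem_erase hf) hne.symm)
      (card_pos.2 hmeet.2)
  · rw [card_eq_zero, ← not_nonempty_iff_eq_empty]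
    exact fun h => hmeet ⟨hne, h⟩

theorem exists_inter_nonempty_of_isConnected (h : H.IsConnected)
    (hne : ∀ e ∈ edgeFamily H, e.Nonempty) {S : Finset (Finset V)} (hS : S ⊂ edgeFamily H)
    (hS₀ : S.Nonempty) : ∃ e ∈ S, ∃ f ∈ edgeFamily H, f ∉ S ∧ (e ∩ f).Nonempty := by
  classical
  by_contra! hcon
  have hdisj : ∀ e ∈ S, ∀ f ∈ edgeFamily H, f ∉ S → ∀ x ∈ e, x ∉ f :=
    fun e he f hf hfS x hxe hxf => notMem_empty x (hcon e he f hf hfS ▸ mem_inter.2 ⟨hxe, hxf⟩)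
  obtain ⟨e₀, he₀⟩ := hS₀
  obtain ⟨f₀, hf₀, hf₀S⟩ := exists_of_ssubset hS
  obtain ⟨u, hu⟩ := hne e₀ (hS.1 he₀)
  obtain ⟨w, hw⟩ := hne f₀ hf₀
  have hmem : ∀ e ∈ edgeFamily H, ∀ v ∈ e, v ∈ H.vertexSet := fun e he v hv =>
    mem_vertexSet_of_mem_edgeSet (mem_edgeFamily.1 he) hv
  have hcovered : ∀ x, Relation.ReflTransGen H.Adj u x → ∃ e ∈ S, x ∈ e := by
    intro x hx
    induction hx with
    | refl => exact ⟨e₀, he₀, hu⟩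
    | @tail x y _ hadj ih =>
      obtain ⟨e, he, hxe⟩ := ih
      obtain ⟨f, hf, hxf, hyf⟩ := hadj
      refine ⟨f.toFinset, ?_, by simpa using hyf⟩
      by_contra hfS
      exact hdisj e he f.toFinset (by simpa [mem_edgeFamily] using hf) hfS x hxe
        (by simpa using hxf)
  obtain ⟨e, he, hwe⟩ := hcovered w (h.2 u (hmem _ (hS.1 he₀) _ hu) w (hmem _ hf₀ _ hw))
  exact hdisj e he f₀ hf₀ hf₀S w hwe hw

/-- A closed walk of consecutively meeting edges of `H`, written as a sequence of period `g`, whose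
edges are distinct within a period. -/
structure IsEdgeCycle (H : Hypergraph V) (g : ℕ) (a : ℕ → Finset V) : Prop where
  eq_iff : ∀ i j, a i = a j ↔ i ≡ j [MOD g]
  mem : ∀ i, a i ∈ edgeFamily H
  meet : ∀ i, (a i ∩ a (i + 1)).Nonempty

namespace IsEdgeCycle

theorem shift (h : IsEdgeCycle H g a) (n : ℕ) : IsEdgeCycle H g fun i => a (i + n) where
  eq_iff i j := (h.eq_iff _ _).trans
    ⟨fun hij => Nat.ModEq.add_right_cancel' _ hij, fun hij => hij.add_right _⟩
  mem _ := h.mem _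
  meet i := by simpa only [add_right_comm] using h.meet (i + n)

theorem inj (h : IsEdgeCycle H g a) : ∀ i < g, ∀ j < g, a i = a j → i = j :=
  fun i hi j hj hij => Nat.ModEq.eq_of_lt_of_lt ((h.eq_iff i j).1 hij) hi hj

theorem apply_add_period (h : IsEdgeCycle H g a) (i : ℕ) : a (i + g) = a i :=
  (h.eq_iff _ _).2 (by simp [Nat.ModEq])

theorem apply_add_ne (h : IsEdgeCycle H g a) (i : ℕ) {n : ℕ} (hn : n ≠ 0) (hng : n < g) :
    a (i + n) ≠ a i := fun heq => by
  have hdvd : n ≡ 0 [MOD g] := Nat.ModEq.add_left_cancel' i ((h.eq_iff _ _).1 heq)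
  exact hn (hdvd.eq_of_lt_of_lt hng (by omega))

theorem succ_mem_edgeNeighbors (h : IsEdgeCycle H g a) (hg : 2 ≤ g) (i : ℕ) :
    a (i + 1) ∈ edgeNeighbors H (a i) :=
  mem_edgeNeighbors.2 ⟨h.mem _, h.apply_add_ne i one_ne_zero (by omega), h.meet i⟩

theorem mem_edgeNeighbors_succ (h : IsEdgeCycle H g a) (hg : 2 ≤ g) (i : ℕ) :
    a i ∈ edgeNeighbors H (a (i + 1)) :=
  mem_edgeNeighbors.2 ⟨h.mem _, (h.apply_add_ne i one_ne_zero (by omega)).symm,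
    by simpa only [inter_comm] using h.meet i⟩

theorem pred_mem_edgeNeighbors (h : IsEdgeCycle H g a) (hg : 2 ≤ g) :
    a (g - 1) ∈ edgeNeighbors H (a 0) := by
  have hmem := h.mem_edgeNeighbors_succ hg (g - 1)
  rwa [show g - 1 + 1 = 0 + g by omega, h.apply_add_period] at hmem

theorem apply_pred_ne_apply_one (h : IsEdgeCycle H g a) (hg : 3 ≤ g) : a (g - 1) ≠ a 1 :=
  fun heq => by
    have := h.inj (g - 1) (by omega) 1 (by omega) heq
    omega

theorem two_le_card_edgeNeighbors (h : IsEdgeCycle H g a) (hg : 3 ≤ g) (i : ℕ) :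
    2 ≤ #(edgeNeighbors H (a i)) := by
  have hprev := (h.shift i).pred_mem_edgeNeighbors (by omega)
  have hnext := (h.shift i).succ_mem_edgeNeighbors (by omega) 0
  have hne := (h.shift i).apply_pred_ne_apply_one hg
  simp only [zero_add] at hprev hnext
  rw [← card_pair hne]
  exact card_le_card (insert_subset hprev (singleton_subset_iff.2 hnext))

end IsEdgeCycle

/-- The pairs `i < j` of indices of edges that meet in a hypercycle with a pendant hyperpath: the
first `g` indices run around the cycle, the path is attached to the edge `0`, and the indices from
`g` on run along the path. -/
def LollipopAdj (g i j : ℕ) : Prop :=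
  (j < g ∧ (j = i + 1 ∨ (i = 0 ∧ j + 1 = g))) ∨ (j = g ∧ i = 0) ∨ (g < j ∧ j = i + 1)

/-- The index of the edge at which a cycle of `g` edges with a pendant path of `s` edges can be
continued. -/
def lollipopEnd (g s : ℕ) : ℕ := if s = 0 then 0 else g + s - 1

theorem lollipopAdj_add_iff {i : ℕ} :
    LollipopAdj g i (g + s) ↔ i = lollipopEnd g s := by
  unfold LollipopAdj lollipopEnd
  split_ifs <;> omega

theorem lollipopEnd_succ : lollipopEnd g (s + 1) = g + s := by
  simp [lollipopEnd, ← add_assoc]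

theorem lollipopEnd_lt (hg : g ≠ 0) : lollipopEnd g s < g + s := by
  unfold lollipopEnd
  split_ifs <;> omega

/-- A cycle of edges of `H` outside whose first edge all edges of `H` have at most two neighbours,
while the first one has at most three. -/
structure IsLollipopCycle (H : Hypergraph V) (g : ℕ) (a : ℕ → Finset V) : Prop
    extends IsEdgeCycle H g a where
  card_first : #(edgeNeighbors H (a 0)) ≤ 3
  card_le : ∀ e ∈ edgeFamily H, e ≠ a 0 → #(edgeNeighbors H e) ≤ 2

/-- A partial enumeration of the edges of `H`, first along a cycle of `g` edges and then along a
pendant path of `s` edges, at most the last of which has further neighbours. -/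
structure IsLollipopEnum (H : Hypergraph V) (g s : ℕ) (a : ℕ → Finset V) : Prop where
  inj : ∀ i < g + s, ∀ j < g + s, a i = a j → i = j
  mem : ∀ i < g + s, a i ∈ edgeFamily H
  meet_iff : ∀ j < g + s, ∀ i < j, ((a i ∩ a j).Nonempty ↔ LollipopAdj g i j)
  closed : ∀ i < g + s, i ≠ lollipopEnd g s →
    edgeNeighbors H (a i) ⊆ (range (g + s)).image a

namespace IsLollipopCycle

theorem edgeNeighbors_eq (h : IsLollipopCycle H g a) (hg : 3 ≤ g) {i : ℕ} (hi : i + 1 < g) :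
    edgeNeighbors H (a (i + 1)) = {a i, a (i + 2)} := by
  refine eq_pair_of_card_le_two (h.card_le _ (h.mem _) ?_)
    (h.mem_edgeNeighbors_succ (by omega) i) (h.succ_mem_edgeNeighbors (by omega) (i + 1))
    (h.apply_add_ne i two_ne_zero (by omega)).symm
  exact fun heq => i.succ_ne_zero (h.inj _ hi _ (by omega) heq)

theorem apply_zero (h : IsLollipopCycle H g a) : a g = a 0 := by
  simpa only [zero_add] using h.apply_add_period 0

theorem isLollipopEnum (hg : 3 ≤ g) (h : IsLollipopCycle H g a) : IsLollipopEnum H g 0 a where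
  inj := h.inj
  mem i _ := h.mem i
  meet_iff j hj i hij := by
    obtain ⟨j, rfl⟩ : ∃ j', j = j' + 1 := ⟨j - 1, by omega⟩
    have hmeet : (a i ∩ a (j + 1)).Nonempty ↔ a i ∈ edgeNeighbors H (a (j + 1)) := by
      rw [mem_edgeNeighbors, inter_comm]
      exact ⟨fun hne => ⟨h.mem i, fun heq => by
        have := h.inj _ (by omega) _ hj heq
        omega, hne⟩, fun hne => hne.2.2⟩
    have hprev : a i = a j ↔ i = j :=
      ⟨h.inj i (by omega) j (by omega), congrArg a⟩
    have hnext : a i = a (j + 2) ↔ i = 0 ∧ j + 2 = g := by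
      refine ⟨fun heq => ?_, fun ⟨hi, hjg⟩ => by rw [hi, hjg, h.apply_zero]⟩
      rcases (show j + 2 ≤ g by omega).eq_or_lt with hjg | hjg
      · rw [hjg, h.apply_zero] at heq
        exact ⟨h.inj i (by omega) 0 (by omega) heq, hjg⟩
      · have := h.inj i (by omega) _ hjg heq
        omega
    rw [hmeet, h.edgeNeighbors_eq hg hj, mem_insert, mem_singleton, hprev, hnext]
    unfold LollipopAdj
    omega
  closed i hi hi₀ := by
    obtain ⟨i, rfl⟩ : ∃ i', i = i' + 1 := ⟨i - 1, by simp only [lollipopEnd, if_true] at hi₀; omega⟩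
    rw [h.edgeNeighbors_eq hg hi, insert_subset_iff, singleton_subset_iff, mem_image, mem_image]
    refine ⟨⟨i, mem_range.2 (by omega), rfl⟩, ?_⟩
    rcases (show i + 2 ≤ g by omega).eq_or_lt with hig | hig
    · exact ⟨0, mem_range.2 (by omega), by rw [hig, h.apply_zero]⟩
    · exact ⟨i + 2, mem_range.2 hig, rfl⟩

end IsLollipopCycle

namespace IsLollipopEnum

theorem exists_edge_at_end (h : IsLollipopEnum H g s a) (hg : g ≠ 0) (hconn : H.IsConnected)
    (hne : ∀ e ∈ edgeFamily H, e.Nonempty) (hm : g + s < #(edgeFamily H)) :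
    ∃ f ∈ edgeFamily H, f ∉ (range (g + s)).image a ∧
      ∀ i < g + s, ((a i ∩ f).Nonempty ↔ i = lollipopEnd g s) := by
  obtain ⟨e, he, f, hf, hfa, hef⟩ := exists_inter_nonempty_of_isConnected hconn hne
    (image_range_ssubset h.inj h.mem hm) ⟨a 0, mem_image_of_mem a (mem_range.2 (by omega))⟩
  obtain ⟨o, ho, rfl⟩ := mem_image.1 he
  have hend : ∀ i < g + s, (a i ∩ f).Nonempty → i = lollipopEnd g s := by
    intro i hi hmeet
    by_contra hi_end
    refine hfa (h.closed i hi hi_end (mem_edgeNeighbors.2 ⟨hf, ?_, hmeet⟩))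
    rintro rfl
    exact hfa (mem_image_of_mem a (mem_range.2 hi))
  refine ⟨f, hf, hfa, fun i hi => ⟨hend i hi, ?_⟩⟩
  rintro rfl
  rwa [← hend o (mem_range.1 ho) hef]

theorem mem_edgeNeighbors_of_lt (h : IsLollipopEnum H g s a) {i j : ℕ} (hij : i < j)
    (hj : j < g + s) (hadj : LollipopAdj g i j) :
    a i ∈ edgeNeighbors H (a j) ∧ a j ∈ edgeNeighbors H (a i) := by
  have hne : a i ≠ a j := fun heq => hij.ne (h.inj i (by omega) j hj heq)
  have hmeet := (h.meet_iff j hj i hij).2 hadj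
  exact ⟨mem_edgeNeighbors.2 ⟨h.mem i (by omega), hne, by rwa [inter_comm]⟩,
    mem_edgeNeighbors.2 ⟨h.mem j hj, hne.symm, hmeet⟩⟩

theorem edgeNeighbors_zero_subset (h : IsLollipopEnum H g 0 a) (hg : 3 ≤ g)
    (hcard : #(edgeNeighbors H (a 0)) ≤ 3) (hf : f ∈ edgeNeighbors H (a 0))
    (hfa : f ∉ (range g).image a) :
    edgeNeighbors H (a 0) ⊆ insert f ((range g).image a) := by
  have hmem : ∀ i < g, a i ∈ (range g).image a := fun i hi =>
    mem_image_of_mem a (mem_range.2 hi)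
  have hne : ∀ i < g, a i ≠ f := fun i hi heq => hfa (heq ▸ hmem i hi)
  have hnext := (h.mem_edgeNeighbors_of_lt (i := 0) (j := 1) (by omega) (by omega)
    (.inl ⟨by omega, .inl rfl⟩)).2
  have hlast := (h.mem_edgeNeighbors_of_lt (i := 0) (j := g - 1) (by omega) (by omega)
    (.inl ⟨by omega, .inr ⟨rfl, by omega⟩⟩)).2
  have hne' : a 1 ≠ a (g - 1) := fun heq => by
    have := h.inj 1 (by omega) _ (by omega) heq
    omega
  rw [eq_triple_of_card_le_three hcard hnext hlast hf hne' (hne _ (by omega)) (hne _ (by omega))]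
  simp [insert_subset_iff, hmem 1 (by omega), hmem (g - 1) (by omega)]

theorem edgeNeighbors_end_succ_subset (h : IsLollipopEnum H g (s + 1) a) (hg : g ≠ 0)
    (hcard : #(edgeNeighbors H (a (g + s))) ≤ 2) (hf : f ∈ edgeNeighbors H (a (g + s)))
    (hfa : f ∉ (range (g + (s + 1))).image a) :
    edgeNeighbors H (a (g + s)) ⊆ insert f ((range (g + (s + 1))).image a) := by
  have hlt : lollipopEnd g s < g + s := lollipopEnd_lt hg
  have hmem : a (lollipopEnd g s) ∈ (range (g + (s + 1))).image a :=
    mem_image_of_mem a (mem_range.2 (by omega))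
  have hprev := (h.mem_edgeNeighbors_of_lt hlt (by omega) (lollipopAdj_add_iff.2 rfl)).1
  rw [eq_pair_of_card_le_two hcard hprev hf fun heq => hfa (heq ▸ hmem)]
  simp [insert_subset_iff, hmem]

theorem edgeNeighbors_end_subset (h : IsLollipopEnum H g s a) (hg : 3 ≤ g)
    (hcard₀ : #(edgeNeighbors H (a 0)) ≤ 3)
    (hcard : ∀ e ∈ edgeFamily H, e ≠ a 0 → #(edgeNeighbors H e) ≤ 2)
    (hf : f ∈ edgeNeighbors H (a (lollipopEnd g s))) (hfa : f ∉ (range (g + s)).image a) :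
    edgeNeighbors H (a (lollipopEnd g s)) ⊆ insert f ((range (g + s)).image a) := by
  cases s with
  | zero => exact h.edgeNeighbors_zero_subset hg hcard₀ hf hfa
  | succ s =>
    refine h.edgeNeighbors_end_succ_subset (by omega)
      (hcard _ (h.mem _ (by omega)) fun heq => ?_) hf hfa
    have := h.inj _ (by omega) 0 (by omega) heq
    omega

theorem update_end (h : IsLollipopEnum H g s a) (hg : 3 ≤ g)
    (hcard₀ : #(edgeNeighbors H (a 0)) ≤ 3)
    (hcard : ∀ e ∈ edgeFamily H, e ≠ a 0 → #(edgeNeighbors H e) ≤ 2) (hf : f ∈ edgeFamily H)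
    (hfa : f ∉ (range (g + s)).image a)
    (hmeet : ∀ i < g + s, ((a i ∩ f).Nonempty ↔ i = lollipopEnd g s)) :
    IsLollipopEnum H g (s + 1) (Function.update a (g + s) f) := by
  have hold : ∀ i < g + s, Function.update a (g + s) f i = a i := fun i hi =>
    Function.update_of_ne hi.ne _ _
  have hnew : Function.update a (g + s) f (g + s) = f := Function.update_self ..
  have hne : ∀ i < g + s, a i ≠ f := fun i hi heq =>
    hfa (heq ▸ mem_image_of_mem a (mem_range.2 hi))
  have hsplit : ∀ i < g + (s + 1), i < g + s ∨ i = g + s := by omega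
  refine ⟨fun i hi j hj hij => ?_, fun i hi => ?_, fun j hj i hij => ?_, fun i hi hi_end => ?_⟩
  · rcases hsplit i hi with hi | rfl <;> rcases hsplit j hj with hj | rfl
    · exact h.inj i hi j hj (by rwa [hold i hi, hold j hj] at hij)
    · exact absurd (by rwa [hold i hi, hnew] at hij) (hne i hi)
    · exact absurd (by rwa [hold j hj, hnew, eq_comm] at hij) (hne j hj)
    · rfl
  · rcases hsplit i hi with hi | rfl
    · exact (hold i hi).symm ▸ h.mem i hi
    · exact hnew.symm ▸ hf
  · rcases hsplit j hj with hj | rfl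
    · rw [hold i (by omega), hold j hj, h.meet_iff j hj i hij]
    · rw [hold i hij, hnew, lollipopAdj_add_iff, hmeet i hij]
  · have hi : i < g + s := (hsplit i hi).resolve_right (lollipopEnd_succ (s := s) ▸ hi_end)
    rw [hold i hi, ← add_assoc, image_range_succ_update]
    rcases eq_or_ne i (lollipopEnd g s) with rfl | hi_old
    · exact h.edgeNeighbors_end_subset hg hcard₀ hcard
        (mem_edgeNeighbors.2 ⟨hf, (hne _ hi).symm, (hmeet _ hi).2 rfl⟩) hfa
    · exact (h.closed i hi hi_old).trans (subset_insert _ _)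

end IsLollipopEnum

namespace IsLollipopCycle

theorem exists_isLollipopEnum (h : IsLollipopCycle H g a) (hg : 3 ≤ g) (hconn : H.IsConnected)
    (hne : ∀ e ∈ edgeFamily H, e.Nonempty) (hs : g + s ≤ #(edgeFamily H)) :
    ∃ b, IsLollipopEnum H g s b ∧ b 0 = a 0 := by
  induction s with
  | zero => exact ⟨a, h.isLollipopEnum hg, rfl⟩
  | succ s ih =>
    obtain ⟨b, hb, hb₀⟩ := ih (by omega)
    obtain ⟨f, hf, hfb, hmeet⟩ := hb.exists_edge_at_end (by omega) hconn hne (by omega)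
    exact ⟨_, hb.update_end hg (hb₀ ▸ h.card_first) (hb₀ ▸ h.card_le) hf hfb hmeet,
      (Function.update_of_ne (by omega) _ _).trans hb₀⟩

theorem exists_isEdgeEnum (h : IsLollipopCycle H g a) (hg : 3 ≤ g) (hconn : H.IsConnected)
    (hne : ∀ e ∈ edgeFamily H, e.Nonempty) (hm : #(edgeFamily H) = m) (hgm : g ≤ m) :
    ∃ b, IsEdgeEnum H m b ∧
      ∀ j < m, ∀ i < j, ((b i ∩ b j).Nonempty ↔ LollipopAdj g i j) := by
  obtain ⟨s, rfl⟩ := Nat.exists_eq_add_of_le hgm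
  obtain ⟨b, hb, -⟩ := h.exists_isLollipopEnum hg hconn hne hm.ge
  refine ⟨b, ⟨hb.inj, fun e => ?_⟩, hb.meet_iff⟩
  rw [← image_range_eq hb.inj hb.mem hm.le]
  simp

end IsLollipopCycle

end UnicyclicHypergraph

/-! ### Edge excess -/

namespace UnicyclicHypergraph

open Hypergraph Finset

section SumSq

variable {ι : Type*} {s : Finset ι} {x : ι → ℤ} {i : ι}

theorem sum_sq_le_two (hi : i ∈ s) (hsum : ∑ j ∈ s, x j = 0) (hxi : x i ≤ 1)
    (hx : ∀ j ∈ s, j ≠ i → x j ≤ 0) : ∑ j ∈ s, x j ^ 2 ≤ 2 := by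
  classical
  rw [← add_sum_erase _ _ hi] at hsum ⊢
  have hneg : ∀ j ∈ s.erase i, x j ≤ 0 := fun j hj =>
    hx j (mem_of_mem_erase hj) (ne_of_mem_erase hj)
  have hsq : ∀ j ∈ s.erase i, x j ^ 2 ≤ -x j := by
    intro j hj
    have hle := single_le_sum (f := fun j => -x j) (fun j hj => neg_nonneg.2 (hneg j hj)) hj
    rw [sum_neg_distrib] at hle
    nlinarith [hneg j hj]
  have hle := sum_le_sum hsq
  rw [sum_neg_distrib] at hle
  nlinarith [sum_nonpos hneg]

theorem zero_le_sq_add_self (n : ℤ) : 0 ≤ n ^ 2 + n := by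
  rcases le_or_gt 0 n with hn | hn
  · positivity
  · nlinarith

theorem le_of_sum_sq_le_two (hi : i ∈ s) (hsum : ∑ j ∈ s, x j = 0) (hxi : 1 ≤ x i)
    (hsq : ∑ j ∈ s, x j ^ 2 ≤ 2) : x i ≤ 1 ∧ ∀ j ∈ s, j ≠ i → x j ≤ 0 := by
  classical
  rw [← add_sum_erase _ _ hi] at hsum hsq
  have hnonneg : ∀ j ∈ s.erase i, 0 ≤ x j ^ 2 + x j := fun j _ => zero_le_sq_add_self (x j)
  have hsum_nonneg := sum_nonneg hnonneg
  rw [sum_add_distrib] at hsum_nonneg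
  have hxi' : x i = 1 := by nlinarith
  have hzero := (sum_eq_zero_iff_of_nonneg hnonneg).1 (by
    rw [sum_add_distrib]
    rw [hxi'] at hsum hsq
    linarith)
  refine ⟨hxi'.le, fun j hj hji => ?_⟩
  nlinarith [hzero j (mem_erase.2 ⟨hji, hj⟩)]

end SumSq

section Unicyclic

variable {V : Type*} {H : Hypergraph V} {k m g : ℕ}

theorem exists_isCycle_of_isLinearUnicyclic (h : H.IsLinearUnicyclic k m g) :
    ∃ (v : Fin g → V) (e : Fin g → Set V), H.IsCycle v e := by
  obtain ⟨_, C, ⟨l, v, e, hc, -⟩, -⟩ := h.unicyclic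
  have hmem := Nat.sInf_mem (s := {l | ∃ (v : Fin l → V) (e : Fin l → Set V), H.IsCycle v e})
    ⟨l, v, e, hc⟩
  rw [← girth, h.girth_eq] at hmem
  exact hmem

theorem one_le_degree_of_isConnected [Finite V] [Nontrivial V] (h : H.IsConnected)
    (hV : H.vertexSet = Set.univ) (v : V) : 1 ≤ H.degree v := by
  classical
  have := Fintype.ofFinite V
  obtain ⟨e, he, hv⟩ := exists_mem_edgeSet_of_isConnected h hV v
  rw [← card_filter_mem_edgeFamily]
  exact card_pos.2 ⟨e.toFinset, by simpa [mem_edgeFamily] using ⟨he, hv⟩⟩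

variable [Fintype V]

theorem nonempty_of_isUniform (hu : H.IsUniform k) (hk : k ≠ 0) :
    ∀ e ∈ edgeFamily H, e.Nonempty := fun e he =>
  card_ne_zero.1 (by rwa [card_eq_of_isUniform hu e he])

theorem card_add_eq_mul_of_isLinearUnicyclic (h : H.IsLinearUnicyclic k m g) (hk : k ≠ 0) :
    Fintype.card V + m = k * m := by
  have hne : ∀ e ∈ H.edgeSet, e.Nonempty := fun e he =>
    Set.nonempty_of_ncard_ne_zero (by rwa [h.uniform e he])
  have hcard := card_edgeSet_incGraph_of_isUnicyclic h.unicyclic h.vertexSet_eq hne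
  rw [card_edgeSet_incGraph_of_isUniform h.uniform, Nat.card_sum, Nat.card_eq_fintype_card,
    Nat.card_coe_set_eq, h.card_edges] at hcard
  exact hcard.symm

theorem sum_degree_pow_of_isLinearUnicyclic (h : H.IsLinearUnicyclic k m g)
    (hd : ∀ v, 1 ≤ H.degree v ∧ H.degree v ≤ 2) (t : ℕ) :
    ∑ v, (H.degree v : ℤ) ^ t = (2 ^ t - 1) * (k * m) + (2 - 2 ^ t) * Fintype.card V := by
  have hinterp : ∀ v, (H.degree v : ℤ) ^ t = (2 ^ t - 1) * H.degree v + (2 - 2 ^ t) := by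
    intro v
    obtain ⟨hone, htwo⟩ := hd v
    generalize H.degree v = d at *
    interval_cases d <;> push_cast <;> ring
  simp only [hinterp, sum_add_distrib, ← mul_sum, sum_const, card_univ, nsmul_eq_mul]
  rw [← Nat.cast_sum, sum_degree h.uniform, h.card_edges]
  push_cast
  ring

variable [DecidableEq V]

theorem exists_isEdgeCycle_of_isCycle {v : Fin g → V} {e : Fin g → Set V} (h : H.IsCycle v e) :
    ∃ a, IsEdgeCycle H g a ∧ ∀ i : Fin g, (a i : Set V) = e i := by
  classical
  obtain ⟨g, rfl⟩ : ∃ g', g = g' + 1 := ⟨g - 1, by have := h.two_le; omega⟩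
  refine ⟨fun n => (e (Fin.ofNat (g + 1) n)).toFinset,
    ⟨fun i j => ?_, fun i => ?_, fun i => ?_⟩, fun i => by simp⟩
  · rw [Set.toFinset_inj, h.edge_injective.eq_iff]
    simp [Fin.ext_iff, Nat.ModEq]
  · rw [mem_edgeFamily, Set.coe_toFinset]
    exact h.edge_mem _
  · have hright := h.right_mem (Fin.ofNat (g + 1) i)
    have hrot : finRotate (g + 1) (Fin.ofNat (g + 1) i) = Fin.ofNat (g + 1) (i + 1) := by
      rw [finRotate_apply]
      ext
      simp [Fin.val_add]
    rw [hrot] at hright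
    exact ⟨_, mem_inter.2 ⟨Set.mem_toFinset.2 hright, Set.mem_toFinset.2 (h.left_mem _)⟩⟩

theorem exists_isEdgeCycle_three_le_card (h : H.IsLinearUnicyclic k m g)
    (hk : k ≠ 0) (hg : 3 ≤ g) (hgm : g < m) :
    ∃ a, IsEdgeCycle H g a ∧ 3 ≤ #(edgeNeighbors H (a 0)) := by
  obtain ⟨v, e, hc⟩ := exists_isCycle_of_isLinearUnicyclic h
  obtain ⟨b, hb, -⟩ := exists_isEdgeCycle_of_isCycle hc
  have himage : (range g).image b ⊂ edgeFamily H :=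
    image_range_ssubset hb.inj (fun i _ => hb.mem i) (by rwa [card_edgeFamily, h.card_edges])
  obtain ⟨e, he, f, hf, hfb, hmeet⟩ := exists_inter_nonempty_of_isConnected h.unicyclic.1
    (nonempty_of_isUniform h.uniform hk) himage
    ⟨b 0, mem_image_of_mem b (mem_range.2 (by omega))⟩
  obtain ⟨n, -, rfl⟩ := mem_image.1 he
  have hfne : ∀ i, f ≠ b i := fun i hfi => hfb <| mem_image.2 ⟨i % g,
    mem_range.2 (Nat.mod_lt _ (by omega)), ((hb.eq_iff _ _).2 (Nat.mod_modEq i g)).trans hfi.symm⟩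
  have ha := hb.shift n
  have hpred := ha.pred_mem_edgeNeighbors (by omega)
  have hsucc : b (1 + n) ∈ edgeNeighbors H (b (0 + n)) := by
    simpa only [zero_add] using ha.succ_mem_edgeNeighbors (by omega) 0
  have hne := ha.apply_pred_ne_apply_one hg
  have hf' : f ∈ edgeNeighbors H (b (0 + n)) :=
    mem_edgeNeighbors.2 ⟨hf, hfne _, by simpa using hmeet⟩
  refine ⟨_, ha, ?_⟩
  rw [← card_eq_three.2 ⟨_, _, _, hfne (g - 1 + n), hfne (1 + n), hne, rfl⟩]
  exact card_le_card (insert_subset hf' (insert_subset hpred (singleton_subset_iff.2 hsucc)))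

/-- The number of neighbours of the edge `e` beyond the two that an edge of a cycle has. -/
noncomputable def excess (H : Hypergraph V) (e : Finset V) : ℤ := #(edgeNeighbors H e) - 2

section DegreeLeTwo

variable (h : H.IsLinearUnicyclic k m g) (hk : k ≠ 0)
  (hd : ∀ v, 1 ≤ H.degree v ∧ H.degree v ≤ 2)

include h hk hd

theorem sum_excess : ∑ e ∈ edgeFamily H, excess H e = 0 := by
  have hdeg := sum_edgeFamily_sum H fun v => (H.degree v : ℤ)
  rw [sum_congr rfl fun e he => by
      rw [← Nat.cast_sum, sum_degree_edge h.uniform h.linear he, Nat.cast_add],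
    sum_add_distrib, sum_const, card_edgeFamily, h.card_edges, nsmul_eq_mul] at hdeg
  simp only [← sq] at hdeg
  rw [sum_degree_pow_of_isLinearUnicyclic h hd 2] at hdeg
  have hcard := card_add_eq_mul_of_isLinearUnicyclic h hk
  simp only [excess]
  rw [sum_sub_distrib, sum_const, card_edgeFamily, h.card_edges, nsmul_eq_mul]
  zify at hcard
  linarith

theorem sum_edge_sq_eq_add_sum_excess_sq :
    ((∑ e ∈ edgeFamily H, (∑ v ∈ e, H.degree v) ^ 2 : ℕ) : ℤ) =
      m * (k + 2) ^ 2 + ∑ e ∈ edgeFamily H, excess H e ^ 2 := by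
  rw [sum_congr rfl fun e he => by rw [sum_degree_edge h.uniform h.linear he]]
  have hexpand : ∀ e : Finset V, ((k : ℤ) + #(edgeNeighbors H e)) ^ 2 = (k + 2) ^ 2 +
      2 * (k + 2) * excess H e + excess H e ^ 2 := fun e => by
    unfold excess
    ring
  push_cast
  simp only [hexpand, sum_add_distrib, ← mul_sum, sum_excess h hk hd, sum_const, card_edgeFamily,
    h.card_edges]
  simp

theorem sum_excess_sq_le_two {a : ℕ → Finset V} (ha : IsLollipopCycle H g a) :
    ∑ e ∈ edgeFamily H, excess H e ^ 2 ≤ 2 := by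
  refine sum_sq_le_two (ha.mem 0) (sum_excess h hk hd) ?_ fun e he hne => ?_
  · have := ha.card_first
    unfold excess
    omega
  · have := ha.card_le e he hne
    unfold excess
    omega

theorem exists_isLollipopCycle_of_eq (hg : 3 ≤ g) (hgm : m = g) :
    ∃ a, IsLollipopCycle H g a := by
  obtain ⟨v, e, hc⟩ := exists_isCycle_of_isLinearUnicyclic h
  obtain ⟨a, ha, -⟩ := exists_isEdgeCycle_of_isCycle hc
  have himage : (range g).image a = edgeFamily H := by
    refine image_range_eq ha.inj (fun i _ => ha.mem i) ?_
    rw [card_edgeFamily, h.card_edges, hgm]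
  have hnonneg : ∀ f ∈ edgeFamily H, 0 ≤ excess H f := by
    intro f hf
    rw [← himage, mem_image] at hf
    obtain ⟨i, -, rfl⟩ := hf
    have := ha.two_le_card_edgeNeighbors hg i
    unfold excess
    omega
  have hzero := (sum_eq_zero_iff_of_nonneg hnonneg).1 (sum_excess h hk hd)
  have hcard : ∀ f ∈ edgeFamily H, #(edgeNeighbors H f) = 2 := fun f hf => by
    have := hzero f hf
    unfold excess at this
    omega
  exact ⟨a, ha, by rw [hcard _ (ha.mem 0)]; omega, fun f hf _ => (hcard f hf).le⟩

theorem exists_isLollipopCycle_of_sum_excess_sq_le_two (hg : 3 ≤ g) (hgm : g < m)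
    (hsq : ∑ e ∈ edgeFamily H, excess H e ^ 2 ≤ 2) : ∃ a, IsLollipopCycle H g a := by
  obtain ⟨a, ha, hcard⟩ := exists_isEdgeCycle_three_le_card h hk hg hgm
  obtain ⟨hfirst, hle⟩ := le_of_sum_sq_le_two (ha.mem 0) (sum_excess h hk hd)
    (by unfold excess; omega) hsq
  refine ⟨a, ha, ?_, fun e he hne => ?_⟩
  · unfold excess at hfirst
    omega
  · have := hle e he hne
    unfold excess at this
    omega

end DegreeLeTwo

end Unicyclic

end UnicyclicHypergraph

/-! ### Recognizing linear unicyclic hypergraphs -/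

namespace UnicyclicHypergraph

open Hypergraph Finset

section Recognition

variable {V : Type*} {H : Hypergraph V} {k m g : ℕ}

theorem isConnected_of_forall_exists_inter_nonempty {E : ℕ → Set V} {N : ℕ} {u : V}
    (hV : H.vertexSet = Set.univ) (hE : ∀ n < N, E n ∈ H.edgeSet) (hu : u ∈ E 0)
    (hcover : ∀ x, ∃ n < N, x ∈ E n)
    (hmeet : ∀ n < N, n ≠ 0 → ∃ j < n, (E j ∩ E n).Nonempty) : H.IsConnected := by
  have hreach : ∀ n < N, ∀ x ∈ E n, Relation.ReflTransGen H.Adj u x := by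
    intro n
    induction n using Nat.strong_induction_on with
    | _ n ih =>
      intro hn x hx
      rcases eq_or_ne n 0 with rfl | hn₀
      · exact .single ⟨E 0, hE 0 hn, hu, hx⟩
      · obtain ⟨j, hj, y, hyj, hyn⟩ := hmeet n hn hn₀
        exact (ih j hj (by omega) y hyj).tail ⟨E n, hE n hn, hyn, hx⟩
  have hreach' : ∀ x, Relation.ReflTransGen H.Adj u x := fun x => by
    obtain ⟨n, hn, hx⟩ := hcover x
    exact hreach n hn x hx
  have : Std.Symm H.Adj := ⟨fun _ _ h => h.symm⟩
  exact ⟨⟨u, hV ▸ trivial⟩, fun x _ y _ =>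
    (Relation.ReflTransGen.stdSymm.symm _ _ (hreach' x)).trans (hreach' y)⟩

theorem image_snd_cycleIncidences {l : ℕ} (v : Fin l → V) (e : Fin l → Set V) :
    Prod.snd '' cycleIncidences v e = Set.range e := by
  ext f
  constructor
  · rintro ⟨_, ⟨i, rfl | rfl⟩, rfl⟩ <;> exact ⟨i, rfl⟩
  · rintro ⟨i, rfl⟩
    exact ⟨_, ⟨i, .inl rfl⟩, rfl⟩

theorem eq_of_cycleIncidences_eq {l l' : ℕ} {v : Fin l → V} {e : Fin l → Set V}
    {v' : Fin l' → V} {e' : Fin l' → Set V} (h : H.IsCycle v e) (h' : H.IsCycle v' e')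
    (heq : cycleIncidences v e = cycleIncidences v' e') : l = l' := by
  have hcard := congrArg (fun s => (Prod.snd '' s).ncard) heq
  simpa only [image_snd_cycleIncidences, Set.ncard_range_of_injective h.edge_injective,
    Set.ncard_range_of_injective h'.edge_injective, Nat.card_fin] using hcard

theorem isLinearUnicyclic_of_isCycle [Finite V] (hV : H.vertexSet = Set.univ)
    (hu : H.IsUniform k) (hk : k ≠ 0) (hl : H.IsLinear) (hconn : H.IsConnected)
    (hm : H.edgeSet.ncard = m) (hcard : Nat.card V + m = k * m)
    {v : Fin g → V} {e : Fin g → Set V} (hc : H.IsCycle v e) : H.IsLinearUnicyclic k m g := by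
  have hne : ∀ e ∈ H.edgeSet, e.Nonempty := fun e he =>
    Set.nonempty_of_ncard_ne_zero (by rwa [hu e he])
  have hinc := connected_incGraph hconn hV hne
  have hinc_card : Nat.card (incGraph H).edgeSet = Nat.card (V ⊕ H.edgeSet) := by
    rw [card_edgeSet_incGraph_of_isUniform hu, Nat.card_sum, Nat.card_coe_set_eq, hm, hcard]
  have huniq : ∀ {l : ℕ} {v' : Fin l → V} {e' : Fin l → Set V}, H.IsCycle v' e' →
      cycleIncidences v' e' = cycleIncidences v e := fun h =>
    (cycleIncidences_subset hinc hinc_card hc h).antisymm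
      (cycleIncidences_subset hinc hinc_card h hc)
  have hlengths : {l | ∃ (v : Fin l → V) (e : Fin l → Set V), H.IsCycle v e} = {g} := by
    ext l
    constructor
    · rintro ⟨v', e', h⟩
      exact eq_of_cycleIncidences_eq h hc (huniq h)
    · rintro rfl
      exact ⟨v, e, hc⟩
  refine ⟨hV, hu, hl, ⟨hconn, _, ⟨g, v, e, hc, rfl⟩, ?_⟩, hm, ?_⟩
  · rintro _ ⟨l, v', e', h, rfl⟩
    exact huniq h
  · rw [girth, hlengths, csInf_singleton]

end Recognition

/-! ### The hypercycle with a pendant hyperpath -/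

section LinkEdge

variable {A B : Type*} {n : ℕ} {a b c : A} {i : B} {q : B × Fin n}

/-- The edge with the two ends `a` and `b` and the `n` interior vertices `(i, j)`; the edges of
hypercycles and of hyperpaths have this form. -/
def linkEdge (n : ℕ) (a b : A) (i : B) : Set (A ⊕ B × Fin n) :=
  {Sum.inl a, Sum.inl b} ∪ Set.range fun j => Sum.inr (i, j)

theorem inl_mem_linkEdge : Sum.inl c ∈ linkEdge n a b i ↔ c = a ∨ c = b := by
  simp [linkEdge]

theorem inr_mem_linkEdge : Sum.inr q ∈ linkEdge n a b i ↔ i = q.1 := by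
  simp [linkEdge, Prod.ext_iff]

theorem ncard_linkEdge (hab : a ≠ b) : (linkEdge n a b i).ncard = n + 2 := by
  have hdisj : Disjoint ({Sum.inl a, Sum.inl b} : Set (A ⊕ B × Fin n))
      (Set.range fun j => Sum.inr (i, j)) := by
    rw [Set.disjoint_left]
    rintro x (rfl | rfl) <;> simp
  have hinj : Function.Injective fun j : Fin n => (Sum.inr (i, j) : A ⊕ B × Fin n) := by
    intro j j' h
    simpa using h
  rw [linkEdge, Set.ncard_union_eq hdisj (Set.toFinite _) (Set.toFinite _),
    Set.ncard_pair (by simpa using hab), Set.ncard_range_of_injective hinj, Nat.card_fin, add_comm]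

end LinkEdge

variable {k g r : ℕ}

theorem val_finRotate (i : Fin g) :
    (finRotate g i : ℕ) = if (i : ℕ) + 1 = g then 0 else (i : ℕ) + 1 := by
  obtain ⟨g, rfl⟩ : ∃ g', g = g' + 1 := ⟨g - 1, by have := i.pos; omega⟩
  rw [coe_finRotate]
  simp [Fin.ext_iff]

theorem finRotate_ne_self (hg : 2 ≤ g) (i : Fin g) : finRotate g i ≠ i := fun h => by
  have hval := val_finRotate i
  rw [h] at hval
  split_ifs at hval <;> omega

theorem mem_edgeSet_hypercycle {e : Set (CycleVertex k g)} :
    e ∈ (hypercycle k g).edgeSet ↔ ∃ i, linkEdge (k - 2) i (finRotate g i) i = e :=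
  Iff.rfl

theorem isCored_hypercycle_inr (p : Fin g × Fin (k - 2)) :
    (hypercycle k g).IsCored (.inr p) := by
  rw [IsCored, degree, Set.ncard_eq_one]
  refine ⟨linkEdge (k - 2) p.1 (finRotate g p.1) p.1, Set.ext fun e => ⟨?_, ?_⟩⟩
  · rintro ⟨⟨i, rfl⟩, hp⟩
    rw [inr_mem_linkEdge.1 hp]
    rfl
  · rintro rfl
    exact ⟨⟨p.1, rfl⟩, inr_mem_linkEdge.2 rfl⟩

theorem not_isCored_hypercycle_inl (hk : 3 ≤ k) (hg : 2 ≤ g) (i : Fin g) :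
    ¬ (hypercycle k g).IsCored (.inl i) := by
  rw [IsCored, degree, Set.ncard_eq_one]
  rintro ⟨e, he⟩
  have hnext := he.le ⟨mem_edgeSet_hypercycle.2 ⟨i, rfl⟩, inl_mem_linkEdge.2 (.inl rfl)⟩
  have hprev := he.le ⟨mem_edgeSet_hypercycle.2 ⟨(finRotate g).symm i, rfl⟩,
    inl_mem_linkEdge.2 (.inr ((finRotate g).apply_symm_apply i).symm)⟩
  have hinterior : (Sum.inr (i, ⟨0, by omega⟩) : CycleVertex k g) ∈
      linkEdge (k - 2) ((finRotate g).symm i) (finRotate g ((finRotate g).symm i))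
        ((finRotate g).symm i) :=
    (hnext.trans hprev.symm).le (inr_mem_linkEdge.2 rfl)
  have hfixed : (finRotate g).symm i = i := inr_mem_linkEdge.1 hinterior
  exact finRotate_ne_self hg i ((Equiv.symm_apply_eq _).1 hfixed).symm

theorem isCored_hypercycle_iff (hk : 3 ≤ k) (hg : 2 ≤ g) {c : CycleVertex k g} :
    (hypercycle k g).IsCored c ↔ ∃ p, c = .inr p := by
  rcases c with i | p
  · simp [not_isCored_hypercycle_inl hk hg i]
  · simp [isCored_hypercycle_inr p]

section CoalMap

variable {V W : Type*} [DecidableEq W] {v : V} {w y : W}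

theorem coalMap_injective (v : V) (w : W) : Function.Injective (coalMap v w) := by
  intro x y h
  unfold coalMap at h
  split_ifs at h with hx hy hy
  · exact hx.trans hy.symm
  · simpa using h

theorem coalMap_eq_inl_iff {x : V} : coalMap v w y = .inl x ↔ y = w ∧ x = v := by
  unfold coalMap
  split_ifs with h <;> simp [h, eq_comm]

theorem coalMap_eq_inr_iff {x : {x : W // x ≠ w}} : coalMap v w y = .inr x ↔ y = x := by
  unfold coalMap
  split_ifs with h
  · simpa [h] using x.2.symm
  · simp [Subtype.ext_iff]

end CoalMap

/-- The vertices of the coalescence of a hypercycle and a hyperpath. -/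
abbrev CyclePathVertex (k g r : ℕ) : Type :=
  CoalVertex (CycleVertex k g) (Sum.inl 0 : PathVertex k r)

/-- Incidence in the coalescence of a hypercycle at its vertex `w_p` and a hyperpath, the edges of
the hypercycle being numbered from `0` to `g - 1` and those of the hyperpath from `g` to
`g + r - 1`. -/
def CyclePathInc (p : Fin g × Fin (k - 2)) (n : ℕ) : CyclePathVertex k g r → Prop
  | .inl (.inl a) => n < g ∧ (n = a ∨ n + 1 = a ∨ (n + 1 = g ∧ (a : ℕ) = 0))
  | .inl (.inr q) => n = q.1 ∨ (n = g ∧ q = p)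
  | .inr ⟨.inl a, _⟩ => n = g + a ∨ n + 1 = g + a
  | .inr ⟨.inr q, _⟩ => n = g + q.1

/-- The edge with number `n` of the coalescence of a hypercycle and a hyperpath. -/
def cyclePathEdge (p : Fin g × Fin (k - 2)) (n : ℕ) : Set (CyclePathVertex k g r) :=
  {x | CyclePathInc p n x}

variable (p : Fin g × Fin (k - 2)) {n n' : ℕ}

theorem val_ne_zero_of_inl_ne {a : Fin (r + 1)} (h : (Sum.inl a : PathVertex k r) ≠ .inl 0) :
    (a : ℕ) ≠ 0 :=
  fun ha => h (congrArg Sum.inl (Fin.ext ha))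

theorem image_inl_linkEdge (i : Fin g) :
    Sum.inl '' linkEdge (k - 2) i (finRotate g i) i = cyclePathEdge (r := r) p i := by
  have hi := i.2
  have hrot := val_finRotate i
  ext x
  rcases x with (a | q) | ⟨a | q, h⟩
  · have ha := a.2
    rw [Sum.inl_injective.mem_set_image, inl_mem_linkEdge, Fin.ext_iff, Fin.ext_iff]
    simp only [cyclePathEdge, Set.mem_ofPred_eq, CyclePathInc]
    split_ifs at hrot <;> omega
  · rw [Sum.inl_injective.mem_set_image, inr_mem_linkEdge, Fin.ext_iff]
    simp [cyclePathEdge, CyclePathInc, hi.ne]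
  · have ha := val_ne_zero_of_inl_ne h
    simp only [Set.mem_image, reduceCtorEq, and_false, exists_false, false_iff]
    simp only [cyclePathEdge, Set.mem_ofPred_eq, CyclePathInc]
    omega
  · simp only [Set.mem_image, reduceCtorEq, and_false, exists_false, false_iff]
    simp only [cyclePathEdge, Set.mem_ofPred_eq, CyclePathInc]
    omega

theorem image_coalMap_linkEdge (i : Fin r) :
    coalMap (.inr p : CycleVertex k g) (Sum.inl 0 : PathVertex k r) ''
      linkEdge (k - 2) i.castSucc i.succ i = cyclePathEdge p (g + i) := by
  ext x
  rcases x with (a | q) | ⟨a | q, h⟩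
  · simp [coalMap_eq_inl_iff, cyclePathEdge, CyclePathInc]
  · have hq := q.1.2
    have hzero : (0 = i.castSucc ∨ 0 = i.succ) ↔ (i : ℕ) = 0 := by
      simp [Fin.ext_iff, eq_comm]
    simp only [Set.mem_image, coalMap_eq_inl_iff, cyclePathEdge, Set.mem_ofPred_eq, CyclePathInc,
      Sum.inr.injEq, and_left_comm, exists_eq_left, inl_mem_linkEdge, hzero]
    constructor
    · rintro ⟨hi, rfl⟩
      exact .inr ⟨by omega, rfl⟩
    · rintro (hi | ⟨hi, rfl⟩)
      · omega
      · exact ⟨by omega, rfl⟩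
  · simp only [Set.mem_image, coalMap_eq_inr_iff, exists_eq_right, inl_mem_linkEdge, Fin.ext_iff,
      cyclePathEdge, Set.mem_ofPred_eq, CyclePathInc, Fin.val_castSucc, Fin.val_succ]
    omega
  · simp only [Set.mem_image, coalMap_eq_inr_iff, exists_eq_right, inr_mem_linkEdge, Fin.ext_iff,
      cyclePathEdge, Set.mem_ofPred_eq, CyclePathInc]
    omega

theorem mem_edgeSet_cyclePath {e : Set (CyclePathVertex k g r)} :
    e ∈ (cyclePath k g r (.inr p)).edgeSet ↔ ∃ n < g + r, cyclePathEdge p n = e := by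
  constructor
  · rintro (⟨_, ⟨i, rfl⟩, rfl⟩ | ⟨_, ⟨i, rfl⟩, rfl⟩)
    · exact ⟨i, by omega, (image_inl_linkEdge p i).symm⟩
    · exact ⟨g + i, by omega, (image_coalMap_linkEdge p i).symm⟩
  · rintro ⟨n, hn, rfl⟩
    rcases lt_or_ge n g with hng | hng
    · exact .inl ⟨_, ⟨⟨n, hng⟩, rfl⟩, image_inl_linkEdge p ⟨n, hng⟩⟩
    · obtain ⟨i, rfl⟩ := Nat.exists_eq_add_of_le hng
      exact .inr ⟨_, ⟨⟨i, by omega⟩, rfl⟩, image_coalMap_linkEdge p ⟨i, by omega⟩⟩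

theorem isUniform_cyclePath (hk : 2 ≤ k) (hg : 2 ≤ g) :
    (cyclePath k g r (.inr p)).IsUniform k := by
  rintro e (⟨_, ⟨i, rfl⟩, rfl⟩ | ⟨_, ⟨i, rfl⟩, rfl⟩)
  · rw [Set.ncard_image_of_injective _ Sum.inl_injective]
    exact (ncard_linkEdge (finRotate_ne_self hg i).symm).trans (by omega)
  · rw [Set.ncard_image_of_injective _ (coalMap_injective _ _)]
    exact (ncard_linkEdge (Fin.castSucc_lt_succ (i := i)).ne).trans (by omega)

theorem vertexSet_cyclePath (c : CycleVertex k g) :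
    (cyclePath k g r c).vertexSet = Set.univ := by
  refine Set.eq_univ_of_forall fun x => ?_
  rcases x with x | x
  · exact .inl ⟨x, trivial, rfl⟩
  · exact .inr ⟨x.1, trivial, dif_neg x.2⟩

theorem injOn_cyclePathEdge (hk : 3 ≤ k) :
    Set.InjOn (cyclePathEdge (r := r) p) (Set.Iio (g + r)) := by
  intro n hn n' hn' h
  simp only [Set.mem_Iio] at hn hn'
  wlog hle : n ≤ n' generalizing n n'
  · exact (this h.symm hn' hn (by omega)).symm
  rcases lt_or_ge n' g with hg | hg
  · have hmem : (.inl (.inr (⟨n, by omega⟩, ⟨0, by omega⟩)) : CyclePathVertex k g r) ∈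
      cyclePathEdge p n := .inl rfl
    rcases h.le hmem with hval | ⟨hval, -⟩
    · exact hval.symm
    · omega
  · obtain ⟨i, rfl⟩ := Nat.exists_eq_add_of_le hg
    have hmem : (.inr ⟨.inr (⟨i, by omega⟩, ⟨0, by omega⟩), by simp⟩ :
        CyclePathVertex k g r) ∈ cyclePathEdge p (g + i) := rfl
    exact h.ge hmem

theorem card_edgeSet_cyclePath (hk : 3 ≤ k) :
    (cyclePath k g r (.inr p)).edgeSet.ncard = g + r := by
  have himage : (cyclePath k g r (.inr p)).edgeSet = cyclePathEdge p '' Set.Iio (g + r) := by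
    ext e
    exact mem_edgeSet_cyclePath p
  rw [himage, (injOn_cyclePathEdge p hk).ncard_image, ← coe_Iio, Set.ncard_coe_finset, Nat.card_Iio]

theorem card_cyclePathVertex (hk : 2 ≤ k) :
    Fintype.card (CyclePathVertex k g r) + (g + r) = k * (g + r) := by
  have hpath : Fintype.card {x : PathVertex k r // x ≠ .inl 0} = r + r * (k - 2) := by
    rw [Fintype.card_subtype_compl]
    simp
  obtain ⟨k, rfl⟩ := Nat.exists_eq_add_of_le' hk
  rw [Fintype.card_sum, hpath]
  simp
  ring

theorem cyclePathInc_inter_cases {x : CyclePathVertex k g r} (hlt : n < n')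
    (hx : CyclePathInc p n x) (hx' : CyclePathInc p n' x) :
    (∃ a : Fin g, x = .inl (.inl a) ∧ n' < g ∧
        ((n' = n + 1 ∧ n' = a) ∨ (n = 0 ∧ n' + 1 = g ∧ (a : ℕ) = 0))) ∨
      (x = .inl (.inr p) ∧ n = p.1 ∧ n' = g) ∨
      ∃ a h, x = .inr ⟨.inl a, h⟩ ∧ g < n' ∧ n' = n + 1 ∧ n' = g + a := by
  rcases x with (a | q) | ⟨a | q, h⟩ <;> simp only [CyclePathInc] at hx hx'
  · exact .inl ⟨a, rfl, hx'.1, by omega⟩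
  · have := q.1.2
    obtain ⟨hn', rfl⟩ : n' = g ∧ q = p := hx'.resolve_left (by omega)
    exact .inr (.inl ⟨rfl, by omega, hn'⟩)
  · have := val_ne_zero_of_inl_ne h
    exact .inr (.inr ⟨a, h, rfl, by omega⟩)
  · omega

theorem isLinear_cyclePath (hg : 3 ≤ g) : (cyclePath k g r (.inr p)).IsLinear := by
  intro e he f hf hef
  obtain ⟨n, hn, rfl⟩ := (mem_edgeSet_cyclePath p).1 he
  obtain ⟨n', hn', rfl⟩ := (mem_edgeSet_cyclePath p).1 hf
  wlog hlt : n < n' generalizing n n'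
  · rw [Set.inter_comm]
    refine this n' hn' hf n hn he hef.symm (lt_of_le_of_ne (not_lt.1 hlt) ?_)
    rintro rfl
    exact hef rfl
  have hp := p.1.2
  rintro x ⟨hx, hx'⟩ y ⟨hy, hy'⟩
  obtain ⟨a, rfl, ha⟩ | ⟨rfl, hn⟩ | ⟨a, _, rfl, ha⟩ := cyclePathInc_inter_cases p hlt hx hx' <;>
    obtain ⟨b, rfl, hb⟩ | ⟨rfl, hn'⟩ | ⟨b, _, rfl, hb⟩ :=
      cyclePathInc_inter_cases p hlt hy hy'
  case inl.inl => rw [Fin.ext (show (a : ℕ) = b by omega)]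
  case inr.inl.inr.inl => rfl
  case inr.inr.inr.inr =>
    obtain rfl : a = b := Fin.ext (by omega)
    rfl
  all_goals omega

theorem isConnected_cyclePath : (cyclePath k g r (.inr p)).IsConnected := by
  have hg : 0 < g := p.1.pos
  refine isConnected_of_forall_exists_inter_nonempty (E := cyclePathEdge p) (N := g + r)
    (u := .inl (.inl ⟨0, hg⟩)) (vertexSet_cyclePath _)
    (fun n hn => (mem_edgeSet_cyclePath p).2 ⟨n, hn, rfl⟩) ⟨hg, .inl rfl⟩ (fun x => ?_)
    fun n hn hn₀ => ?_
  · rcases x with (a | q) | ⟨a | q, h⟩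
    · exact ⟨a, by omega, a.2, .inl rfl⟩
    · exact ⟨q.1, by omega, .inl rfl⟩
    · have := val_ne_zero_of_inl_ne h
      exact ⟨g + a - 1, by omega, .inr (by omega)⟩
    · exact ⟨g + q.1, by omega, rfl⟩
  · rcases lt_trichotomy n g with hng | rfl | hng
    · exact ⟨n - 1, by omega, .inl (.inl ⟨n, hng⟩), ⟨by omega, .inr (.inl (by dsimp only; omega))⟩,
        hng, .inl rfl⟩
    · exact ⟨p.1, p.1.2, .inl (.inr p), .inl rfl, .inr ⟨rfl, rfl⟩⟩
    · exact ⟨n - 1, by omega, .inr ⟨.inl ⟨n - g, by omega⟩, by simp [Fin.ext_iff]; omega⟩,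
        .inr (by dsimp only; omega), .inl (by dsimp only; omega)⟩

theorem isCycle_cyclePath (hk : 3 ≤ k) (hg : 2 ≤ g) :
    (cyclePath k g r (.inr p)).IsCycle (fun i : Fin g => .inl (.inl i))
      (fun i => cyclePathEdge p i) where
  two_le := hg
  vertex_injective i j h := by simpa using h
  edge_injective i j h := Fin.ext (injOn_cyclePathEdge p hk
    (Set.mem_Iio.2 (by omega)) (Set.mem_Iio.2 (by omega)) h)
  edge_mem i := (mem_edgeSet_cyclePath p).2 ⟨i, by omega, rfl⟩
  left_mem i := ⟨i.2, .inl rfl⟩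
  right_mem i := by
    refine ⟨i.2, ?_⟩
    rw [val_finRotate]
    split_ifs <;> omega

theorem isLinearUnicyclic_cyclePath (hk : 3 ≤ k) (hg : 3 ≤ g) :
    (cyclePath k g r (.inr p)).IsLinearUnicyclic k (g + r) g :=
  isLinearUnicyclic_of_isCycle (vertexSet_cyclePath _)
    (isUniform_cyclePath p (by omega) (by omega)) (by omega) (isLinear_cyclePath p hg)
    (isConnected_cyclePath p) (card_edgeSet_cyclePath p hk)
    (by rw [Nat.card_eq_fintype_card, card_cyclePathVertex (by omega)])
    (isCycle_cyclePath p hk (by omega))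

theorem exists_pair_of_cyclePathInc (x : CyclePathVertex k g r) :
    ∃ a b, ∀ n, CyclePathInc p n x → n = a ∨ n = b := by
  rcases x with (a | q) | ⟨a | q, h⟩
  · exact ⟨a, if (a : ℕ) = 0 then g - 1 else a - 1, fun n hn => by
      simp only [CyclePathInc] at hn
      split_ifs <;> omega⟩
  · exact ⟨q.1, g, fun n hn => hn.imp_right And.left⟩
  · exact ⟨g + a, g + a - 1, fun n hn => by
      simp only [CyclePathInc] at hn
      omega⟩
  · exact ⟨g + q.1, g, fun n hn => .inl hn⟩

theorem degree_cyclePath_le_two (x : CyclePathVertex k g r) :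
    (cyclePath k g r (.inr p)).degree x ≤ 2 := by
  obtain ⟨a, b, hab⟩ := exists_pair_of_cyclePathInc p x
  have hsub : {e | e ∈ (cyclePath k g r (.inr p)).edgeSet ∧ x ∈ e} ⊆
      {cyclePathEdge p a, cyclePathEdge p b} := by
    rintro e ⟨he, hx⟩
    obtain ⟨n, -, rfl⟩ := (mem_edgeSet_cyclePath p).1 he
    rcases hab n hx with rfl | rfl
    exacts [.inl rfl, .inr rfl]
  exact (Set.ncard_le_ncard hsub (Set.toFinite _)).trans (by
    simpa using Set.ncard_insert_le (cyclePathEdge p a) {cyclePathEdge p b})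

section EdgeNeighbors

variable {e : Finset (CyclePathVertex k g r)}

theorem card_edgeNeighbors_cyclePath_le (he : (e : Set (CyclePathVertex k g r)) = cyclePathEdge p n)
    {T : Finset ℕ} (hT : ∀ n' ≠ n, ∀ x : CyclePathVertex k g r,
      CyclePathInc p n x → CyclePathInc p n' x → n' ∈ T) :
    #(edgeNeighbors (cyclePath k g r (.inr p)) e) ≤ #T := by
  classical
  have hsub : edgeNeighbors (cyclePath k g r (.inr p)) e ⊆
      T.image fun n => (cyclePathEdge p n).toFinset := by
    intro f hf
    obtain ⟨hf, hfe, x, hx⟩ := mem_edgeNeighbors.1 hf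
    obtain ⟨n', -, hf'⟩ := (mem_edgeSet_cyclePath p).1 (mem_edgeFamily.1 hf)
    rw [mem_inter, ← mem_coe, ← mem_coe, he, ← hf'] at hx
    refine mem_image.2 ⟨n', hT n' ?_ x hx.1 hx.2, by rw [← coe_inj, Set.coe_toFinset, hf']⟩
    rintro rfl
    exact hfe (coe_injective (hf'.symm.trans he.symm))
  exact (card_le_card hsub).trans card_image_le

theorem card_edgeNeighbors_cyclePath_le_three
    (he : (e : Set (CyclePathVertex k g r)) = cyclePathEdge p p.1) :
    #(edgeNeighbors (cyclePath k g r (.inr p)) e) ≤ 3 := by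
  refine (card_edgeNeighbors_cyclePath_le p he
    (T := {if (p.1 : ℕ) + 1 = g then 0 else (p.1 : ℕ) + 1,
      if (p.1 : ℕ) = 0 then g - 1 else (p.1 : ℕ) - 1, g}) fun n' hnn x hx hx' => ?_).trans
    card_le_three
  have hp := p.1.2
  simp only [mem_insert, mem_singleton]
  rcases lt_or_gt_of_ne hnn with hlt | hlt
  · obtain ⟨a, -, ha⟩ | ⟨-, hn⟩ | ⟨a, _, -, ha⟩ := cyclePathInc_inter_cases p hlt hx' hx <;>
      split_ifs <;> omega
  · obtain ⟨a, -, ha⟩ | ⟨-, hn⟩ | ⟨a, _, -, ha⟩ := cyclePathInc_inter_cases p hlt hx hx' <;>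
      split_ifs <;> omega

theorem card_edgeNeighbors_cyclePath_le_two
    (he : (e : Set (CyclePathVertex k g r)) = cyclePathEdge p n) (hn : n ≠ p.1) :
    #(edgeNeighbors (cyclePath k g r (.inr p)) e) ≤ 2 := by
  refine (card_edgeNeighbors_cyclePath_le p he (T := if n < g then
    {if n + 1 = g then 0 else n + 1, if n = 0 then g - 1 else n - 1} else
    {if n = g then (p.1 : ℕ) else n - 1, n + 1}) fun n' hnn x hx hx' => ?_).trans
    (by split_ifs <;> exact card_le_two)
  have := p.1.2
  rcases lt_or_gt_of_ne hnn with hlt | hlt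
  · obtain ⟨a, -, ha⟩ | ⟨-, hn⟩ | ⟨a, _, -, ha⟩ := cyclePathInc_inter_cases p hlt hx' hx <;>
      split_ifs <;> simp only [mem_insert, mem_singleton] <;> omega
  · obtain ⟨a, -, ha⟩ | ⟨-, hn⟩ | ⟨a, _, -, ha⟩ := cyclePathInc_inter_cases p hlt hx hx' <;>
      split_ifs <;> simp only [mem_insert, mem_singleton] <;> omega

end EdgeNeighbors

theorem exists_isLollipopCycle_cyclePath (hk : 3 ≤ k) (hg : 2 ≤ g) :
    ∃ a, IsLollipopCycle (cyclePath k g r (.inr p)) g a := by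
  obtain ⟨a, ha, hedge⟩ := exists_isEdgeCycle_of_isCycle (isCycle_cyclePath (r := r) p hk hg)
  have hfirst : (a (0 + p.1) : Set (CyclePathVertex k g r)) = cyclePathEdge p p.1 := by
    rw [zero_add, hedge]
  refine ⟨_, ha.shift p.1, card_edgeNeighbors_cyclePath_le_three p hfirst, fun e he hne => ?_⟩
  obtain ⟨n, -, hn⟩ := (mem_edgeSet_cyclePath p).1 (mem_edgeFamily.1 he)
  refine card_edgeNeighbors_cyclePath_le_two p hn.symm ?_
  rintro rfl
  exact hne (coe_injective (hn.symm.trans hfirst.symm))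

end UnicyclicHypergraph

/-! ### Comparison in `S_α`-order -/

namespace UnicyclicHypergraph

open Hypergraph Finset

section Image

variable {V W : Type*} {H : Hypergraph V} {k : ℕ}

theorem isUniform_image_equiv (hu : H.IsUniform k) (f : V ≃ W) : (H.image f).IsUniform k := by
  rintro _ ⟨e, he, rfl⟩
  rw [Set.ncard_image_of_injective _ f.injective, hu e he]

theorem isLinear_image_equiv (hl : H.IsLinear) (f : V ≃ W) : (H.image f).IsLinear := by
  rintro _ ⟨e, he, rfl⟩ _ ⟨e', he', rfl⟩ hne
  rw [← Set.image_inter f.injective]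
  exact (hl e he e' he' fun h => hne (h ▸ rfl)).image f

theorem ncard_edgeSet_image (H : Hypergraph V) (f : V ≃ W) :
    (H.image f).edgeSet.ncard = H.edgeSet.ncard :=
  Set.ncard_image_of_injective _ (Set.image_injective.2 f.injective)

variable [Fintype V] [Fintype W]

theorem sum_degree_pow_image (H : Hypergraph V) (f : V ≃ W) (t : ℕ) :
    ∑ w, (H.image f).degree w ^ t = ∑ v, H.degree v ^ t := by
  simp only [← f.sum_comp, degree_image]

theorem edgeFamily_image (H : Hypergraph V) (f : V ≃ W) :
    edgeFamily (H.image f) = (edgeFamily H).map (mapEmbedding f.toEmbedding).toEmbedding := by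
  refine (eq_of_subset_of_card_le (fun e he => ?_) ?_).symm
  · obtain ⟨s, hs, rfl⟩ := mem_map.1 he
    rw [mem_edgeFamily] at hs ⊢
    exact ⟨s, hs, by simp⟩
  · rw [card_map, card_edgeFamily, card_edgeFamily, ncard_edgeSet_image]

theorem sum_edge_sq_image (H : Hypergraph V) (f : V ≃ W) :
    ∑ e ∈ edgeFamily (H.image f), (∑ v ∈ e, (H.image f).degree v) ^ 2 =
      ∑ e ∈ edgeFamily H, (∑ v ∈ e, H.degree v) ^ 2 := by
  simp [edgeFamily_image, degree_image]

end Image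

variable {V W : Type*} {H : Hypergraph V} {H' : Hypergraph W} {k m g : ℕ} {α : ℝ}

theorem card_eq_card_of_isLinearUnicyclic [Fintype V] [Fintype W]
    (h : H.IsLinearUnicyclic k m g) (h' : H'.IsLinearUnicyclic k m g) (hk : k ≠ 0) :
    Fintype.card V = Fintype.card W :=
  Nat.add_right_cancel ((card_add_eq_mul_of_isLinearUnicyclic h hk).trans
    (card_add_eq_mul_of_isLinearUnicyclic h' hk).symm)

theorem add_two_lt_card_of_isLinearUnicyclic [Fintype V]
    (h : H.IsLinearUnicyclic k m g) (hk : 3 ≤ k) (hm : 3 ≤ m) : k + 2 < Fintype.card V := by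
  have hcard := card_add_eq_mul_of_isLinearUnicyclic h (by omega)
  nlinarith

theorem one_le_degree_of_isLinearUnicyclic [Finite V] (h : H.IsLinearUnicyclic k m g) (hk : 3 ≤ k)
    (hm : 3 ≤ m) (v : V) : 1 ≤ H.degree v := by
  have := Fintype.ofFinite V
  have hbig := add_two_lt_card_of_isLinearUnicyclic h hk hm
  have : Nontrivial V := Fintype.one_lt_card_iff_nontrivial.1 (by omega)
  exact one_le_degree_of_isConnected h.unicyclic.1 h.vertexSet_eq v

variable [Fintype V] [DecidableEq V] [Fintype W] [DecidableEq W]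

theorem SEq_of_iso (h : H.Iso H') (k : ℕ) (α : ℝ) : SEq k α H H' :=
  ⟨Fintype.card_congr h.choose, fun t _ => moment_eq_of_iso h k α t⟩

theorem not_SEq_of_SLT (h : SLT k α H H') : ¬ SEq k α H H' := fun h' => by
  obtain ⟨-, d, -, hd, -, hlt⟩ := h
  exact hlt.ne (h'.2 d hd)

theorem SLT_of_SLT_image (f : V ≃ W) (h : SLT k α (H.image f) H') : SLT k α H H' := by
  have hcard := Fintype.card_congr f
  have hmoment := moment_eq_of_iso (H := H) ⟨f, rfl⟩ k α
  obtain ⟨-, d, hd, hdlt, heq, hlt⟩ := h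
  exact ⟨hcard, d, hd, by rwa [hcard], fun t ht => (hmoment t).trans (heq t ht),
    (hmoment d).trans_lt hlt⟩

theorem IsLollipopCycle.iso (h : H.IsLinearUnicyclic k m g) (h' : H'.IsLinearUnicyclic k m g)
    (hk : k ≠ 0) (hg : 3 ≤ g) (hgm : g ≤ m) (hd : ∀ v, 1 ≤ H.degree v ∧ H.degree v ≤ 2)
    (hd' : ∀ v, 1 ≤ H'.degree v ∧ H'.degree v ≤ 2) {a : ℕ → Finset V} {a' : ℕ → Finset W}
    (ha : IsLollipopCycle H g a) (ha' : IsLollipopCycle H' g a') : H.Iso H' := by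
  obtain ⟨b, hb, hadj⟩ := ha.exists_isEdgeEnum hg h.unicyclic.1
    (nonempty_of_isUniform h.uniform hk) ((card_edgeFamily H).trans h.card_edges) hgm
  obtain ⟨b', hb', hadj'⟩ := ha'.exists_isEdgeEnum hg h'.unicyclic.1
    (nonempty_of_isUniform h'.uniform hk) ((card_edgeFamily H').trans h'.card_edges) hgm
  refine hb.iso hb' h.vertexSet_eq h'.vertexSet_eq h.uniform h'.uniform h.linear h'.linear hd hd'
    fun i hi j hj hij => ?_
  rcases lt_or_gt_of_ne hij with hlt | hlt
  · rw [hadj j hj i hlt, hadj' j hj i hlt]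
  · rw [inter_comm, inter_comm (b' i), hadj i hi j hlt, hadj' i hi j hlt]

theorem exists_isLollipopCycle_or_two_lt_sum_excess_sq (h : H.IsLinearUnicyclic k m g)
    (hk : k ≠ 0) (hg : 3 ≤ g) (hgm : g ≤ m) (hd : ∀ v, 1 ≤ H.degree v ∧ H.degree v ≤ 2) :
    (∃ a, IsLollipopCycle H g a) ∨ 2 < ∑ e ∈ edgeFamily H, excess H e ^ 2 := by
  rcases hgm.eq_or_lt with rfl | hlt
  · exact .inl (exists_isLollipopCycle_of_eq h hk hd hg rfl)
  · exact (le_or_gt _ _).imp_left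
      (exists_isLollipopCycle_of_sum_excess_sq_le_two h hk hd hg hlt)

section Comparison

variable (h : H.IsLinearUnicyclic k m g) (h' : H'.IsLinearUnicyclic k m g) (hk : 3 ≤ k)
  (hm : 3 ≤ m) (hα : α ≠ 0) (hd : ∀ v, H.degree v ≤ 2)
include h h' hk hm hα hd

theorem SLT_of_two_lt_degree {w : W} (hw : 2 < H'.degree w) : SLT k α H H' := by
  have hcard := card_eq_card_of_isLinearUnicyclic h h' (by omega)
  have hbig := add_two_lt_card_of_isLinearUnicyclic h' hk hm
  let f : V ≃ W := Fintype.equivOfCardEq hcard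
  refine SLT_of_SLT_image f (SLT_of_sum_degree_sq_lt hk (isUniform_image_equiv h.uniform f)
    h'.uniform (isLinear_image_equiv h.linear f) h'.linear
    (by rw [ncard_edgeSet_image, h.card_edges, h'.card_edges]) (by omega) hα ?_)
  -- `3 d - 2 ≤ d ^ 2` is an equality for `d = 1, 2`, hence for all the degrees of `H`.
  have hlt : ∑ v, (3 * (H'.degree v : ℤ) - 2) < ∑ v, (H'.degree v : ℤ) ^ 2 := by
    refine sum_lt_sum (fun v _ => ?_) ⟨w, mem_univ w, ?_⟩
    · rcases (one_le_degree_of_isLinearUnicyclic h' hk hm v).eq_or_lt with hv | hv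
      · rw [← hv]
        norm_num
      · zify at hv
        nlinarith
    · zify at hw
      nlinarith
  have hsum := sum_degree_pow_of_isLinearUnicyclic h
    (fun v => ⟨one_le_degree_of_isLinearUnicyclic h hk hm v, hd v⟩) 2
  rw [sum_sub_distrib, ← mul_sum, ← Nat.cast_sum, sum_degree h'.uniform, h'.card_edges, sum_const,
    card_univ, ← hcard, nsmul_eq_mul] at hlt
  rw [sum_degree_pow_image]
  zify
  push_cast at hlt
  linarith

theorem SLT_of_two_lt_sum_excess_sq (hα₁ : 0 < (1 - α) ^ k)
    (hd' : ∀ v, H'.degree v ≤ 2) {a : ℕ → Finset V} (ha : IsLollipopCycle H g a)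
    (hexcess : 2 < ∑ e ∈ edgeFamily H', excess H' e ^ 2) : SLT k α H H' := by
  have hcard := card_eq_card_of_isLinearUnicyclic h h' (by omega)
  let f : V ≃ W := Fintype.equivOfCardEq hcard
  replace hd : ∀ v, 1 ≤ H.degree v ∧ H.degree v ≤ 2 := fun v =>
    ⟨one_le_degree_of_isLinearUnicyclic h hk hm v, hd v⟩
  replace hd' : ∀ v, 1 ≤ H'.degree v ∧ H'.degree v ≤ 2 := fun v =>
    ⟨one_le_degree_of_isLinearUnicyclic h' hk hm v, hd' v⟩
  refine SLT_of_SLT_image f (SLT_of_sum_edge_sq_lt hk (isUniform_image_equiv h.uniform f)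
    h'.uniform (isLinear_image_equiv h.linear f) h'.linear
    (by rw [ncard_edgeSet_image, h.card_edges, h'.card_edges])
    (add_two_lt_card_of_isLinearUnicyclic h' hk hm) hα hα₁ (fun t => ?_) ?_)
  · have hsum := sum_degree_pow_of_isLinearUnicyclic h hd t
    rw [hcard, ← sum_degree_pow_of_isLinearUnicyclic h' hd'] at hsum
    rw [sum_degree_pow_image]
    exact_mod_cast hsum
  · rw [sum_edge_sq_image, ← Nat.cast_lt (α := ℤ),
      sum_edge_sq_eq_add_sum_excess_sq h (by omega) hd,
      sum_edge_sq_eq_add_sum_excess_sq h' (by omega) hd']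
    have hle := sum_excess_sq_le_two h (by omega) hd ha
    omega

end Comparison

theorem IsLollipopCycle.SLT_or_iso (h : H.IsLinearUnicyclic k m g)
    (h' : H'.IsLinearUnicyclic k m g) (hk : 3 ≤ k) (hg : 3 ≤ g) (hgm : g ≤ m) (hα : α ≠ 0)
    (hα₁ : 0 < (1 - α) ^ k) (hd : ∀ v, H.degree v ≤ 2) {a : ℕ → Finset V}
    (ha : IsLollipopCycle H g a) : SLT k α H H' ∨ H.Iso H' := by
  have hm := hg.trans hgm
  by_cases! hd' : ∃ w, 2 < H'.degree w
  · obtain ⟨w, hw⟩ := hd'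
    exact .inl (SLT_of_two_lt_degree h h' hk hm hα hd hw)
  have hpos := one_le_degree_of_isLinearUnicyclic h hk hm
  have hpos' := one_le_degree_of_isLinearUnicyclic h' hk hm
  obtain ⟨a', ha'⟩ | hexcess := exists_isLollipopCycle_or_two_lt_sum_excess_sq h' (by omega) hg hgm
    fun v => ⟨hpos' v, hd' v⟩
  · exact .inr (ha.iso h h' (by omega) hg hgm (fun v => ⟨hpos v, hd v⟩)
      (fun v => ⟨hpos' v, hd' v⟩) ha')
  · exact .inl (SLT_of_two_lt_sum_excess_sq h h' hk hm hα hd hα₁ hd' ha hexcess)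

end UnicyclicHypergraph

open UnicyclicHypergraph in
theorem mainTheorem12_general (k m g : ℕ) (hk : 3 ≤ k) (hg : 3 ≤ g) (hgm : g ≤ m)
    (α : ℝ) (hα₀ : α ≠ 0) (hα₁ : 0 < (1 - α) ^ k) :
    (∃ c, (Hypergraph.hypercycle k g).IsCored c) ∧
    ∀ c, (Hypergraph.hypercycle k g).IsCored c →
      (Hypergraph.cyclePath k g (m - g) c).IsLinearUnicyclic k m g ∧
      ∀ (V : Type u) [Fintype V] [DecidableEq V] (H : Hypergraph V),
        H.IsLinearUnicyclic k m g →
          Hypergraph.SLE k α (Hypergraph.cyclePath k g (m - g) c) H ∧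
          (Hypergraph.SEq k α (Hypergraph.cyclePath k g (m - g) c) H ↔
            Hypergraph.Iso (Hypergraph.cyclePath k g (m - g) c) H) := by
  refine ⟨⟨_, isCored_hypercycle_inr (⟨0, by omega⟩, ⟨0, by omega⟩)⟩, fun c hc => ?_⟩
  obtain ⟨p, rfl⟩ := (isCored_hypercycle_iff hk (by omega)).1 hc
  have h := isLinearUnicyclic_cyclePath (r := m - g) p hk hg
  rw [Nat.add_sub_cancel' hgm] at h
  refine ⟨h, fun V _ _ H hH => ?_⟩
  obtain ⟨a, ha⟩ := exists_isLollipopCycle_cyclePath (r := m - g) p hk (by omega)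
  rcases ha.SLT_or_iso h hH hk hg hgm hα₀ hα₁ (degree_cyclePath_le_two p) with hlt | hiso
  · exact ⟨.inl hlt, fun heq => absurd heq (not_SEq_of_SLT hlt), fun hiso => SEq_of_iso hiso k α⟩
  · exact ⟨.inr (SEq_of_iso hiso k α), fun _ => hiso, fun hiso => SEq_of_iso hiso k α⟩

theorem mainTheorem12 (k m g : ℕ) (hk : 3 ≤ k) (hg : 3 ≤ g) (hgm : g ≤ m)
    (α : ℝ) (hα₀ : 0 < α) (hα₁ : α < 1) :
    (∃ c, (Hypergraph.hypercycle k g).IsCored c) ∧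
    ∀ c, (Hypergraph.hypercycle k g).IsCored c →
      (Hypergraph.cyclePath k g (m - g) c).IsLinearUnicyclic k m g ∧
      ∀ (V : Type u) [Fintype V] [DecidableEq V] (H : Hypergraph V),
        H.IsLinearUnicyclic k m g →
          Hypergraph.SLE k α (Hypergraph.cyclePath k g (m - g) c) H ∧
          (Hypergraph.SEq k α (Hypergraph.cyclePath k g (m - g) c) H ↔
            Hypergraph.Iso (Hypergraph.cyclePath k g (m - g) c) H) :=
  mainTheorem12_general k m g hk hg hgm α hα₀.ne' (pow_pos (sub_pos.2 hα₁) k)
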